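/- **Setting.** Let $\mathbb{Q}$ be the quaternions and $\mathbb{DQ}=\{q_s+q_d\epsilon\}$, $\epsilon^2=0$, the dual quaternions; $\hat A=A_s+A_d\epsilon\in\mathbb{DQ}^{n\times n}$, and vectors $\hat{\mathbf x}=\mathbf x_s+\mathbf x_d\epsilon\in\mathbb{DQ}^n$. A vector is appreciable if $\mathbf x_s\ne0$. An eigenpair of $\hat A$ is $(\hat\lambda,\hat{\mathbf x})$ with $\hat A\hat{\mathbf x}=\hat{\mathbf x}\hat\lambda$ and $\hat{\mathbf x}$ appreciable; similarity is $\hat\lambda\mapsto \hat u^*\hat\lambda\hat u$ with $\hat u$ a unit dual quaternion. The multiplicity $\mathtt m(\hat\lambda,\hat A)$ is the maximal number of vectors in $\{\hat{\mathbf x}:\hat A\hat{\mathbf x}=\hat{\mathbf x}\hat\lambda\}$ whose standard parts are right linearly independent. A standard eigenvalue of $A_s$ is a right eigenvalue in $\mathbb C$ with nonnegative imaginary part; $\mathtt m_a$ and $\mathtt m_g$ are its algebraic and geometric multiplicities (sum of the sizes, respectively number, of its Jordan blocks). An eigenvalue of $\hat A$ is strict dominant if its standard part is strictly larger in magnitude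 than that of every eigenvalue of $\hat A$ not similar to it. *Assumption 2* for $\hat A$: some standard eigenvalue $\lambda$ of $A_s$ is strictly larger in magnitude than all other standard eigenvalues of $A_s$, and either (i) $\lambda\in\mathbb R$ and there is an eigenvalue $\lambda+\lambda_{d}\epsilon$ of $\hat A$ with $\lambda_d\in\mathbb R$ and $\mathtt m(\lambda+\lambda_d\epsilon,\hat A)=\mathtt m_a(\lambda,A_s)$; or (ii) there is an eigenvalue $\lambda+\lambda_{d}\epsilon$ of $\hat A$ with $\lambda_d\in\mathbb C$ and $\mathtt m(\lambda+\lambda_d\epsilon,\hat A)=\mathtt m_g(\lambda,A_s)=\mathtt m_a(\lambda,A_s)=1$. *Power method* from $\hat{\mathbf v}^{(0)}\in\mathbb{DQ}^n$: for $k\ge0$, $\hat{\mathbf y}^{(k+1)}=\hat A\hat{\mathbf v}^{(k)}$, $\hat\lambda^{(k)}=(\hat{\mathbf v}^{(k)})^*\hat{\mathbf y}^{(k+1)}$, $\hat{\mathbf v}^{(k+1)}=\hat{\mathbf y}^{(k+1)}/\|\hat{\mathbf y}^{(k+1)}\|_2$, where $\|\hat{\mathbf x}\|_2=\|\mathbf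 x_s\|_2+\frac{\mathbf x_s^*\mathbf x_d+\mathbf x_d^*\mathbf x_s}{2\|\mathbf x_s\|_2}\epsilon$ for appreciable $\hat{\mathbf x}$. With $\|\hat{\mathbf x}\|_{2^R}=\sqrt{\|\mathbf x_s\|_2^2+\|\mathbf x_d\|_2^2}$, the residual is $r_k=\|\hat{\mathbf y}^{(k+1)}-\hat{\mathbf v}^{(k)}\hat\lambda^{(k)}\|_{2^R}$. **Theorem 3.7.** Let $\lambda_{1s}$ be a standard eigenvalue of $A_s$ of maximal magnitude, let $\lambda_{1s}\neq0$, and suppose that $\hat A$ violates Assumption 2. Write "$\lambda_{1s}$ is strictly largest" if every other standard eigenvalue of $A_s$ is strictly smaller in magnitude. Then $\hat A$ is in one of the following cases: 1. another standard eigenvalue of $A_s$ has magnitude $|\lambda_{1s}|$; 2. $\lambda_{1s}$ is strictly largest and $\mathtt m_a(\lambda_{1s},A_s)>\mathtt m_g(\lambda_{1s},A_s)$; 3. $\lambda_{1s}$ is strictly largest, $\mathtt m_a(\lambda_{1s},A_s)=\mathtt m_g(\lambda_{1s},A_s)>1$ and $\lambda_{1s}\notin\mathbb R$; 4. $\lambda_{1s}$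 is strictly largest and real, $\mathtt m_a(\lambda_{1s},A_s)=\mathtt m_g(\lambda_{1s},A_s)$, and $\hat A$ has an eigenvalue $\lambda_{1s}+\lambda_{1d}\epsilon$, $\lambda_{1d}\in\mathbb C$, with $\mathtt m(\lambda_{1s}+\lambda_{1d}\epsilon,\hat A)<\mathtt m_a(\lambda_{1s},A_s)$; 5. $\lambda_{1s}$ is strictly largest and real, $\mathtt m_a(\lambda_{1s},A_s)=\mathtt m_g(\lambda_{1s},A_s)$, and $\hat A$ has an eigenvalue $\lambda_{1s}+\lambda_{1d}\epsilon$, $\lambda_{1d}\in\mathbb C\setminus\mathbb R$, with $\mathtt m(\lambda_{1s}+\lambda_{1d}\epsilon,\hat A)=\mathtt m_a(\lambda_{1s},A_s)>1$. Moreover, in every case the power method fails for generic initial vectors: there is a nonzero real polynomial $p$ in the $4n$ real coordinates of $\mathbf v_s^{(0)}$, depending only on $\hat A$, such that for every $\hat{\mathbf v}^{(0)}$ with $p(\mathbf v_s^{(0)})\ne0$ the following hold. (a) All $\hat{\mathbf y}^{(k)}$ are appreciable, so the iteration is well defined. (b) The method does not yield a strict dominant eigenpair: if $\hat\lambda$ is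 a strict dominant eigenvalue of $\hat A$, there are no eigenvectors $\hat{\mathbf w}^{(k)}$ of $\hat A$ with eigenvalues similar to $\hat\lambda$ such that $\|\hat{\mathbf v}^{(k)}-\hat{\mathbf w}^{(k)}\|_{2^R}\to0$. (c) The method does not converge linearly to eigenpairs: for no $c\in(0,1)$ is $r_k=O(c^k)$, and for no $c\in(0,1)$ are there eigenvectors $\hat{\mathbf w}^{(k)}$ of $\hat A$ (for any eigenvalues) with $\|\hat{\mathbf v}^{(k)}-\hat{\mathbf w}^{(k)}\|_{2^R}=O(c^k)$. (d) If $\mathtt m_a(\mu,A_s)=\mathtt m_g(\mu,A_s)$ for all standard eigenvalues $\mu$ of $A_s$ with $|\mu|=|\lambda_{1s}|$ (which is automatic in cases 3, 4 and 5), then no eigenpair at all is produced: there are no eigenvectors $\hat{\mathbf w}^{(k)}$ of $\hat A$ with $\|\hat{\mathbf v}^{(k)}-\hat{\mathbf w}^{(k)}\|_{2^R}\to0$, and there is $\delta>0$ with $r_k\ge\delta$ for all $k$. Hence Assumption 2 is also necessary for the convergence of the power method. -/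

import Mathlib

open Filter Topology
open scoped Matrix Quaternion

namespace DQPower

noncomputable section

/-- The quaternions. -/
abbrev Quat : Type := ℍ[ℝ]

/-- The dual quaternions `q_s + q_d ε`, `ε ^ 2 = 0`, with `ε` central;
`q.fst` is the standard part and `q.snd` the dual part. -/
abbrev DualQuat : Type := DualNumber Quat

/-- The conjugate `q_s^* + q_d^* ε`. -/
def conj (q : DualQuat) : DualQuat :=
  TrivSqZeroExt.inl (star q.fst) + TrivSqZeroExt.inr (star q.snd)

/-- The dual quaternion `a + b ε` with complex `a`, `b`. -/
def dualComplex (a b : ℂ) : DualQuat :=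
  TrivSqZeroExt.inl (a : Quat) + TrivSqZeroExt.inr (b : Quat)

/-- A dual (real) number viewed as a dual quaternion. -/
def ofDualReal (a : DualNumber ℝ) : DualQuat :=
  TrivSqZeroExt.inl (a.fst : Quat) + TrivSqZeroExt.inr (a.snd : Quat)

/-- A unit dual quaternion: `|u| = 1`, equivalently `u^* u = 1`. -/
def IsUnitDQ (u : DualQuat) : Prop := conj u * u = 1

/-- Similarity of dual quaternions: `q = u^* p u` for a unit dual quaternion `u`. -/
def Similar (p q : DualQuat) : Prop := ∃ u : DualQuat, IsUnitDQ u ∧ conj u * p * u = q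

/-! ### Vectors -/

variable {n : ℕ}

/-- Standard part of a dual quaternion vector. -/
def stVec (x : Fin n → DualQuat) : Fin n → Quat := fun i => (x i).fst

/-- Multiplication of a vector by a scalar from the right. -/
def rsmul {R : Type*} [Mul R] (x : Fin n → R) (q : R) : Fin n → R := fun i => x i * q

/-- The 2-norm of a quaternion vector. -/
def norm2 (x : Fin n → Quat) : ℝ := Real.sqrt (∑ i, ‖x i‖ ^ 2)

/-- The 2-norm of a dual quaternion vector, a dual number: it is
`‖x_s‖ + (x_s^* x_d + x_d^* x_s) / (2 ‖x_s‖) ε` if `x_s ≠ 0`, and `‖x_d‖ ε` otherwise.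
(The quaternion `x_s^* x_d + x_d^* x_s` is real.) -/
def dualNorm (x : Fin n → DualQuat) : DualNumber ℝ :=
  open Classical in
  if stVec x ≠ 0 then
    TrivSqZeroExt.inl (norm2 (stVec x)) +
      TrivSqZeroExt.inr
        ((∑ i, (star (x i).fst * (x i).snd + star (x i).snd * (x i).fst)).re
          / (2 * norm2 (stVec x)))
  else
    TrivSqZeroExt.inr (norm2 fun i => (x i).snd)

/-- The `2^R`-norm `√(‖x_s‖² + ‖x_d‖²)`. -/
def normR (x : Fin n → DualQuat) : ℝ :=
  Real.sqrt (norm2 (fun i => (x i).fst) ^ 2 + norm2 (fun i => (x i).snd) ^ 2)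

/-- `x^* y`. -/
def dot (x y : Fin n → DualQuat) : DualQuat := ∑ i, conj (x i) * y i

/-! ### Quaternion matrices -/

/-- `μ ∈ ℂ` is a standard eigenvalue of the quaternion matrix `B`: a right eigenvalue that is a
complex number with nonnegative imaginary part. -/
def IsStandardEigenvalue (B : Matrix (Fin n) (Fin n) Quat) (μ : ℂ) : Prop :=
  0 ≤ μ.im ∧ ∃ x : Fin n → Quat, x ≠ 0 ∧ B *ᵥ x = rsmul x (μ : Quat)

/-- The additive map `x ↦ B x - x μ`; its kernel is the eigenspace of `μ`, and on a Jordan chain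
`B x_1 = x_1 μ`, `B x_{j+1} = x_{j+1} μ + x_j` it is the shift. -/
def eigMap (B : Matrix (Fin n) (Fin n) Quat) (μ : ℂ) (x : Fin n → Quat) : Fin n → Quat :=
  B *ᵥ x - rsmul x (μ : Quat)

/-- Geometric multiplicity of `μ` (the number of Jordan blocks of `μ`): the maximal number of
right linearly independent eigenvectors. Right linear independence in `ℍ^n` is linear independence
over the opposite ring of `ℍ`, and `Set.finrank` is the dimension of the right span of a set, that
is, the cardinality of a maximal right linearly independent subset. -/
def geomMult (μ : ℂ) (B : Matrix (Fin n) (Fin n) Quat) : ℕ :=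
  Set.finrank Quatᵐᵒᵖ {x : Fin n → Quat | eigMap B μ x = 0}

/-- Algebraic multiplicity of `μ` (the sum of the sizes of the Jordan blocks of `μ`): the maximal
number of right linearly independent generalized eigenvectors. -/
def algMult (μ : ℂ) (B : Matrix (Fin n) (Fin n) Quat) : ℕ :=
  Set.finrank Quatᵐᵒᵖ {x : Fin n → Quat | ∃ j : ℕ, (eigMap B μ)^[j] x = 0}

/-! ### Dual quaternion matrices -/

/-- Standard part of a dual quaternion matrix. -/
def stMat (A : Matrix (Fin n) (Fin n) DualQuat) : Matrix (Fin n) (Fin n) Quat :=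
  fun i j => (A i j).fst

/-- `x` is an (appreciable) right eigenvector of `A` for the right eigenvalue `μ`. -/
def IsEigenpair (A : Matrix (Fin n) (Fin n) DualQuat) (μ : DualQuat) (x : Fin n → DualQuat) :
    Prop :=
  stVec x ≠ 0 ∧ A *ᵥ x = rsmul x μ

/-- `μ` is a right eigenvalue of `A`. -/
def IsEigenvalue (A : Matrix (Fin n) (Fin n) DualQuat) (μ : DualQuat) : Prop :=
  ∃ x, IsEigenpair A μ x

/-- The multiplicity of `μ` as an eigenvalue of `A`: the maximal number of appreciably linearly
independent vectors (vectors with right linearly independent standard parts) in the eigenspace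
`{x | A x = x μ}`. -/
def mult (μ : DualQuat) (A : Matrix (Fin n) (Fin n) DualQuat) : ℕ :=
  Set.finrank Quatᵐᵒᵖ (stVec '' {x : Fin n → DualQuat | A *ᵥ x = rsmul x μ})

/-- `μ` is a strict dominant eigenvalue of `A`: its standard part is larger in magnitude than that
of every other eigenvalue. As eigenvalues come in similarity classes, "other" is understood up to
similarity. -/
def IsStrictDominant (A : Matrix (Fin n) (Fin n) DualQuat) (μ : DualQuat) : Prop :=
  IsEigenvalue A μ ∧ ∀ ν, IsEigenvalue A ν → ¬ Similar μ ν → ‖ν.fst‖ < ‖μ.fst‖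

/-- `|l|` is larger than the magnitude of any other standard eigenvalue of `B`. -/
def StrictlyLargest (B : Matrix (Fin n) (Fin n) Quat) (l : ℂ) : Prop :=
  ∀ μ : ℂ, IsStandardEigenvalue B μ → μ ≠ l → ‖μ‖ < ‖l‖

/-- The spectral condition whose necessity for the power method is at stake. -/
def SpectralAssumption (A : Matrix (Fin n) (Fin n) DualQuat) : Prop :=
  ∃ l : ℂ, IsStandardEigenvalue (stMat A) l ∧ StrictlyLargest (stMat A) l ∧
    ((l.im = 0 ∧ ∃ d : ℝ, IsEigenvalue A (dualComplex l d) ∧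
        mult (dualComplex l d) A = algMult l (stMat A)) ∨
      (∃ d : ℂ, IsEigenvalue A (dualComplex l d) ∧ mult (dualComplex l d) A = 1 ∧
        geomMult l (stMat A) = 1 ∧ algMult l (stMat A) = 1))

/-- Another standard eigenvalue has the same magnitude as `l`. -/
def CaseI (A : Matrix (Fin n) (Fin n) DualQuat) (l : ℂ) : Prop :=
  ∃ μ : ℂ, IsStandardEigenvalue (stMat A) μ ∧ μ ≠ l ∧ ‖μ‖ = ‖l‖

/-- `l` is strictly largest and defective. -/
def CaseII (A : Matrix (Fin n) (Fin n) DualQuat) (l : ℂ) : Prop :=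
  StrictlyLargest (stMat A) l ∧ geomMult l (stMat A) < algMult l (stMat A)

/-- `l` is strictly largest, semisimple, multiple and not real. -/
def CaseIII (A : Matrix (Fin n) (Fin n) DualQuat) (l : ℂ) : Prop :=
  StrictlyLargest (stMat A) l ∧ algMult l (stMat A) = geomMult l (stMat A) ∧
    1 < geomMult l (stMat A) ∧ l.im ≠ 0

/-- `l` is strictly largest, semisimple and real, and `A` has an eigenvalue above it of too small
multiplicity. -/
def CaseIV (A : Matrix (Fin n) (Fin n) DualQuat) (l : ℂ) : Prop :=
  StrictlyLargest (stMat A) l ∧ algMult l (stMat A) = geomMult l (stMat A) ∧ l.im = 0 ∧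
    ∃ d : ℂ, IsEigenvalue A (dualComplex l d) ∧
      mult (dualComplex l d) A < algMult l (stMat A)

/-- `l` is strictly largest, semisimple and real, and `A` has an eigenvalue above it of full
multiplicity greater than one, with dual part not real. -/
def CaseV (A : Matrix (Fin n) (Fin n) DualQuat) (l : ℂ) : Prop :=
  StrictlyLargest (stMat A) l ∧ algMult l (stMat A) = geomMult l (stMat A) ∧ l.im = 0 ∧
    ∃ d : ℂ, d.im ≠ 0 ∧ IsEigenvalue A (dualComplex l d) ∧
      mult (dualComplex l d) A = algMult l (stMat A) ∧ 1 < algMult l (stMat A)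

/-! ### The power method -/

/-- The iterates `v^(k)`: `y^(k+1) = A v^(k)`, `v^(k+1) = y^(k+1) / ‖y^(k+1)‖₂`. The division is the
division by an invertible dual number when `y^(k+1)` is appreciable; otherwise the method breaks
down and the value here is a convention. -/
def pmVec (A : Matrix (Fin n) (Fin n) DualQuat) (v0 : Fin n → DualQuat) : ℕ → Fin n → DualQuat
  | 0 => v0
  | k + 1 => rsmul (A *ᵥ pmVec A v0 k) (ofDualReal (dualNorm (A *ᵥ pmVec A v0 k))⁻¹)

/-- The eigenvalue estimates `λ^(k) = (v^(k))^* y^(k+1)`. -/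
def pmVal (A : Matrix (Fin n) (Fin n) DualQuat) (v0 : Fin n → DualQuat) (k : ℕ) : DualQuat :=
  dot (pmVec A v0 k) (A *ᵥ pmVec A v0 k)

/-- The residual `‖y^(k+1) - v^(k) λ^(k)‖` in the `2^R`-norm, which the stopping criterion compares
with the tolerance. -/
def pmResidual (A : Matrix (Fin n) (Fin n) DualQuat) (v0 : Fin n → DualQuat) (k : ℕ) : ℝ :=
  normR (A *ᵥ pmVec A v0 k - rsmul (pmVec A v0 k) (pmVal A v0 k))

/-- The power method never breaks down: all `y^(k)` are appreciable. -/
def WellDefined (A : Matrix (Fin n) (Fin n) DualQuat) (v0 : Fin n → DualQuat) : Prop :=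
  ∀ k, stVec (A *ᵥ pmVec A v0 k) ≠ 0

/-- The iterates approach eigenvectors: `v^(k) - w^(k) → 0` for some eigenvectors `w^(k)` with
eigenvalues in the set `S`. (Even in the good cases the vectors `v^(k)` need not converge to one
fixed eigenvector, only to a sequence of eigenvectors with similar eigenvalues.) -/
def ApproachesEigenvectors (A : Matrix (Fin n) (Fin n) DualQuat) (v0 : Fin n → DualQuat)
    (S : Set DualQuat) : Prop :=
  ∃ w : ℕ → Fin n → DualQuat, (∀ k, ∃ μ ∈ S, IsEigenpair A μ (w k)) ∧
    Tendsto (fun k => normR (pmVec A v0 k - w k)) atTop (𝓝 0)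

/-- The same, at the linear rate `c ^ k`. -/
def ApproachesEigenvectorsAtRate (A : Matrix (Fin n) (Fin n) DualQuat) (v0 : Fin n → DualQuat)
    (c : ℝ) : Prop :=
  ∃ w : ℕ → Fin n → DualQuat, (∀ k, ∃ μ, IsEigenpair A μ (w k)) ∧
    (fun k => normR (pmVec A v0 k - w k)) =O[atTop] (fun k => c ^ k)

/-- The `4 n` real coordinates of a quaternion vector. -/
def coords (x : Fin n → Quat) : Fin n × Fin 4 → ℝ :=
  fun ij => ![(x ij.1).re, (x ij.1).imI, (x ij.1).imJ, (x ij.1).imK] ij.2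

end

end DQPower

open DQPower

namespace DQPower

noncomputable section

variable {n : ℕ}

/-! ### Right scalar multiplication and the shift `x ↦ B x - x q` -/

/-! Write `B` and `C` for the standard and dual parts of the matrix, `x` for the standard part of
the start, and `ρ` for the maximal magnitude of an eigenvalue of `B`. From index one on, the
standard part of the iterate is `B ^ k x` normalized, so failure is mostly a question about powers
of `B`. "Generic" means that a quaternion-valued polynomial in `x`, which is nonzero at one explicit
point, does not vanish; its squared norm is the required real polynomial.

The classification is short. A semisimple strictly largest `l` of geometric multiplicity one always
satisfies the assumption, so otherwise the multiplicity exceeds one. If moreover `l` is real,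
degenerate first-order perturbation theory provides an eigenvalue `l + d ε`, and only the last two
cases remain.

If some eigenvalue `ν` of magnitude `ρ` is defective, it has a left chain `a B = ν a`, `b B = ν b +
a`, and generically `a x ≠ 0`. Pairing with `a` and `b` excludes any geometric rate
(`not_geometric_of_chain`). The powers grow at least like `k ρ ^ k`, whereas a projection onto the
standard parts of strict dominant eigenvectors sees growth `ρ ^ k` only
(`not_approaches_strictDominant`).

If all eigenvalues of magnitude `ρ` are semisimple and there are two of them, or one that is nonreal
and multiple, then two left eigenvectors yield a defect of constant norm that vanishes at every
eigenvector (`exists_delta_of_two_rows`). There remains a real, strictly largest, semisimple `l`.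
Here the standard parts do approach eigenvectors of `B`, but not ones that lift to eigenvectors of
the dual matrix. With the spectral projection `Q`, a liftable `ξ` in the eigenspace must satisfy `Q
C ξ ∈ ξ ℍ`. If all `ξ` did, `Q C` would be a real scalar there and the assumption would hold
(`exists_eigenvector_not_liftable`). The component of `Q C ξ` orthogonal to `ξ` also keeps the
residual away from zero (`Reduction.exists_delta`). -/

theorem rsmul_eq_op_smul {R : Type*} [Mul R] (x : Fin n → R) (q : R) :
    rsmul x q = MulOpposite.op q • x := rfl

@[simp] theorem rsmul_apply {R : Type*} [Mul R] (x : Fin n → R) (q : R) (i : Fin n) :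
    rsmul x q i = x i * q := rfl

theorem rsmul_rsmul {R : Type*} [Semigroup R] (x : Fin n → R) (p q : R) : rsmul (rsmul x p) q = rsmul x (p * q) := by
  ext1 i; simp [mul_assoc]

theorem rsmul_add (x y : Fin n → Quat) (q : Quat) : rsmul (x + y) q = rsmul x q + rsmul y q := by
  ext1 i; simp [add_mul]

theorem rsmul_sub (x y : Fin n → Quat) (q : Quat) : rsmul (x - y) q = rsmul x q - rsmul y q := by
  ext1 i; simp [sub_mul]

theorem add_rsmul (x : Fin n → Quat) (p q : Quat) : rsmul x (p + q) = rsmul x p + rsmul x q := by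
  ext1 i; simp [mul_add]

theorem sub_rsmul (x : Fin n → Quat) (p q : Quat) : rsmul x (p - q) = rsmul x p - rsmul x q := by
  ext1 i; simp [mul_sub]

@[simp] theorem rsmul_one (x : Fin n → Quat) : rsmul x 1 = x := by ext1 i; simp

@[simp] theorem rsmul_zero (x : Fin n → Quat) : rsmul x (0 : Quat) = 0 := by ext1 i; simp

@[simp] theorem zero_rsmul (q : Quat) : rsmul (0 : Fin n → Quat) q = 0 := by ext1 i; simp

theorem norm_rsmul (x : Fin n → Quat) (q : Quat) : ‖rsmul x q‖ = ‖x‖ * ‖q‖ := by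
  rw [rsmul_eq_op_smul, norm_smul, MulOpposite.norm_op, mul_comm]

theorem rsmul_coe (x : Fin n → Quat) (r : ℝ) : rsmul x (r : Quat) = r • x := by
  ext1 i; simp [← Quaternion.coe_mul_eq_smul, Quaternion.coe_commutes]

theorem mulVec_rsmul {R : Type*} [Semiring R] (B : Matrix (Fin n) (Fin n) R) (x : Fin n → R)
    (q : R) :
    B *ᵥ rsmul x q = rsmul (B *ᵥ x) q := by
  rw [rsmul_eq_op_smul, Matrix.mulVec_smul]; rfl

theorem dotProduct_rsmul (a x : Fin n → Quat) (q : Quat) : a ⬝ᵥ rsmul x q = (a ⬝ᵥ x) * q := by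
  simp [dotProduct, Finset.sum_mul, mul_assoc]

instance : Module.Finite Quatᵐᵒᵖ (Fin n → Quat) :=
  Module.Finite.of_restrictScalars_finite ℝ Quatᵐᵒᵖ (Fin n → Quat)

/-- A quaternion matrix as a right linear map. -/
def matLin (B : Matrix (Fin n) (Fin n) Quat) : (Fin n → Quat) →ₗ[Quatᵐᵒᵖ] (Fin n → Quat) where
  toFun x := B *ᵥ x
  map_add' := Matrix.mulVec_add B
  map_smul' q x := Matrix.mulVec_smul B q x

@[simp] theorem matLin_apply (B : Matrix (Fin n) (Fin n) Quat) (x : Fin n → Quat) :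
    matLin B x = B *ᵥ x := rfl

theorem map_rsmul (f : (Fin n → Quat) →ₗ[Quatᵐᵒᵖ] (Fin n → Quat)) (x : Fin n → Quat) (q : Quat) :
    f (rsmul x q) = rsmul (f x) q := by
  rw [rsmul_eq_op_smul, map_smul]; rfl

theorem exists_norm_le (f : (Fin n → Quat) →ₗ[ℝ] (Fin n → Quat)) :
    ∃ C : ℝ, 0 < C ∧ ∀ x, ‖f x‖ ≤ C * ‖x‖ := by
  refine ⟨‖LinearMap.toContinuousLinearMap f‖ + 1, by positivity, fun x => ?_⟩
  have := (LinearMap.toContinuousLinearMap f).le_opNorm x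
  simp only [LinearMap.coe_toContinuousLinearMap'] at this
  nlinarith [norm_nonneg x]

theorem exists_norm_map_le (f : (Fin n → Quat) →ₗ[Quatᵐᵒᵖ] (Fin n → Quat)) :
    ∃ C : ℝ, 0 < C ∧ ∀ x, ‖f x‖ ≤ C * ‖x‖ :=
  exists_norm_le (f.restrictScalars ℝ)

theorem exists_norm_mulVec_le (B : Matrix (Fin n) (Fin n) Quat) :
    ∃ C : ℝ, 0 < C ∧ ∀ x, ‖B *ᵥ x‖ ≤ C * ‖x‖ :=
  exists_norm_map_le (matLin B)

theorem exists_norm_dotProduct_le (a : Fin n → Quat) :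
    ∃ C : ℝ, 0 < C ∧ ∀ x, ‖a ⬝ᵥ x‖ ≤ C * ‖x‖ := by
  refine ⟨(∑ i, ‖a i‖) + 1, by positivity, fun x => ?_⟩
  calc ‖a ⬝ᵥ x‖ ≤ ∑ i, ‖a i‖ * ‖x i‖ := by
        refine (norm_sum_le _ _).trans (Finset.sum_le_sum fun i _ => (norm_mul _ _).le)
    _ ≤ ∑ i, ‖a i‖ * ‖x‖ := by gcongr with i; exact norm_le_pi_norm x i
    _ ≤ _ := by rw [← Finset.sum_mul]; nlinarith [norm_nonneg x]

/-- The real linear map `x ↦ B x - x q`. -/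
def shift (B : Matrix (Fin n) (Fin n) Quat) (q : Quat) :
    (Fin n → Quat) →ₗ[ℝ] (Fin n → Quat) where
  toFun x := B *ᵥ x - rsmul x q
  map_add' x y := by rw [Matrix.mulVec_add, rsmul_add]; abel
  map_smul' r x := by
    have h : rsmul (r • x) q = r • rsmul x q := by ext1 i; simp
    simp only [h, Matrix.mulVec_smul, RingHom.id_apply, smul_sub]

@[simp] theorem shift_apply (B : Matrix (Fin n) (Fin n) Quat) (q : Quat) (x : Fin n → Quat) :
    shift B q x = B *ᵥ x - rsmul x q := rfl

theorem eigMap_eq_shift (B : Matrix (Fin n) (Fin n) Quat) (μ : ℂ) : eigMap B μ = shift B μ := rfl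

theorem eigMap_iterate (B : Matrix (Fin n) (Fin n) Quat) (μ : ℂ) (j : ℕ) (x : Fin n → Quat) :
    (eigMap B μ)^[j] x = (shift B μ ^ j) x := by
  rw [Module.End.pow_apply, eigMap_eq_shift]

theorem pow_succ_mulVec (B : Matrix (Fin n) (Fin n) Quat) (k : ℕ) (x : Fin n → Quat) :
    (B ^ (k + 1)) *ᵥ x = B *ᵥ (B ^ k *ᵥ x) := by
  rw [pow_succ', Matrix.mulVec_mulVec]

/-- Left multiplication by `B` commutes with right multiplication by `q`. Hence the eigenvector
defect of `B ^ k x` is the power applied to the defect of `x`. -/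
theorem pow_mulVec_shift (B : Matrix (Fin n) (Fin n) Quat) (q : Quat) (k : ℕ) (x : Fin n → Quat) :
    B ^ k *ᵥ shift B q x = B *ᵥ (B ^ k *ᵥ x) - rsmul (B ^ k *ᵥ x) q := by
  rw [← pow_succ_mulVec, pow_succ, shift_apply, Matrix.mulVec_sub, mulVec_rsmul,
    Matrix.mulVec_mulVec]

theorem pow_mulVec_of_eigenvector {B : Matrix (Fin n) (Fin n) Quat} {q : Quat} {x : Fin n → Quat}
    (h : B *ᵥ x = rsmul x q) (k : ℕ) : B ^ k *ᵥ x = rsmul x (q ^ k) := by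
  induction k with
  | zero => simp
  | succ k ih => rw [pow_succ_mulVec, ih, mulVec_rsmul, h, rsmul_rsmul, pow_succ']

/-! ### The real pairing of rows and columns -/

theorem re_mul_comm (p q : Quat) : (p * q).re = (q * p).re := by
  simp; ring

theorem re_dotProduct_rsmul (b x : Fin n → Quat) (q : Quat) :
    (b ⬝ᵥ rsmul x q).re = ((q • b) ⬝ᵥ x).re := by
  rw [dotProduct_rsmul, smul_dotProduct, re_mul_comm, smul_eq_mul]

/-- For nonreal `q` the shift is not right linear over the quaternions. The real pairing `Re (b x)`
still gives it an adjoint, namely `b ↦ b B - q b`, because real parts of products are cyclic. -/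
theorem re_dotProduct_shift (B : Matrix (Fin n) (Fin n) Quat) (b x : Fin n → Quat) (q : Quat) :
    (b ⬝ᵥ shift B q x).re = ((b ᵥ* B - q • b) ⬝ᵥ x).re := by
  rw [shift_apply, dotProduct_sub, sub_dotProduct, Quaternion.re_sub, Quaternion.re_sub,
    re_dotProduct_rsmul, Matrix.dotProduct_mulVec]

/-- The quaternion with the given coordinates. -/
def quatMk (a b c d : ℝ) : Quat := ⟨a, b, c, d⟩

@[simp] theorem re_quatMk (a b c d : ℝ) : (quatMk a b c d).re = a := rfl
@[simp] theorem imI_quatMk (a b c d : ℝ) : (quatMk a b c d).imI = b := rfl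
@[simp] theorem imJ_quatMk (a b c d : ℝ) : (quatMk a b c d).imJ = c := rfl
@[simp] theorem imK_quatMk (a b c d : ℝ) : (quatMk a b c d).imK = d := rfl

/-- The real part as a linear map. -/
def reLin : Quat →ₗ[ℝ] ℝ where
  toFun q := q.re
  map_add' _ _ := rfl
  map_smul' _ _ := rfl

theorem re_sum {ι : Type*} (s : Finset ι) (g : ι → Quat) : (∑ i ∈ s, g i).re = ∑ i ∈ s, (g i).re :=
  map_sum reLin g s

/-- A quaternion vector in terms of the standard real basis. -/
theorem eq_sum_coords (x : Fin n → Quat) :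
    x = ∑ i : Fin n, ((x i).re • Pi.single (M := fun _ : Fin n => Quat) i (quatMk 1 0 0 0)
      + (x i).imI • Pi.single (M := fun _ : Fin n => Quat) i (quatMk 0 1 0 0)
      + (x i).imJ • Pi.single (M := fun _ : Fin n => Quat) i (quatMk 0 0 1 0)
      + (x i).imK • Pi.single (M := fun _ : Fin n => Quat) i (quatMk 0 0 0 1)) := by
  conv_lhs => rw [← Finset.univ_sum_single x]
  refine Finset.sum_congr rfl fun i _ => ?_
  simp only [← Pi.single_smul, ← Pi.single_add]
  congr 1
  ext <;> simp

theorem exists_re_dotProduct (f : (Fin n → Quat) →ₗ[ℝ] ℝ) :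
    ∃ b : Fin n → Quat, ∀ x, f x = (b ⬝ᵥ x).re := by
  refine ⟨fun i => quatMk (f (Pi.single i (quatMk 1 0 0 0))) (-f (Pi.single i (quatMk 0 1 0 0)))
    (-f (Pi.single i (quatMk 0 0 1 0))) (-f (Pi.single i (quatMk 0 0 0 1))), fun x => ?_⟩
  conv_lhs => rw [eq_sum_coords x]
  simp only [map_sum, map_add, map_smul, smul_eq_mul, dotProduct, re_sum, Quaternion.re_mul,
    re_quatMk, imI_quatMk, imJ_quatMk, imK_quatMk]
  refine Finset.sum_congr rfl fun i _ => ?_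
  ring

theorem eq_zero_of_re_dotProduct {b : Fin n → Quat} (h : ∀ x, (b ⬝ᵥ x).re = 0) : b = 0 := by
  classical
  ext1 i
  have := h (Pi.single i (star (b i)))
  rw [dotProduct_single, Quaternion.self_mul_star, Quaternion.re_coe] at this
  simpa using this

theorem vecMul_eq_of_re {B : Matrix (Fin n) (Fin n) Quat} {q : Quat} {b : Fin n → Quat}
    (h : ∀ x, (b ⬝ᵥ shift B q x).re = 0) : b ᵥ* B = q • b := by
  rw [← sub_eq_zero]
  exact eq_zero_of_re_dotProduct fun x => by rw [← re_dotProduct_shift, h]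

/-- A vector outside a real subspace is separated from it by a row vector. -/
theorem exists_row_of_notMem {W : Submodule ℝ (Fin n → Quat)} {y : Fin n → Quat} (hy : y ∉ W) :
    ∃ b : Fin n → Quat, (∀ x ∈ W, (b ⬝ᵥ x).re = 0) ∧ (b ⬝ᵥ y).re ≠ 0 := by
  obtain ⟨f, hfy, hf⟩ := Submodule.exists_le_ker_of_notMem hy
  obtain ⟨b, hb⟩ := exists_re_dotProduct f
  exact ⟨b, fun x hx => by rw [← hb]; exact hf hx, by rwa [← hb]⟩

/-- A real functional that kills the range of the shift is represented by a row killed by the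
adjoint, that is, by a left eigenvector. -/
theorem exists_left_eigenvector_of_notMem {B : Matrix (Fin n) (Fin n) Quat} {q : Quat}
    {y : Fin n → Quat} (hy : y ∉ (shift B q).range) :
    ∃ a : Fin n → Quat, a ᵥ* B = q • a ∧ a ⬝ᵥ y ≠ 0 := by
  obtain ⟨b, hb, hby⟩ := exists_row_of_notMem hy
  exact ⟨b, vecMul_eq_of_re fun x => hb _ ⟨x, rfl⟩, fun h => hby (by rw [h]; rfl)⟩

/-- The shift is a real endomorphism in finite dimension, so a nontrivial kernel makes it
non-surjective. -/
theorem exists_left_eigenvector {B : Matrix (Fin n) (Fin n) Quat} {q : Quat}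
    {x : Fin n → Quat} (hx : x ≠ 0) (h : B *ᵥ x = rsmul x q) :
    ∃ a y : Fin n → Quat, a ᵥ* B = q • a ∧ a ⬝ᵥ y ≠ 0 := by
  have hker : (shift B q).ker ≠ ⊥ := fun hbot => hx <| by
    have : x ∈ (shift B q).ker := by simp [h]
    simpa [hbot] using this
  have hr : (shift B q).range ≠ ⊤ := fun ht =>
    hker (LinearMap.ker_eq_bot.2 (LinearMap.injective_iff_surjective.2 (LinearMap.range_eq_top.1 ht)))
  obtain ⟨y, hy⟩ : ∃ y, y ∉ (shift B q).range := by
    by_contra! hall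
    exact hr (Submodule.eq_top_iff'.2 hall)
  obtain ⟨a, ha, hay⟩ := exists_left_eigenvector_of_notMem hy
  exact ⟨a, y, ha, hay⟩

/-- A defective eigenvalue has a left Jordan chain of length two. -/
theorem exists_left_chain {B : Matrix (Fin n) (Fin n) Quat} {q : Quat}
    {x : Fin n → Quat} (hx : shift B q x ≠ 0) (h : shift B q (shift B q x) = 0) :
    ∃ a b y : Fin n → Quat, a ᵥ* B = q • a ∧ b ᵥ* B = q • b + a ∧ a ⬝ᵥ y ≠ 0 := by
  set T := shift B q with hT
  -- Otherwise `T` and `T ∘ T` have equal rank, hence kernels of equal dimension, contrary to `x`.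
  obtain ⟨z, hz⟩ : ∃ z, T z ∉ (T ∘ₗ T).range := by
    by_contra! hall
    have hle : T.range ≤ (T ∘ₗ T).range := by
      rintro _ ⟨z, rfl⟩
      exact hall z
    have h1 := T.finrank_range_add_finrank_ker
    have h2 := (T ∘ₗ T).finrank_range_add_finrank_ker
    have h3 := Submodule.finrank_mono hle
    have h4 : T.ker < (T ∘ₗ T).ker := by
      refine lt_of_le_of_ne (fun u hu => ?_) fun heq => ?_
      · rw [LinearMap.mem_ker] at hu
        simp only [LinearMap.mem_ker, LinearMap.comp_apply, hu, map_zero]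
      · have : x ∈ T.ker := by rw [heq]; simpa using h
        exact hx this
    have h5 := Submodule.finrank_lt_finrank_of_lt h4
    omega
  obtain ⟨b, hb, hbz⟩ := exists_row_of_notMem hz
  -- The row `b` kills the range of `T ∘ T` but not `T z`. Its image `a` under the adjoint therefore
  -- kills the range of `T` but not `z`.
  refine ⟨b ᵥ* B - q • b, b, z, vecMul_eq_of_re fun u => ?_, by abel, fun h0 => hbz ?_⟩
  · rw [← re_dotProduct_shift]
    exact hb _ ⟨u, rfl⟩
  · rw [hT, re_dotProduct_shift, h0]; rfl

theorem dotProduct_pow_mulVec {B : Matrix (Fin n) (Fin n) Quat} {q : Quat} {a : Fin n → Quat}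
    (h : a ᵥ* B = q • a) (k : ℕ) (x : Fin n → Quat) : a ⬝ᵥ (B ^ k *ᵥ x) = q ^ k * (a ⬝ᵥ x) := by
  induction k with
  | zero => simp
  | succ k ih =>
    rw [pow_succ_mulVec, Matrix.dotProduct_mulVec, h, smul_dotProduct, ih, smul_eq_mul, pow_succ',
      mul_assoc]

/-- This is the power of a Jordan block of size two. At `k = 0` the truncated exponent is harmless,
as the factor `k` vanishes. -/
theorem dotProduct_pow_mulVec_chain {B : Matrix (Fin n) (Fin n) Quat} {q : Quat}
    {a b : Fin n → Quat} (ha : a ᵥ* B = q • a) (hb : b ᵥ* B = q • b + a) (k : ℕ)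
    (x : Fin n → Quat) :
    b ⬝ᵥ (B ^ k *ᵥ x) = q ^ k * (b ⬝ᵥ x) + k * q ^ (k - 1) * (a ⬝ᵥ x) := by
  induction k with
  | zero => simp
  | succ k ih =>
    rw [pow_succ_mulVec, Matrix.dotProduct_mulVec, hb, add_dotProduct, smul_dotProduct, ih,
      dotProduct_pow_mulVec ha, smul_eq_mul, pow_succ']
    rcases k with _ | k
    · simp
    · simp only [Nat.add_sub_cancel, Nat.cast_add, Nat.cast_one, pow_succ' q k]
      have : q * ((k : Quat) + 1) = ((k : Quat) + 1) * q := by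
        rw [mul_add, add_mul, (Nat.cast_commute k q).eq]; simp
      rw [mul_add, ← mul_assoc q (((k : Quat) + 1) * q ^ k), ← mul_assoc q ((k : Quat) + 1), this,
        add_mul ((k : Quat) + 1) 1]
      simp only [add_mul, mul_assoc, one_mul]
      abel

/-! ### Splitting off a semisimple eigenvalue -/

theorem isCompl_ker_range {K V : Type*} [DivisionRing K] [AddCommGroup V] [Module K V]
    [FiniteDimensional K V] {T : V →ₗ[K] V} (hT : ∀ x, T (T x) = 0 → T x = 0) :
    IsCompl T.ker T.range := by
  have hd : Disjoint T.ker T.range := by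
    rw [Submodule.disjoint_def]
    rintro _ hx ⟨y, rfl⟩
    exact hT y hx
  refine ⟨hd, codisjoint_iff.2 (Submodule.eq_top_of_disjoint _ _ ?_ hd)⟩
  rw [← T.finrank_range_add_finrank_ker, add_comm]

/-- The projection `Q` onto the kernel of `T` along its range, and a reduced resolvent `D`. -/
theorem exists_spectral_projection {K V : Type*} [DivisionRing K] [AddCommGroup V] [Module K V]
    [FiniteDimensional K V] {T : V →ₗ[K] V} (hT : ∀ x, T (T x) = 0 → T x = 0) :
    ∃ Q D : V →ₗ[K] V, (∀ x, T x = 0 → Q x = x) ∧ (∀ x, Q (T x) = 0) ∧ (∀ x, T (Q x) = 0) ∧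
      (∀ x, D (T x) = x - Q x) ∧ ∀ x, ∃ y, T y = x - Q x := by
  have hc := isCompl_ker_range hT
  set Q := T.ker.projection T.range hc with hQ
  have hQk : ∀ x, T x = 0 → Q x = x := fun x hx =>
    (Submodule.projection_eq_self_iff hc x).2 hx
  have hQr : ∀ x, ∃ y, T y = x - Q x := fun x => Submodule.sub_projection_mem hc x
  obtain ⟨g, hg⟩ := T.rangeRestrict.exists_rightInverse_of_surjective T.range_rangeRestrict
  have hg' : ∀ y, T (g (T.rangeRestrict y)) = T y := fun y => by
    have := congrArg Subtype.val (LinearMap.congr_fun hg (T.rangeRestrict y))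
    exact this
  -- Here `g` inverts `T` on its range up to an element of the kernel; the factor `1 - Q` removes
  -- this ambiguity.
  refine ⟨Q, (LinearMap.id - Q) ∘ₗ g ∘ₗ T.range.projectionOnto T.ker hc.symm, hQk,
    fun x => (Submodule.projection_apply_eq_zero_iff hc).2 ⟨x, rfl⟩,
    fun x => Submodule.projection_apply_mem hc x, fun x => ?_, hQr⟩
  have h1 : T.range.projectionOnto T.ker hc.symm (T x) = T.rangeRestrict x :=
    Submodule.projectionOnto_apply_left hc.symm (T.rangeRestrict x)
  have h2 : Q (g (T.rangeRestrict x) - x) = g (T.rangeRestrict x) - x :=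
    hQk _ (by rw [map_sub, hg', sub_self])
  rw [map_sub] at h2
  simp only [LinearMap.comp_apply, h1, LinearMap.sub_apply, LinearMap.id_apply]
  rw [← sub_eq_zero] at h2 ⊢
  rw [← neg_eq_zero, ← h2]
  abel

/-! ### The complex structure given by right multiplication -/

/-- Quaternion vectors as a complex vector space, complex numbers acting from the right. -/
@[reducible] def rightComplexModule (n : ℕ) : Module ℂ (Fin n → Quat) :=
  Module.compHom (Fin n → Quat)
    ({ toFun := fun z => MulOpposite.op (z : Quat)
       map_one' := by simp
       map_mul' := fun z w => by rw [mul_comm, Quaternion.coeComplex_mul]; rfl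
       map_zero' := by simp
       map_add' := fun z w => by simp } : ℂ →+* Quatᵐᵒᵖ)

theorem rightComplexModule_finite (n : ℕ) :
    letI := rightComplexModule n; Module.Finite ℂ (Fin n → Quat) := by
  let _ := rightComplexModule n
  have : IsScalarTower ℝ ℂ (Fin n → Quat) := ⟨fun r z x => by
    change rsmul x ((r • z : ℂ) : Quat) = r • rsmul x (z : Quat)
    rw [show ((r • z : ℂ) : Quat) = (z : Quat) * (r : Quat) by ext <;> simp [mul_comm],
      ← rsmul_coe, rsmul_rsmul]⟩
  exact Module.Finite.of_restrictScalars_finite ℝ ℂ (Fin n → Quat)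

/-- A quaternion matrix as a complex linear map. -/
def complexLin (B : Matrix (Fin n) (Fin n) Quat) :
    letI := rightComplexModule n; (Fin n → Quat) →ₗ[ℂ] (Fin n → Quat) :=
  letI := rightComplexModule n
  { toFun := fun x => B *ᵥ x
    map_add' := Matrix.mulVec_add B
    map_smul' := fun z x => mulVec_rsmul B x z }

/-- Induction on the decomposition of a vector into generalized eigenvectors. -/
theorem genEigenvector_induction (B : Matrix (Fin n) (Fin n) Quat) {P : (Fin n → Quat) → Prop}
    (zero : P 0) (add : ∀ x y, P x → P y → P (x + y))
    (gen : ∀ (μ : ℂ) (N : ℕ) (x : Fin n → Quat), (shift B μ ^ N) x = 0 → P x)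
    (x : Fin n → Quat) : P x := by
  let _ := rightComplexModule n
  have := rightComplexModule_finite n
  -- With complex scalars acting from the right, `x ↦ x μ` is scalar multiplication, so the
  -- decomposition over an algebraically closed field applies.
  have htop := Module.End.iSup_maxGenEigenspace_eq_top (K := ℂ) (V := Fin n → Quat) (complexLin B)
  have hx : x ∈ ⨆ μ, Module.End.maxGenEigenspace (complexLin B) μ := by rw [htop]; trivial
  refine Submodule.iSup_induction _ (motive := P) hx (fun μ y hy => ?_) zero add
  obtain ⟨N, hN⟩ := (Module.End.mem_maxGenEigenspace _ _ _).1 hy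
  refine gen μ N y ?_
  rw [← hN]
  clear hN hy
  induction N generalizing y with
  | zero => rfl
  | succ N ih =>
    rw [pow_succ, pow_succ, Module.End.mul_apply, Module.End.mul_apply, ← ih]
    rfl

/-- Above a semisimple eigenvalue `l` of the standard part `B` lies an eigenvalue `l + d ε`. -/
theorem exists_perturbed_eigenvector (B C : Matrix (Fin n) (Fin n) Quat) (l : ℂ)
    (hss : ∀ x, shift B l (shift B l x) = 0 → shift B l x = 0)
    {e : Fin n → Quat} (he0 : e ≠ 0) (he : shift B l e = 0) :
    ∃ x y : Fin n → Quat, ∃ d : ℂ, x ≠ 0 ∧ shift B l x = 0 ∧ shift B l y = rsmul x d - C *ᵥ x := by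
  let _ := rightComplexModule n
  have := rightComplexModule_finite n
  set T : (Fin n → Quat) →ₗ[ℂ] (Fin n → Quat) := complexLin B - l • LinearMap.id with hT
  have hTs : ∀ x, T x = shift B l x := fun x => rfl
  obtain ⟨Q, -, hQk, -, hTQ, -, hQr⟩ := exists_spectral_projection (T := T) (by simpa [hTs] using hss)
  have : Nontrivial T.ker := ⟨⟨⟨e, by rw [LinearMap.mem_ker, hTs, he]⟩, 0, fun h => he0
    (congrArg Subtype.val h)⟩⟩
  -- Solvability of the dual equation requires `x d - C x` to lie in the range of `T`, that is, `Q
  -- (C x) = x d`. So `d` is an eigenvalue of the compression of `C` to the kernel.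
  let f : T.ker →ₗ[ℂ] T.ker := (Q ∘ₗ complexLin C ∘ₗ T.ker.subtype).codRestrict T.ker
    fun x => by rw [LinearMap.mem_ker]; exact hTQ _
  obtain ⟨d, hd⟩ := Module.End.exists_eigenvalue f
  obtain ⟨x, hx⟩ := hd.exists_hasEigenvector
  have hx1 : Q (C *ᵥ (x : Fin n → Quat)) = rsmul (x : Fin n → Quat) d :=
    congrArg Subtype.val hx.apply_eq_smul
  obtain ⟨y, hy⟩ := hQr (C *ᵥ (x : Fin n → Quat))
  refine ⟨x, -y, d, fun h => hx.2 (Subtype.ext h), by rw [← hTs]; exact x.2, ?_⟩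
  rw [map_neg, ← hTs, hy, hx1]
  abel

/-! ### Growth of the powers -/

/-- Induction on the length of the chain: `B ^ (k + 1) x = B ^ k (shift x) + (B ^ k x) μ`, where the
first term is already bounded. -/
theorem exists_norm_pow_mulVec_le_of_gen {B : Matrix (Fin n) (Fin n) Quat} {μ : Quat} {r : ℝ}
    (hr : ‖μ‖ < r) (N : ℕ) {x : Fin n → Quat} (hx : (shift B μ ^ N) x = 0) :
    ∃ C : ℝ, 0 ≤ C ∧ ∀ k, ‖B ^ k *ᵥ x‖ ≤ C * r ^ k := by
  have hr0 : 0 < r := (norm_nonneg μ).trans_lt hr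
  induction N generalizing x with
  | zero =>
    rw [pow_zero, Module.End.one_apply] at hx
    exact ⟨0, le_rfl, fun k => by simp [hx]⟩
  | succ N ih =>
    rw [pow_succ, Module.End.mul_apply] at hx
    obtain ⟨C, hC, hCk⟩ := ih hx
    have hrμ : 0 < r - ‖μ‖ := sub_pos.2 hr
    -- The constant `D` must satisfy `‖x‖ ≤ D` for `k = 0` and `C + D ‖μ‖ ≤ D r` for the recursion.
    refine ⟨max ‖x‖ (C / (r - ‖μ‖)), le_max_of_le_left (norm_nonneg _), fun k => ?_⟩
    induction k with
    | zero => simp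
    | succ k ihk =>
      set D := max ‖x‖ (C / (r - ‖μ‖))
      have hD : C ≤ D * (r - ‖μ‖) := (div_le_iff₀ hrμ).1 (le_max_right _ _)
      have h1 : B ^ (k + 1) *ᵥ x = B ^ k *ᵥ shift B μ x + rsmul (B ^ k *ᵥ x) μ := by
        rw [pow_mulVec_shift, pow_succ_mulVec]; abel
      have hrk : 0 ≤ r ^ k := by positivity
      calc ‖B ^ (k + 1) *ᵥ x‖ ≤ ‖B ^ k *ᵥ shift B μ x‖ + ‖B ^ k *ᵥ x‖ * ‖μ‖ := by
            rw [h1, ← norm_rsmul]; exact norm_add_le _ _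
        _ ≤ C * r ^ k + D * r ^ k * ‖μ‖ := by
            gcongr
            exact hCk k
        _ ≤ D * (r - ‖μ‖) * r ^ k + D * r ^ k * ‖μ‖ := by gcongr
        _ = D * r ^ (k + 1) := by ring

theorem norm_coeComplex (z : ℂ) : ‖(z : Quat)‖ = ‖z‖ := by
  rw [← sq_eq_sq₀ (norm_nonneg _) (norm_nonneg _), sq, ← Quaternion.normSq_eq_norm_mul_self,
    Quaternion.normSq_def', Complex.sq_norm, Complex.normSq_apply]
  simp
  ring

/-- The multiplication by `j` from the right intertwines the shifts by `μ` and `conj μ`. -/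
theorem shift_rsmul_j (B : Matrix (Fin n) (Fin n) Quat) (μ : ℂ) (x : Fin n → Quat) :
    shift B (starRingEnd ℂ μ : ℂ) (rsmul x (quatMk 0 0 1 0))
      = rsmul (shift B μ x) (quatMk 0 0 1 0) := by
  have h : quatMk 0 0 1 0 * ((starRingEnd ℂ μ : ℂ) : Quat) = (μ : Quat) * quatMk 0 0 1 0 := by
    ext <;> simp
  rw [shift_apply, shift_apply, mulVec_rsmul, rsmul_sub, rsmul_rsmul, rsmul_rsmul, h]

theorem quatMk_j_ne_zero : quatMk 0 0 1 0 ≠ 0 := fun h => by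
  have := congrArg (fun q : Quat => q.imJ) h
  simp at this

theorem rsmul_ne_zero {x : Fin n → Quat} {q : Quat} (hx : x ≠ 0) (hq : q ≠ 0) :
    rsmul x q ≠ 0 := by
  rw [← norm_ne_zero_iff, norm_rsmul]
  exact mul_ne_zero (norm_ne_zero_iff.2 hx) (norm_ne_zero_iff.2 hq)

/-- The standard representative of the similarity class of a complex number. -/
def stdRep (μ : ℂ) : ℂ := ⟨μ.re, |μ.im|⟩

theorem stdRep_eq (μ : ℂ) : stdRep μ = μ ∨ stdRep μ = starRingEnd ℂ μ := by
  rcases le_total 0 μ.im with h | h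
  · left; apply Complex.ext <;> simp [stdRep, abs_of_nonneg h]
  · right; apply Complex.ext <;> simp [stdRep, abs_of_nonpos h]

theorem norm_stdRep (μ : ℂ) : ‖stdRep μ‖ = ‖μ‖ := by
  rcases stdRep_eq μ with h | h <;> simp [h]

/-- A unit of the quaternions carrying `μ`-eigenvectors to `stdRep μ`-eigenvectors. -/
theorem exists_shift_stdRep (B : Matrix (Fin n) (Fin n) Quat) (μ : ℂ) :
    ∃ u : Quat, u ≠ 0 ∧ ∀ x, shift B (stdRep μ) (rsmul x u) = rsmul (shift B μ x) u := by
  rcases stdRep_eq μ with h | h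
  · exact ⟨1, one_ne_zero, fun x => by rw [h, rsmul_one, rsmul_one]⟩
  · exact ⟨_, quatMk_j_ne_zero, fun x => by rw [h, shift_rsmul_j]⟩

theorem isStandardEigenvalue_stdRep {B : Matrix (Fin n) (Fin n) Quat} {μ : ℂ} {x : Fin n → Quat}
    (hx : x ≠ 0) (h : shift B μ x = 0) : IsStandardEigenvalue B (stdRep μ) := by
  obtain ⟨u, hu, hus⟩ := exists_shift_stdRep B μ
  refine ⟨abs_nonneg _, rsmul x u, rsmul_ne_zero hx hu, ?_⟩
  rw [← sub_eq_zero, ← shift_apply, hus, h, zero_rsmul]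

/-- The last nonzero vector of the chain generated by `x` is an eigenvector. -/
theorem isStandardEigenvalue_stdRep_of_gen {B : Matrix (Fin n) (Fin n) Quat} {μ : ℂ} {N : ℕ}
    {x : Fin n → Quat} (hx : x ≠ 0) (h : (shift B μ ^ N) x = 0) :
    IsStandardEigenvalue B (stdRep μ) := by
  induction N generalizing x with
  | zero => exact absurd h hx
  | succ N ih =>
    by_cases hs : shift B μ x = 0
    · exact isStandardEigenvalue_stdRep hx hs
    · rw [pow_succ, Module.End.mul_apply] at h
      exact ih hs h

/-- If no eigenvalue exceeds `ρ` in magnitude, the powers grow at most like `r ^ k`, `r > ρ`. -/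
theorem exists_norm_pow_mulVec_le {B : Matrix (Fin n) (Fin n) Quat} {ρ r : ℝ}
    (hmax : ∀ μ, IsStandardEigenvalue B μ → ‖μ‖ ≤ ρ) (hr : ρ < r) (x : Fin n → Quat) :
    ∃ C : ℝ, 0 ≤ C ∧ ∀ k, ‖B ^ k *ᵥ x‖ ≤ C * r ^ k := by
  induction x using genEigenvector_induction B with
  | zero => exact ⟨0, le_rfl, fun k => by simp⟩
  | add x y hx hy =>
    obtain ⟨C, hC, h⟩ := hx
    obtain ⟨D, hD, h'⟩ := hy
    refine ⟨C + D, by positivity, fun k => ?_⟩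
    rw [Matrix.mulVec_add, add_mul]
    exact (norm_add_le _ _).trans (add_le_add (h k) (h' k))
  | gen μ N x hx =>
    by_cases hx0 : x = 0
    · exact ⟨0, le_rfl, fun k => by simp [hx0]⟩
    · have := hmax _ (isStandardEigenvalue_stdRep_of_gen hx0 hx)
      rw [norm_stdRep] at this
      exact exists_norm_pow_mulVec_le_of_gen (by rw [norm_coeComplex]; linarith) N hx

/-- The eigenvalue `μ` has no Jordan block of size greater than one. -/
def Semisimple (B : Matrix (Fin n) (Fin n) Quat) (μ : ℂ) : Prop :=
  ∀ x, shift B μ (shift B μ x) = 0 → shift B μ x = 0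

theorem Semisimple.of_pow {B : Matrix (Fin n) (Fin n) Quat} {μ : ℂ} (h : Semisimple B μ) {N : ℕ}
    {x : Fin n → Quat} (hx : (shift B μ ^ N) x = 0) : shift B μ x = 0 := by
  induction N generalizing x with
  | zero => rw [pow_zero, Module.End.one_apply] at hx; rw [hx, map_zero]
  | succ N ih =>
    rw [pow_succ, Module.End.mul_apply] at hx
    exact h _ (ih hx)

theorem Semisimple.of_stdRep {B : Matrix (Fin n) (Fin n) Quat} {μ : ℂ}
    (h : Semisimple B (stdRep μ)) : Semisimple B μ := by
  obtain ⟨u, hu, hus⟩ := exists_shift_stdRep B μ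
  intro x hx
  have h1 := h (rsmul x u) (by rw [hus, hus, hx, zero_rsmul])
  rw [hus] at h1
  by_contra hne
  exact rsmul_ne_zero hne hu h1

/-- If the eigenvalues of maximal magnitude `ρ` are semisimple, the powers grow at most like
`ρ ^ k`. -/
theorem exists_norm_pow_mulVec_le_of_semisimple {B : Matrix (Fin n) (Fin n) Quat} {ρ : ℝ}
    (hmax : ∀ μ, IsStandardEigenvalue B μ → ‖μ‖ ≤ ρ)
    (hss : ∀ μ, IsStandardEigenvalue B μ → ‖μ‖ = ρ → Semisimple B μ) (x : Fin n → Quat) :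
    ∃ C : ℝ, 0 ≤ C ∧ ∀ k, ‖B ^ k *ᵥ x‖ ≤ C * ρ ^ k := by
  induction x using genEigenvector_induction B with
  | zero => exact ⟨0, le_rfl, fun k => by simp⟩
  | add x y hx hy =>
    obtain ⟨C, hC, h⟩ := hx
    obtain ⟨D, hD, h'⟩ := hy
    refine ⟨C + D, by positivity, fun k => ?_⟩
    rw [Matrix.mulVec_add, add_mul]
    exact (norm_add_le _ _).trans (add_le_add (h k) (h' k))
  | gen μ N x hx =>
    by_cases hx0 : x = 0
    · exact ⟨0, le_rfl, fun k => by simp [hx0]⟩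
    · have hst := isStandardEigenvalue_stdRep_of_gen hx0 hx
      have hle := hmax _ hst
      rcases hle.lt_or_eq with hlt | heq
      · rw [norm_stdRep] at hlt
        exact exists_norm_pow_mulVec_le_of_gen (by rw [norm_coeComplex]; exact hlt) N hx
      · have h1 := (hss _ hst heq).of_stdRep.of_pow hx
        rw [shift_apply, sub_eq_zero] at h1
        refine ⟨‖x‖, norm_nonneg _, fun k => ?_⟩
        rw [pow_mulVec_of_eigenvector h1, norm_rsmul, norm_pow, norm_coeComplex, ← norm_stdRep,
          heq]

/-- Off a real, semisimple and strictly largest eigenvalue the powers decay relative to it. -/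
theorem exists_norm_pow_mulVec_shift_le {B : Matrix (Fin n) (Fin n) Quat} {l : ℂ} (hl0 : l ≠ 0)
    (him : l.im = 0) (hst : StrictlyLargest B l) (hss : Semisimple B l) (x : Fin n → Quat) :
    ∃ C r : ℝ, 0 ≤ C ∧ 0 < r ∧ r < ‖l‖ ∧ ∀ k, ‖B ^ k *ᵥ shift B l x‖ ≤ C * r ^ k := by
  have hlpos : 0 < ‖l‖ := norm_pos_iff.2 hl0
  induction x using genEigenvector_induction B with
  | zero => exact ⟨0, ‖l‖ / 2, le_rfl, by positivity, by linarith, fun k => by simp⟩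
  | add x y hx hy =>
    obtain ⟨C, r, hC, hr, hrl, h⟩ := hx
    obtain ⟨D, s, hD, hs, hsl, h'⟩ := hy
    refine ⟨C + D, max r s, by positivity, lt_max_of_lt_left hr, max_lt hrl hsl, fun k => ?_⟩
    rw [map_add, Matrix.mulVec_add, add_mul]
    refine (norm_add_le _ _).trans (add_le_add ((h k).trans ?_) ((h' k).trans ?_))
    · gcongr; exact le_max_left _ _
    · gcongr; exact le_max_right _ _
  | gen μ N x hx =>
    by_cases hx0 : x = 0
    · exact ⟨0, ‖l‖ / 2, le_rfl, by positivity, by linarith, fun k => by simp [hx0]⟩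
    · have hstd := isStandardEigenvalue_stdRep_of_gen hx0 hx
      by_cases hμ : stdRep μ = l
      -- Since `l` is real, its similarity class contains no other complex number.
      · have hμl : μ = l := by
          have h1 := congrArg Complex.re hμ
          have h2 := congrArg Complex.im hμ
          simp only [stdRep, him, abs_eq_zero] at h1 h2
          exact Complex.ext h1 (by rw [h2, him])
        rw [hμl] at hx
        refine ⟨0, ‖l‖ / 2, le_rfl, by positivity, by linarith, fun k => ?_⟩
        rw [hss.of_pow hx]
        simp
      · have hlt := hst _ hstd hμ
        rw [norm_stdRep] at hlt
        -- Right multiplications by `l` and `μ` commute because `l` is real, so `shift B l x` is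
        -- again a generalized eigenvector for `μ`.
        have hcomm : ∀ y, shift B μ (shift B l y) = shift B l (shift B μ y) := fun y => by
          have hl : (l : Quat) = ((l.re : ℝ) : Quat) := by ext <;> simp [him]
          simp only [shift_apply, hl, Matrix.mulVec_sub, mulVec_rsmul, rsmul_sub, rsmul_rsmul,
            Quaternion.coe_commutes]
          abel
        have hcommN : ∀ y, (shift B μ ^ N) (shift B l y) = shift B l ((shift B μ ^ N) y) := by
          clear hx
          induction N with
          | zero => intro y; rfl
          | succ N ih => intro y; rw [pow_succ, Module.End.mul_apply, Module.End.mul_apply, hcomm, ih]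
        obtain ⟨C, hC, h⟩ := exists_norm_pow_mulVec_le_of_gen (B := B) (μ := (μ : Quat))
          (r := (‖μ‖ + ‖l‖) / 2) (by rw [norm_coeComplex]; linarith) N (x := shift B l x)
          (by rw [hcommN, hx, map_zero])
        exact ⟨C, (‖μ‖ + ‖l‖) / 2, hC, by positivity, by linarith, h⟩

/-! ### Multiplicities -/

theorem algMult_eq_geomMult {B : Matrix (Fin n) (Fin n) Quat} {μ : ℂ} (h : Semisimple B μ) :
    algMult μ B = geomMult μ B := by
  unfold algMult geomMult
  congr 1
  ext x
  refine ⟨fun ⟨j, hj⟩ => ?_, fun hx => ⟨1, hx⟩⟩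
  rw [eigMap_iterate] at hj
  exact h.of_pow hj

theorem geomMult_le_algMult (μ : ℂ) (B : Matrix (Fin n) (Fin n) Quat) :
    geomMult μ B ≤ algMult μ B :=
  Submodule.finrank_mono (Submodule.span_mono fun _ hx => ⟨1, hx⟩)

/-- Vectors in the right span of the `μ`-eigenvectors are annihilated by the real quadratic
polynomial with roots `μ` and `conj μ`. -/
theorem quadratic_of_mem_span {B : Matrix (Fin n) (Fin n) Quat} {μ : ℂ} {x : Fin n → Quat}
    (hx : x ∈ Submodule.span Quatᵐᵒᵖ {x : Fin n → Quat | eigMap B μ x = 0}) :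
    B *ᵥ (B *ᵥ x) - (2 * μ.re) • B *ᵥ x + (Complex.normSq μ) • x = 0 := by
  induction hx using Submodule.span_induction with
  | mem x hx =>
    have h : B *ᵥ x = rsmul x μ := sub_eq_zero.1 hx
    rw [h, mulVec_rsmul, h, rsmul_rsmul, ← rsmul_coe, ← rsmul_coe, rsmul_rsmul, ← sub_rsmul,
      ← add_rsmul]
    convert! rsmul_zero x
    ext <;> simp [Complex.normSq_apply] <;> ring
  | zero => simp
  | add x y _ _ hx hy =>
    rw [Matrix.mulVec_add, Matrix.mulVec_add, smul_add, smul_add, ← add_zero (0 : Fin n → Quat)]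
    nth_rewrite 1 [← hx]
    rw [← hy]
    abel
  | smul q x _ hx =>
    rw [Matrix.mulVec_smul, Matrix.mulVec_smul, smul_comm _ q, smul_comm _ q, ← smul_sub,
      ← smul_add, hx, smul_zero]

theorem rsmul_eq_zero {x : Fin n → Quat} {q : Quat} (h : rsmul x q = 0) : x = 0 ∨ q = 0 := by
  by_contra! hne
  exact rsmul_ne_zero hne.1 hne.2 h

theorem shift_rsmul_of_real (B : Matrix (Fin n) (Fin n) Quat) {μ : ℂ} (him : μ.im = 0)
    (x : Fin n → Quat) (q : Quat) : shift B μ (rsmul x q) = rsmul (shift B μ x) q := by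
  have hl : (μ : Quat) = ((μ.re : ℝ) : Quat) := by ext <;> simp [him]
  simp only [shift_apply, hl, mulVec_rsmul, rsmul_sub, rsmul_rsmul, Quaternion.coe_commutes]

/-- Equal dimensions give equal right spans, so a generalized eigenvector lies in the span of the
eigenvectors. For nonreal `μ` this span is larger than the eigenspace, which is not closed under
quaternion scalars. The real quadratic polynomial that annihilates the span is then used instead. -/
theorem semisimple_of_algMult_eq {B : Matrix (Fin n) (Fin n) Quat} {μ : ℂ}
    (h : algMult μ B = geomMult μ B) : Semisimple B μ := by
  intro x hx
  have hspan := Submodule.eq_of_le_of_finrank_eq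
    (Submodule.span_mono (R := Quatᵐᵒᵖ) (s := {x : Fin n → Quat | eigMap B μ x = 0})
      (t := {x : Fin n → Quat | ∃ j : ℕ, (eigMap B μ)^[j] x = 0}) fun _ hx => ⟨1, hx⟩) h.symm
  have hmem : x ∈ Submodule.span Quatᵐᵒᵖ {x : Fin n → Quat | eigMap B μ x = 0} := by
    rw [hspan]
    exact Submodule.subset_span ⟨2, hx⟩
  by_cases him : μ.im = 0
  · clear hx
    induction hmem using Submodule.span_induction with
    | mem x hx => exact hx
    | zero => exact map_zero _
    | add x y _ _ hx hy => rw [map_add, hx, hy, add_zero]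
    | smul q x _ hx =>
      have := shift_rsmul_of_real B him x q.unop
      rw [hx, zero_rsmul] at this
      exact this
  · have hq := quadratic_of_mem_span hmem
    set t := shift B μ x with ht
    -- With `B t = t μ`, the quadratic relation for `x` reduces to `t (2 μ - 2 Re μ) = 0`, which
    -- forces `t = 0` when `μ` is not real.
    have h1 : B *ᵥ x = t + rsmul x μ := by rw [ht, shift_apply]; abel
    have h2 : B *ᵥ t = rsmul t μ := by rwa [shift_apply, sub_eq_zero] at hx
    rw [h1, Matrix.mulVec_add, mulVec_rsmul, h2, h1, rsmul_add, rsmul_rsmul, ← rsmul_coe,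
      ← rsmul_coe, rsmul_add, rsmul_rsmul] at hq
    have h3 : rsmul t ((μ : Quat) + μ - ((2 * μ.re : ℝ) : Quat))
        + rsmul x ((μ : Quat) * μ - μ * ((2 * μ.re : ℝ) : Quat)
          + ((Complex.normSq μ : ℝ) : Quat)) = 0 := by
      rw [← hq]
      simp only [sub_rsmul, add_rsmul]
      abel
    have h4 : (μ : Quat) * μ - μ * ((2 * μ.re : ℝ) : Quat) + ((Complex.normSq μ : ℝ) : Quat) = 0 := by
      ext <;> simp [Complex.normSq_apply] <;> ring
    rw [h4, rsmul_zero, add_zero] at h3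
    rcases rsmul_eq_zero h3 with h5 | h5
    · exact h5
    · have := congrArg (fun q : Quat => q.imI) h5
      simp only [Quaternion.imI_sub, Quaternion.imI_add, Quaternion.imI_coeComplex,
        Quaternion.imI_coe, Quaternion.imI_zero] at this
      exact absurd (by linarith) him

theorem one_le_geomMult {B : Matrix (Fin n) (Fin n) Quat} {μ : ℂ} (h : IsStandardEigenvalue B μ) :
    1 ≤ geomMult μ B := by
  obtain ⟨-, x, hx, hBx⟩ := h
  rw [geomMult, Set.finrank, Submodule.one_le_finrank_iff]
  refine (Submodule.ne_bot_iff _).2 ⟨x, Submodule.subset_span ?_, hx⟩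
  exact sub_eq_zero.2 hBx

theorem exists_independent_eigenvector {B : Matrix (Fin n) (Fin n) Quat} {μ : ℂ}
    (h : 1 < geomMult μ B) (e : Fin n → Quat) :
    ∃ x, shift B μ x = 0 ∧ ∀ q, x ≠ rsmul e q := by
  by_contra! hall
  have hle : Submodule.span Quatᵐᵒᵖ {x : Fin n → Quat | eigMap B μ x = 0}
      ≤ Submodule.span Quatᵐᵒᵖ {e} := by
    refine Submodule.span_le.2 fun x hx => ?_
    obtain ⟨q, hq⟩ := hall x hx
    exact Submodule.mem_span_singleton.2 ⟨MulOpposite.op q, hq.symm⟩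
  have h1 := Submodule.finrank_mono hle
  have h2 := finrank_span_le_card (R := Quatᵐᵒᵖ) ({e} : Set (Fin n → Quat))
  have h3 : geomMult μ B ≤ 1 := h1.trans (by simpa using h2)
  omega

/-! ### Dual parts -/

/-- Dual part of a dual quaternion vector. -/
def duVec (x : Fin n → DualQuat) : Fin n → Quat := fun i => (x i).snd

/-- Dual part of a dual quaternion matrix. -/
def duMat (A : Matrix (Fin n) (Fin n) DualQuat) : Matrix (Fin n) (Fin n) Quat :=
  fun i j => (A i j).snd

/-- The dual quaternion vector with the given parts. -/
def mkVec (x y : Fin n → Quat) : Fin n → DualQuat :=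
  fun i => TrivSqZeroExt.inl (x i) + TrivSqZeroExt.inr (y i)

@[simp] theorem stVec_mkVec (x y : Fin n → Quat) : stVec (mkVec x y) = x := by
  ext1 i; simp [stVec, mkVec]

@[simp] theorem duVec_mkVec (x y : Fin n → Quat) : duVec (mkVec x y) = y := by
  ext1 i; simp [duVec, mkVec]

theorem dualVec_ext {x y : Fin n → DualQuat} (h1 : stVec x = stVec y) (h2 : duVec x = duVec y) :
    x = y := by
  ext1 i
  exact TrivSqZeroExt.ext (congrFun h1 i) (congrFun h2 i)

theorem stVec_mulVec (A : Matrix (Fin n) (Fin n) DualQuat) (v : Fin n → DualQuat) :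
    stVec (A *ᵥ v) = stMat A *ᵥ stVec v := by
  ext1 i
  simp [stVec, Matrix.mulVec, dotProduct, stMat, TrivSqZeroExt.fst_sum]

theorem duVec_mulVec (A : Matrix (Fin n) (Fin n) DualQuat) (v : Fin n → DualQuat) :
    duVec (A *ᵥ v) = stMat A *ᵥ duVec v + duMat A *ᵥ stVec v := by
  ext1 i
  simp [stVec, duVec, Matrix.mulVec, dotProduct, stMat, duMat, TrivSqZeroExt.snd_sum,
    Finset.sum_add_distrib]

theorem stVec_rsmul (v : Fin n → DualQuat) (q : DualQuat) :
    stVec (rsmul v q) = rsmul (stVec v) q.fst := by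
  ext1 i; simp [stVec]

theorem duVec_rsmul (v : Fin n → DualQuat) (q : DualQuat) :
    duVec (rsmul v q) = rsmul (stVec v) q.snd + rsmul (duVec v) q.fst := by
  ext1 i; simp [stVec, duVec]

theorem stVec_sub (v w : Fin n → DualQuat) : stVec (v - w) = stVec v - stVec w := rfl

theorem duVec_sub (v w : Fin n → DualQuat) : duVec (v - w) = duVec v - duVec w := rfl

@[simp] theorem fst_dualComplex (a b : ℂ) : (dualComplex a b).fst = a := by simp [dualComplex]

@[simp] theorem snd_dualComplex (a b : ℂ) : (dualComplex a b).snd = b := by simp [dualComplex]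

theorem mulVec_eq_rsmul_iff (A : Matrix (Fin n) (Fin n) DualQuat) (x : Fin n → DualQuat)
    (μ : DualQuat) : A *ᵥ x = rsmul x μ ↔ shift (stMat A) μ.fst (stVec x) = 0 ∧
      shift (stMat A) μ.fst (duVec x) = rsmul (stVec x) μ.snd - duMat A *ᵥ stVec x := by
  rw [shift_apply, shift_apply, sub_eq_zero, sub_eq_sub_iff_add_eq_add]
  constructor
  · intro h
    have h1 := congrArg stVec h
    have h2 := congrArg duVec h
    rw [stVec_mulVec, stVec_rsmul] at h1
    rw [duVec_mulVec, duVec_rsmul] at h2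
    exact ⟨h1, h2⟩
  · rintro ⟨h1, h2⟩
    refine dualVec_ext ?_ ?_
    · rw [stVec_mulVec, stVec_rsmul, h1]
    · rw [duVec_mulVec, duVec_rsmul, h2]

theorem isEigenvalue_of_shift {A : Matrix (Fin n) (Fin n) DualQuat} {l d : ℂ}
    {x y : Fin n → Quat} (hx : x ≠ 0) (h : shift (stMat A) l x = 0)
    (hy : shift (stMat A) l y = rsmul x d - duMat A *ᵥ x) : IsEigenvalue A (dualComplex l d) := by
  refine ⟨mkVec x y, by simpa using hx, ?_⟩
  rw [mulVec_eq_rsmul_iff]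
  simp only [stVec_mkVec, duVec_mkVec, fst_dualComplex, snd_dualComplex]
  exact ⟨h, hy⟩

theorem mult_le_geomMult (A : Matrix (Fin n) (Fin n) DualQuat) (l d : ℂ) :
    mult (dualComplex l d) A ≤ geomMult l (stMat A) := by
  refine Submodule.finrank_mono (Submodule.span_mono ?_)
  rintro _ ⟨x, hx, rfl⟩
  have := ((mulVec_eq_rsmul_iff A x _).1 hx).1
  rwa [fst_dualComplex] at this

theorem one_le_mult {A : Matrix (Fin n) (Fin n) DualQuat} {μ : DualQuat}
    (h : IsEigenvalue A μ) : 1 ≤ mult μ A := by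
  obtain ⟨x, hx, hAx⟩ := h
  rw [mult, Set.finrank, Submodule.one_le_finrank_iff]
  exact (Submodule.ne_bot_iff _).2 ⟨stVec x, Submodule.subset_span ⟨x, hAx, rfl⟩, hx⟩

theorem exists_isEigenvalue {A : Matrix (Fin n) (Fin n) DualQuat} {l : ℂ}
    (hl : IsStandardEigenvalue (stMat A) l) (hss : Semisimple (stMat A) l) :
    ∃ d : ℂ, IsEigenvalue A (dualComplex l d) := by
  obtain ⟨-, e, he, hBe⟩ := hl
  obtain ⟨x, y, d, hx, hBx, hy⟩ := exists_perturbed_eigenvector (stMat A) (duMat A) l hss he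
    (sub_eq_zero.2 hBe)
  exact ⟨d, isEigenvalue_of_shift hx hBx hy⟩

/-- The multiplicity above `l` lies between one and the geometric multiplicity, so alternative (ii)
holds automatically. -/
theorem spectralAssumption_of_geomMult_eq_one {A : Matrix (Fin n) (Fin n) DualQuat} {l : ℂ}
    (hl : IsStandardEigenvalue (stMat A) l) (hst : StrictlyLargest (stMat A) l)
    (hss : Semisimple (stMat A) l) (hg : geomMult l (stMat A) = 1) : SpectralAssumption A := by
  obtain ⟨d, hd⟩ := exists_isEigenvalue hl hss
  refine ⟨l, hl, hst, Or.inr ⟨d, hd, ?_, hg, by rw [algMult_eq_geomMult hss, hg]⟩⟩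
  have h1 := one_le_mult hd
  have h2 := mult_le_geomMult A l d
  omega

theorem one_lt_geomMult {A : Matrix (Fin n) (Fin n) DualQuat} {l : ℂ}
    (hl : IsStandardEigenvalue (stMat A) l) (hst : StrictlyLargest (stMat A) l)
    (hss : Semisimple (stMat A) l) (hA : ¬ SpectralAssumption A) : 1 < geomMult l (stMat A) := by
  have h1 := one_le_geomMult hl
  have h2 : geomMult l (stMat A) ≠ 1 := fun h =>
    hA (spectralAssumption_of_geomMult_eq_one hl hst hss h)
  omega

theorem strictlyLargest_of_not_caseI {A : Matrix (Fin n) (Fin n) DualQuat} {l : ℂ}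
    (hmax : ∀ μ : ℂ, IsStandardEigenvalue (stMat A) μ → ‖μ‖ ≤ ‖l‖) (h : ¬ CaseI A l) :
    StrictlyLargest (stMat A) l := fun μ hμ hne =>
  lt_of_le_of_ne (hmax μ hμ) fun heq => h ⟨μ, hμ, hne, heq⟩

/-- The matrices violating the spectral assumption fall into the five cases. -/
theorem cases_of_not_spectralAssumption {A : Matrix (Fin n) (Fin n) DualQuat} {l : ℂ}
    (hl : IsStandardEigenvalue (stMat A) l)
    (hmax : ∀ μ : ℂ, IsStandardEigenvalue (stMat A) μ → ‖μ‖ ≤ ‖l‖)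
    (hA : ¬ SpectralAssumption A) :
    CaseI A l ∨ CaseII A l ∨ CaseIII A l ∨ CaseIV A l ∨ CaseV A l := by
  by_cases h1 : CaseI A l
  · exact Or.inl h1
  have hst := strictlyLargest_of_not_caseI hmax h1
  by_cases heq : algMult l (stMat A) = geomMult l (stMat A)
  swap
  · exact Or.inr (Or.inl ⟨hst, lt_of_le_of_ne (geomMult_le_algMult _ _) (Ne.symm heq)⟩)
  have hss := semisimple_of_algMult_eq heq
  have hg := one_lt_geomMult hl hst hss hA
  by_cases him : l.im = 0
  swap
  · exact Or.inr (Or.inr (Or.inl ⟨hst, heq, hg, him⟩))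
  obtain ⟨d, hd⟩ := exists_isEigenvalue hl hss
  have hle := mult_le_geomMult A l d
  rw [← heq] at hle
  rcases hle.lt_or_eq with hlt | hme
  · exact Or.inr (Or.inr (Or.inr (Or.inl ⟨hst, heq, him, d, hd, hlt⟩)))
  -- A real `d` of full multiplicity would be alternative (i) of the assumption.
  · refine Or.inr (Or.inr (Or.inr (Or.inr ⟨hst, heq, him, d, fun hdim => hA ?_, hd, hme, heq ▸ hg⟩)))
    have hdr : ((d.re : ℝ) : ℂ) = d := Complex.ext rfl hdim.symm
    exact ⟨l, hl, hst, Or.inl ⟨him, d.re, by rwa [hdr], by rwa [hdr]⟩⟩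

/-! ### Endomorphisms all of whose vectors are eigenvectors -/

theorem quat_eq_coe_of_central {q : Quat} (h : ∀ p : Quat, p * q = q * p) :
    q = ((q.re : ℝ) : Quat) := by
  have h1 := h (quatMk 0 1 0 0)
  have h2 := h (quatMk 0 0 1 0)
  have hJ := congrArg (fun q : Quat => q.imK) h1
  have hK := congrArg (fun q : Quat => q.imJ) h1
  have hI := congrArg (fun q : Quat => q.imK) h2
  simp at hJ hK hI
  ext
  · simp
  · simp only [Quaternion.imI_coe]; linarith
  · simp only [Quaternion.imJ_coe]; linarith
  · simp only [Quaternion.imK_coe]; linarith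

theorem eigenvalue_eq_of_independent
    {M : (Fin n → Quat) →ₗ[Quatᵐᵒᵖ] (Fin n → Quat)} {x y : Fin n → Quat} {p q r : Quat}
    (hx0 : x ≠ 0) (hy0 : ∀ s, y ≠ rsmul x s) (hx : M x = rsmul x p) (hy : M y = rsmul y q)
    (hxy : M (x + y) = rsmul (x + y) r) : p = q := by
  rw [map_add, hx, hy, rsmul_add] at hxy
  have h1 : rsmul x (p - r) = rsmul y (r - q) := by
    rw [sub_rsmul, sub_rsmul, sub_eq_sub_iff_add_eq_add, hxy, add_comm]
  have h2 : r = q := by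
    by_contra hne
    refine hy0 ((p - r) * (r - q)⁻¹) ?_
    rw [← rsmul_rsmul, h1, rsmul_rsmul, mul_inv_cancel₀ (sub_ne_zero.2 hne), rsmul_one]
  rw [h2, sub_self, rsmul_zero] at h1
  rcases rsmul_eq_zero h1 with h3 | h3
  · exact absurd h3 hx0
  · exact sub_eq_zero.1 h3

/-- By comparison through sums, independent eigenvectors have the same eigenvalue `q`. Replacing `e`
by `e p` conjugates its eigenvalue to `p⁻¹ q p`, yet comparison with `f` still gives `q`. So `q` is
central, hence real. -/
theorem exists_real_scalar {M : (Fin n → Quat) →ₗ[Quatᵐᵒᵖ] (Fin n → Quat)}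
    {E : Submodule Quatᵐᵒᵖ (Fin n → Quat)} (hE : ∀ x ∈ E, ∃ q, M x = rsmul x q)
    {e f : Fin n → Quat} (heE : e ∈ E) (hfE : f ∈ E) (he : e ≠ 0) (hf : ∀ q, f ≠ rsmul e q) :
    ∃ r : ℝ, ∀ x ∈ E, M x = rsmul x (r : Quat) := by
  obtain ⟨q, hq⟩ := hE e heE
  have key : ∀ x ∈ E, (∀ s, x ≠ rsmul e s) → M x = rsmul x q := by
    intro x hx hxe
    obtain ⟨p, hp⟩ := hE x hx
    obtain ⟨r, hr⟩ := hE (e + x) (E.add_mem heE hx)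
    rw [hp, eigenvalue_eq_of_independent he hxe hq hp hr]
  have hcentral : ∀ p : Quat, p * q = q * p := by
    intro p
    by_cases hp : p = 0
    · simp [hp]
    have hpE : rsmul e p ∈ E := E.smul_mem _ heE
    obtain ⟨r, hr⟩ := hE _ (E.add_mem hpE hfE)
    have h1 : M (rsmul e p) = rsmul (rsmul e p) (p⁻¹ * q * p) := by
      rw [map_rsmul, hq, rsmul_rsmul, rsmul_rsmul, mul_assoc, mul_inv_cancel_left₀ hp]
    have h2 := eigenvalue_eq_of_independent (rsmul_ne_zero he hp)
      (fun s hs => hf (p * s) (by rw [hs, rsmul_rsmul])) h1 (key f hfE hf) hr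
    conv_lhs => rw [← h2, mul_assoc, mul_inv_cancel_left₀ hp]
  have hreal := quat_eq_coe_of_central hcentral
  refine ⟨q.re, fun x hx => ?_⟩
  rw [← hreal]
  by_cases hxe : ∀ s, x ≠ rsmul e s
  · exact key x hx hxe
  · push Not at hxe
    obtain ⟨s, rfl⟩ := hxe
    rw [map_rsmul, hq, rsmul_rsmul, rsmul_rsmul, hcentral]

/-- The shift by a real number as a right linear map. -/
def shiftLin (B : Matrix (Fin n) (Fin n) Quat) (l : ℂ) (him : l.im = 0) :
    (Fin n → Quat) →ₗ[Quatᵐᵒᵖ] (Fin n → Quat) where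
  toFun := shift B l
  map_add' := map_add _
  map_smul' q x := shift_rsmul_of_real B him x q.unop

@[simp] theorem shiftLin_apply (B : Matrix (Fin n) (Fin n) Quat) (l : ℂ) (him : l.im = 0)
    (x : Fin n → Quat) : shiftLin B l him x = shift B l x := rfl

/-- If the spectral assumption fails for a real semisimple dominant `l`, then some `l`-eigenvector
of the standard part is not the standard part of an eigenvector. -/
theorem exists_eigenvector_not_liftable {A : Matrix (Fin n) (Fin n) DualQuat} {l : ℂ}
    (hl : IsStandardEigenvalue (stMat A) l) (hst : StrictlyLargest (stMat A) l)
    (hss : Semisimple (stMat A) l) (him : l.im = 0) (hA : ¬ SpectralAssumption A)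
    {Q : (Fin n → Quat) →ₗ[Quatᵐᵒᵖ] (Fin n → Quat)}
    (hQ : ∀ x, ∃ y, shift (stMat A) l y = x - Q x) :
    ∃ x, shift (stMat A) l x = 0 ∧ ∀ q, Q (duMat A *ᵥ x) ≠ rsmul x q := by
  by_contra! hall
  have hg := one_lt_geomMult hl hst hss hA
  obtain ⟨-, e, he, hBe⟩ := id hl
  have hBe' : shift (stMat A) l e = 0 := sub_eq_zero.2 hBe
  obtain ⟨f, hf, hfe⟩ := exists_independent_eigenvector hg e
  -- If all eigenvectors were liftable to first order, one real `r` would serve for the whole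
  -- eigenspace, and `l + r ε` would have full multiplicity.
  obtain ⟨r, hr⟩ := exists_real_scalar (M := Q ∘ₗ matLin (duMat A))
    (E := (shiftLin (stMat A) l him).ker) (fun x hx => hall x hx) hBe' hf he hfe
  have hlift : ∀ x, shift (stMat A) l x = 0 → ∃ y,
      shift (stMat A) l y = rsmul x ((r : ℂ) : Quat) - duMat A *ᵥ x := by
    intro x hx
    obtain ⟨y, hy⟩ := hQ (duMat A *ᵥ x)
    have h1 : Q (duMat A *ᵥ x) = rsmul x (r : Quat) := hr x hx
    exact ⟨-y, by rw [map_neg, hy, h1, Quaternion.coeComplex_coe]; abel⟩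
  refine hA ⟨l, hl, hst, Or.inl ⟨him, r, ?_, ?_⟩⟩
  · obtain ⟨y, hy⟩ := hlift e hBe'
    exact isEigenvalue_of_shift he hBe' hy
  · refine le_antisymm ((mult_le_geomMult A l r).trans (geomMult_le_algMult _ _)) ?_
    rw [algMult_eq_geomMult hss]
    refine Submodule.finrank_mono (Submodule.span_mono fun x hx => ?_)
    obtain ⟨y, hy⟩ := hlift x hx
    refine ⟨mkVec x y, ?_, stVec_mkVec x y⟩
    change A *ᵥ mkVec x y = rsmul (mkVec x y) (dualComplex l r)
    rw [mulVec_eq_rsmul_iff]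
    simp only [stVec_mkVec, duVec_mkVec, fst_dualComplex, snd_dualComplex]
    exact ⟨hx, hy⟩

/-! ### Polynomial functions of the real coordinates -/

/-- Real polynomial functions of the coordinates of a quaternion vector. -/
def PolyFun (f : (Fin n → Quat) → ℝ) : Prop :=
  ∃ p : MvPolynomial (Fin n × Fin 4) ℝ, ∀ x, MvPolynomial.eval (coords x) p = f x

theorem PolyFun.const (c : ℝ) : PolyFun fun _ : Fin n → Quat => c :=
  ⟨MvPolynomial.C c, fun _ => MvPolynomial.eval_C _⟩

theorem PolyFun.add {f g : (Fin n → Quat) → ℝ} (hf : PolyFun f) (hg : PolyFun g) :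
    PolyFun fun x => f x + g x := by
  obtain ⟨p, hp⟩ := hf
  obtain ⟨q, hq⟩ := hg
  exact ⟨p + q, fun x => by rw [map_add, hp, hq]⟩

theorem PolyFun.mul {f g : (Fin n → Quat) → ℝ} (hf : PolyFun f) (hg : PolyFun g) :
    PolyFun fun x => f x * g x := by
  obtain ⟨p, hp⟩ := hf
  obtain ⟨q, hq⟩ := hg
  exact ⟨p * q, fun x => by rw [map_mul, hp, hq]⟩

theorem PolyFun.neg {f : (Fin n → Quat) → ℝ} (hf : PolyFun f) : PolyFun fun x => -f x := by
  obtain ⟨p, hp⟩ := hf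
  exact ⟨-p, fun x => by rw [map_neg, hp]⟩

theorem PolyFun.sub {f g : (Fin n → Quat) → ℝ} (hf : PolyFun f) (hg : PolyFun g) :
    PolyFun fun x => f x - g x := by
  simpa only [sub_eq_add_neg] using hf.add hg.neg

theorem PolyFun.sum {ι : Type*} (s : Finset ι) {f : ι → (Fin n → Quat) → ℝ}
    (hf : ∀ i, PolyFun (f i)) : PolyFun fun x => ∑ i ∈ s, f i x := by
  choose p hp using hf
  exact ⟨∑ i ∈ s, p i, fun x => by rw [map_sum]; exact Finset.sum_congr rfl fun i _ => hp i x⟩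

theorem PolyFun.coord (ij : Fin n × Fin 4) : PolyFun fun x : Fin n → Quat => coords x ij :=
  ⟨MvPolynomial.X ij, fun _ => MvPolynomial.eval_X _⟩

theorem PolyFun.linear (f : (Fin n → Quat) →ₗ[ℝ] ℝ) : PolyFun f := by
  have h : (f : (Fin n → Quat) → ℝ) = fun x => ∑ i : Fin n,
      (coords x (i, 0) * f (Pi.single i (quatMk 1 0 0 0))
      + coords x (i, 1) * f (Pi.single i (quatMk 0 1 0 0))
      + coords x (i, 2) * f (Pi.single i (quatMk 0 0 1 0))
      + coords x (i, 3) * f (Pi.single i (quatMk 0 0 0 1))) := by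
    funext x
    conv_lhs => rw [eq_sum_coords x]
    simp only [map_sum, map_add, map_smul, smul_eq_mul]
    rfl
  rw [h]
  exact PolyFun.sum _ fun i => ((((PolyFun.coord _).mul (PolyFun.const _)).add
    ((PolyFun.coord _).mul (PolyFun.const _))).add ((PolyFun.coord _).mul (PolyFun.const _))).add
    ((PolyFun.coord _).mul (PolyFun.const _))

/-- Quaternion valued polynomial functions. -/
structure QuatPolyFun (F : (Fin n → Quat) → Quat) : Prop where
  re : PolyFun fun x => (F x).re
  imI : PolyFun fun x => (F x).imI
  imJ : PolyFun fun x => (F x).imJ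
  imK : PolyFun fun x => (F x).imK

theorem QuatPolyFun.const (q : Quat) : QuatPolyFun fun _ : Fin n → Quat => q :=
  ⟨.const _, .const _, .const _, .const _⟩

theorem QuatPolyFun.add {F G : (Fin n → Quat) → Quat} (hF : QuatPolyFun F) (hG : QuatPolyFun G) :
    QuatPolyFun fun x => F x + G x :=
  ⟨hF.re.add hG.re, hF.imI.add hG.imI, hF.imJ.add hG.imJ, hF.imK.add hG.imK⟩

theorem QuatPolyFun.sub {F G : (Fin n → Quat) → Quat} (hF : QuatPolyFun F) (hG : QuatPolyFun G) :
    QuatPolyFun fun x => F x - G x :=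
  ⟨hF.re.sub hG.re, hF.imI.sub hG.imI, hF.imJ.sub hG.imJ, hF.imK.sub hG.imK⟩

theorem QuatPolyFun.star {F : (Fin n → Quat) → Quat} (hF : QuatPolyFun F) :
    QuatPolyFun fun x => star (F x) := by
  refine ⟨?_, ?_, ?_, ?_⟩
  · simpa using hF.re
  · simpa using hF.imI.neg
  · simpa using hF.imJ.neg
  · simpa using hF.imK.neg

theorem QuatPolyFun.mul {F G : (Fin n → Quat) → Quat} (hF : QuatPolyFun F) (hG : QuatPolyFun G) :
    QuatPolyFun fun x => F x * G x := by
  refine ⟨?_, ?_, ?_, ?_⟩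
  · simpa only [Quaternion.re_mul] using
      (((hF.re.mul hG.re).sub (hF.imI.mul hG.imI)).sub (hF.imJ.mul hG.imJ)).sub (hF.imK.mul hG.imK)
  · simpa only [Quaternion.imI_mul] using
      (((hF.re.mul hG.imI).add (hF.imI.mul hG.re)).add (hF.imJ.mul hG.imK)).sub (hF.imK.mul hG.imJ)
  · simpa only [Quaternion.imJ_mul] using
      (((hF.re.mul hG.imJ).sub (hF.imI.mul hG.imK)).add (hF.imJ.mul hG.re)).add (hF.imK.mul hG.imI)
  · simpa only [Quaternion.imK_mul] using
      (((hF.re.mul hG.imK).add (hF.imI.mul hG.imJ)).sub (hF.imJ.mul hG.imI)).add (hF.imK.mul hG.re)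

theorem QuatPolyFun.sum {ι : Type*} (s : Finset ι) {F : ι → (Fin n → Quat) → Quat}
    (hF : ∀ i, QuatPolyFun (F i)) : QuatPolyFun fun x => ∑ i ∈ s, F i x := by
  classical
  induction s using Finset.induction_on with
  | empty => simpa using QuatPolyFun.const 0
  | insert i s hi ih =>
    simp only [Finset.sum_insert hi]
    exact (hF i).add ih

theorem QuatPolyFun.linear (f : (Fin n → Quat) →ₗ[ℝ] Quat) : QuatPolyFun f := by
  refine ⟨?_, ?_, ?_, ?_⟩
  · exact PolyFun.linear ⟨⟨fun x => (f x).re, fun x y => by simp⟩, fun r x => by simp⟩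
  · exact PolyFun.linear ⟨⟨fun x => (f x).imI, fun x y => by simp⟩, fun r x => by simp⟩
  · exact PolyFun.linear ⟨⟨fun x => (f x).imJ, fun x y => by simp⟩, fun r x => by simp⟩
  · exact PolyFun.linear ⟨⟨fun x => (f x).imK, fun x y => by simp⟩, fun r x => by simp⟩

theorem QuatPolyFun.map_apply (f : (Fin n → Quat) →ₗ[Quatᵐᵒᵖ] (Fin n → Quat)) (i : Fin n) :
    QuatPolyFun fun x => f x i :=
  QuatPolyFun.linear (LinearMap.proj i ∘ₗ f.restrictScalars ℝ)

theorem QuatPolyFun.dotProduct (a : Fin n → Quat) : QuatPolyFun fun x => a ⬝ᵥ x :=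
  QuatPolyFun.sum _ fun i => (QuatPolyFun.const (a i)).mul (QuatPolyFun.map_apply LinearMap.id i)

/-- A polynomial function which does not vanish identically is nonzero off the zero set of a
nonzero polynomial. -/
theorem QuatPolyFun.exists_polynomial {F : (Fin n → Quat) → Quat} (hF : QuatPolyFun F)
    {x₀ : Fin n → Quat} (hx₀ : F x₀ ≠ 0) :
    ∃ p : MvPolynomial (Fin n × Fin 4) ℝ, p ≠ 0 ∧
      ∀ x, MvPolynomial.eval (coords x) p ≠ 0 → F x ≠ 0 := by
  -- The polynomial is the squared norm of `F`, which has the same zeros as `F`.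
  obtain ⟨p, hp⟩ := (hF.star.mul hF).re
  have hns : ∀ x, MvPolynomial.eval (coords x) p = Quaternion.normSq (F x) := fun x =>
    (hp x).trans (by beta_reduce; rw [Quaternion.star_mul_self, Quaternion.re_coe])
  refine ⟨p, fun h => hx₀ ?_, fun x hx hFx => hx ?_⟩
  · have := hns x₀
    rw [h, map_zero] at this
    exact Quaternion.normSq_eq_zero.1 this.symm
  · rw [hns, hFx, map_zero]

/-! ### Norms -/

theorem norm2_nonneg (x : Fin n → Quat) : 0 ≤ norm2 x := Real.sqrt_nonneg _

theorem norm2_sq (x : Fin n → Quat) : norm2 x ^ 2 = ∑ i, ‖x i‖ ^ 2 :=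
  Real.sq_sqrt (by positivity)

/-- Here `‖x‖` is the maximum norm. The estimates below are made in it, which costs only factors
`n`. -/
theorem norm_le_norm2 (x : Fin n → Quat) : ‖x‖ ≤ norm2 x := by
  refine (pi_norm_le_iff_of_nonneg (norm2_nonneg x)).2 fun i => ?_
  rw [← sq_le_sq₀ (norm_nonneg _) (norm2_nonneg x), norm2_sq]
  exact Finset.single_le_sum (f := fun i => ‖x i‖ ^ 2) (fun i _ => by positivity)
    (Finset.mem_univ i)

theorem norm2_le (x : Fin n → Quat) : norm2 x ≤ n * ‖x‖ := by
  rw [← sq_le_sq₀ (norm2_nonneg x) (by positivity), norm2_sq]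
  calc ∑ i, ‖x i‖ ^ 2 ≤ ∑ _i : Fin n, ‖x‖ ^ 2 := by
        gcongr with i
        exact norm_le_pi_norm x i
    _ = n * ‖x‖ ^ 2 := by simp
    _ ≤ (n * ‖x‖) ^ 2 := by
        rw [mul_pow]
        gcongr
        exact_mod_cast Nat.le_self_pow two_ne_zero n

theorem norm2_smul (r : ℝ) (x : Fin n → Quat) : norm2 (r • x) = |r| * norm2 x := by
  rw [← sq_eq_sq₀ (norm2_nonneg _) (mul_nonneg (abs_nonneg _) (norm2_nonneg _)), mul_pow, norm2_sq,
    norm2_sq, Finset.mul_sum]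
  refine Finset.sum_congr rfl fun i _ => ?_
  rw [Pi.smul_apply, norm_smul, mul_pow, Real.norm_eq_abs]

theorem norm2_pos {x : Fin n → Quat} (hx : x ≠ 0) : 0 < norm2 x :=
  (norm_pos_iff.2 hx).trans_le (norm_le_norm2 x)

theorem normR_nonneg (v : Fin n → DualQuat) : 0 ≤ normR v := Real.sqrt_nonneg _

theorem norm_stVec_le_normR (v : Fin n → DualQuat) : ‖stVec v‖ ≤ normR v := by
  refine (norm_le_norm2 _).trans (Real.le_sqrt_of_sq_le ?_)
  exact le_add_of_nonneg_right (sq_nonneg _)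

theorem norm_duVec_le_normR (v : Fin n → DualQuat) : ‖duVec v‖ ≤ normR v := by
  refine (norm_le_norm2 _).trans (Real.le_sqrt_of_sq_le ?_)
  exact le_add_of_nonneg_left (sq_nonneg _)

/-! ### The iterates of the power method -/

theorem fst_dualNorm {v : Fin n → DualQuat} (hv : stVec v ≠ 0) :
    (dualNorm v).fst = norm2 (stVec v) := by
  simp [dualNorm, hv]

/-- The standard part of a positive iterate is the normalized power applied to the start. -/
theorem stVec_pmVec_succ (A : Matrix (Fin n) (Fin n) DualQuat) (v0 : Fin n → DualQuat) (k : ℕ)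
    (hx : ∀ k, stMat A ^ k *ᵥ stVec v0 ≠ 0) :
    stVec (pmVec A v0 (k + 1)) =
      (norm2 (stMat A ^ (k + 1) *ᵥ stVec v0))⁻¹ • (stMat A ^ (k + 1) *ᵥ stVec v0) := by
  have step : ∀ (k : ℕ) (c : ℝ), 0 < c →
      stVec (pmVec A v0 k) = c • (stMat A ^ k *ᵥ stVec v0) →
      stVec (pmVec A v0 (k + 1)) =
        (norm2 (stMat A ^ (k + 1) *ᵥ stVec v0))⁻¹ • (stMat A ^ (k + 1) *ᵥ stVec v0) := by
    intro k c hc h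
    have h1 : stVec (A *ᵥ pmVec A v0 k) = c • (stMat A ^ (k + 1) *ᵥ stVec v0) := by
      rw [stVec_mulVec, h, Matrix.mulVec_smul, pow_succ_mulVec]
    have h2 : stVec (A *ᵥ pmVec A v0 k) ≠ 0 := by
      rw [h1]; exact smul_ne_zero hc.ne' (hx _)
    rw [pmVec, stVec_rsmul, ofDualReal]
    simp only [TrivSqZeroExt.fst_add, TrivSqZeroExt.fst_inl, TrivSqZeroExt.fst_inr, add_zero,
      TrivSqZeroExt.fst_inv]
    rw [fst_dualNorm h2, rsmul_coe, h1, norm2_smul, smul_smul, abs_of_pos hc, mul_inv,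
      mul_right_comm, inv_mul_cancel₀ hc.ne', one_mul]
  induction k with
  | zero => exact step 0 1 one_pos (by simp [pmVec])
  | succ k ih => exact step (k + 1) _ (inv_pos.2 (norm2_pos (hx _))) ih

/-- This form includes index zero, where the start need not be normalized. -/
theorem exists_stVec_pmVec (A : Matrix (Fin n) (Fin n) DualQuat) (v0 : Fin n → DualQuat) (k : ℕ)
    (hx : ∀ k, stMat A ^ k *ᵥ stVec v0 ≠ 0) :
    ∃ c : ℝ, 0 < c ∧ stVec (pmVec A v0 k) = c • (stMat A ^ k *ᵥ stVec v0) := by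
  cases k with
  | zero => exact ⟨1, one_pos, by simp [pmVec]⟩
  | succ k => exact ⟨_, inv_pos.2 (norm2_pos (hx _)), stVec_pmVec_succ A v0 k hx⟩

theorem wellDefined_of_pow_ne_zero {A : Matrix (Fin n) (Fin n) DualQuat} {v0 : Fin n → DualQuat}
    (hx : ∀ k, stMat A ^ k *ᵥ stVec v0 ≠ 0) : WellDefined A v0 := by
  intro k
  obtain ⟨c, hc, h⟩ := exists_stVec_pmVec A v0 k hx
  rw [stVec_mulVec, h, Matrix.mulVec_smul, ← pow_succ_mulVec]
  exact smul_ne_zero hc.ne' (hx _)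

theorem norm2_stVec_pmVec {A : Matrix (Fin n) (Fin n) DualQuat} {v0 : Fin n → DualQuat}
    (hx : ∀ k, stMat A ^ k *ᵥ stVec v0 ≠ 0) {k : ℕ} (hk : 1 ≤ k) :
    norm2 (stVec (pmVec A v0 k)) = 1 := by
  obtain ⟨k, rfl⟩ := Nat.exists_eq_add_of_le' hk
  rw [stVec_pmVec_succ A v0 k hx, norm2_smul, abs_of_pos (inv_pos.2 (norm2_pos (hx _))),
    inv_mul_cancel₀ (norm2_pos (hx _)).ne']

theorem norm_stVec_pmVec_le {A : Matrix (Fin n) (Fin n) DualQuat} {v0 : Fin n → DualQuat}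
    (hx : ∀ k, stMat A ^ k *ᵥ stVec v0 ≠ 0) {k : ℕ} (hk : 1 ≤ k) :
    ‖stVec (pmVec A v0 k)‖ ≤ 1 :=
  (norm_le_norm2 _).trans (norm2_stVec_pmVec hx hk).le

theorem one_le_mul_norm_stVec_pmVec {A : Matrix (Fin n) (Fin n) DualQuat} {v0 : Fin n → DualQuat}
    (hx : ∀ k, stMat A ^ k *ᵥ stVec v0 ≠ 0) {k : ℕ} (hk : 1 ≤ k) :
    1 ≤ n * ‖stVec (pmVec A v0 k)‖ :=
  (norm2_stVec_pmVec hx hk).symm.le.trans (norm2_le _)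

/-- The standard part of the residual. -/
theorem norm_shift_stVec_pmVec_le_pmResidual (A : Matrix (Fin n) (Fin n) DualQuat)
    (v0 : Fin n → DualQuat) (k : ℕ) :
    ‖shift (stMat A) (pmVal A v0 k).fst (stVec (pmVec A v0 k))‖ ≤ pmResidual A v0 k := by
  refine le_trans (le_of_eq ?_) (norm_stVec_le_normR _)
  rw [stVec_sub, stVec_mulVec, stVec_rsmul, shift_apply]

/-- The standard part of an approximate eigenvector is an approximate eigenvector. -/
theorem norm_shift_le_of_eigenvector {B : Matrix (Fin n) (Fin n) Quat} {C : ℝ}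
    (hC : ∀ x, ‖B *ᵥ x‖ ≤ C * ‖x‖) {w : Fin n → Quat} {μ : Quat} (hw0 : w ≠ 0)
    (hw : shift B μ w = 0) (u : Fin n → Quat) : ‖shift B μ u‖ ≤ 2 * C * ‖u - w‖ := by
  have hw' : 0 < ‖w‖ := norm_pos_iff.2 hw0
  -- An eigenvalue is bounded by any operator bound, so the constant does not depend on `μ`.
  have hμ : ‖μ‖ ≤ C := by
    have h1 := hC w
    rw [shift_apply, sub_eq_zero] at hw
    rw [hw, norm_rsmul, mul_comm] at h1
    exact le_of_mul_le_mul_right h1 hw'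
  have h2 : shift B μ u = B *ᵥ (u - w) - rsmul (u - w) μ := by
    rw [← shift_apply, map_sub, hw, sub_zero]
  rw [h2]
  refine (norm_sub_le _ _).trans ?_
  rw [norm_rsmul]
  have h3 : ‖u - w‖ * ‖μ‖ ≤ ‖u - w‖ * C := by gcongr
  linarith [hC (u - w)]

/-! ### Defective dominant eigenvalues -/

/-- Pairing with the left eigenvector gives `q ^ k * (a ⬝ᵥ x)`, which is nonzero. -/
theorem pow_mulVec_ne_zero {B : Matrix (Fin n) (Fin n) Quat} {q : Quat} {a x : Fin n → Quat}
    (hq : q ≠ 0) (ha : a ᵥ* B = q • a) (hx : a ⬝ᵥ x ≠ 0) (k : ℕ) : B ^ k *ᵥ x ≠ 0 := fun h => by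
  have h1 := dotProduct_pow_mulVec ha k x
  rw [h, dotProduct_zero] at h1
  exact mul_ne_zero (pow_ne_zero k hq) hx h1.symm

theorem shift_smul_eq (B : Matrix (Fin n) (Fin n) Quat) (q : Quat) (c : ℝ) (x : Fin n → Quat) :
    ‖shift B q (c • x)‖ = |c| * ‖shift B q x‖ := by
  rw [map_smul, norm_smul, Real.norm_eq_abs]

/-- Along a left Jordan chain of length two the powers do not approach an eigenvector at a
geometric rate. -/
theorem not_geometric_of_chain {B : Matrix (Fin n) (Fin n) Quat} {ν : Quat} {a b x : Fin n → Quat}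
    (ha : a ᵥ* B = ν • a) (hb : b ᵥ* B = ν • b + a) (hg : a ⬝ᵥ x ≠ 0) (hν : ν ≠ 0)
    (hmax : ∀ μ, IsStandardEigenvalue B μ → ‖μ‖ ≤ ‖ν‖) {c K : ℝ} (hc0 : 0 < c) (hc1 : c < 1)
    (q : ℕ → Quat) (h : ∀ᶠ k in atTop, ‖shift B (q k) (B ^ k *ᵥ x)‖ ≤ K * c ^ k * ‖B ^ k *ᵥ x‖) :
    False := by
  set ρ := ‖ν‖ with hρ
  have hρ0 : 0 < ρ := norm_pos_iff.2 hν
  -- The powers are known only to be `O(r ^ k)` for `r > ρ`. This `r` is so close to `ρ` that `c r =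
  -- t ρ` with `t < 1`.
  set r := ρ * (1 + c) / (2 * c) with hr
  have hρr : ρ < r := by
    rw [hr, lt_div_iff₀ (by positivity)]
    nlinarith
  have hr0 : 0 < r := hρ0.trans hρr
  set t := (1 + c) / 2 with ht
  have ht0 : 0 < t := by positivity
  have ht1 : t < 1 := by rw [ht]; linarith
  have hcr : c * r = t * ρ := by rw [hr, ht]; field_simp
  obtain ⟨C, hC, hCk⟩ := exists_norm_pow_mulVec_le hmax hρr x
  obtain ⟨Ca, hCa, hCa'⟩ := exists_norm_dotProduct_le a
  obtain ⟨Cb, hCb, hCb'⟩ := exists_norm_dotProduct_le b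
  set g := a ⬝ᵥ x with hgdef
  set f := b ⬝ᵥ x with hfdef
  -- This combination of the pairings of the defect with `a` and `b` eliminates the unknown `q k`,
  -- so it does not depend on `k`.
  set w := ν * f + g - f * g⁻¹ * (ν * g) with hw
  set K' := |K| * C with hK'
  have hK'0 : 0 ≤ K' := by positivity
  have hα : ∀ k, a ⬝ᵥ shift B (q k) x = ν * g - g * q k := fun k => by
    rw [shift_apply, dotProduct_sub, Matrix.dotProduct_mulVec, ha, smul_dotProduct, smul_eq_mul,
      dotProduct_rsmul]
  have hβ : ∀ k, b ⬝ᵥ shift B (q k) x = ν * f + g - f * q k := fun k => by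
    rw [shift_apply, dotProduct_sub, Matrix.dotProduct_mulVec, hb, add_dotProduct, smul_dotProduct,
      smul_eq_mul, dotProduct_rsmul]
  have hwk : ∀ k, w = b ⬝ᵥ shift B (q k) x - f * g⁻¹ * (a ⬝ᵥ shift B (q k) x) := fun k => by
    rw [hα, hβ, hw, mul_sub, mul_assoc f g⁻¹ (g * q k), inv_mul_cancel_left₀ hg]
    abel
  have hbound : ∀ᶠ k : ℕ in atTop, ‖w‖ ≤ Cb * K' * t ^ k + Ca * K' / ρ * (k * t ^ k)
      + ‖f * g⁻¹‖ * (Ca * K' * t ^ k) := by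
    filter_upwards [h, eventually_ge_atTop 1] with k hk hk1
    -- The defect of the power is the power of the defect, so the pairings with the rows can be
    -- divided by `ρ ^ k`.
    have hz : ‖B ^ k *ᵥ shift B (q k) x‖ ≤ K' * (t ^ k * ρ ^ k) := by
      rw [pow_mulVec_shift, ← shift_apply]
      calc _ ≤ K * c ^ k * ‖B ^ k *ᵥ x‖ := hk
        _ ≤ |K| * c ^ k * (C * r ^ k) := by
            gcongr
            · exact le_abs_self K
            · exact hCk k
        _ = K' * (t ^ k * ρ ^ k) := by rw [← mul_pow, ← hcr, mul_pow, hK']; ring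
    have hρk : 0 < ρ ^ k := by positivity
    have h1 : ‖a ⬝ᵥ shift B (q k) x‖ ≤ Ca * K' * t ^ k := by
      have h2 := (hCa' (B ^ k *ᵥ shift B (q k) x)).trans (mul_le_mul_of_nonneg_left hz hCa.le)
      rw [dotProduct_pow_mulVec ha, norm_mul, norm_pow] at h2
      refine le_of_mul_le_mul_left (h2.trans (le_of_eq ?_)) hρk
      ring
    have h3 : ‖b ⬝ᵥ shift B (q k) x‖ ≤ Cb * K' * t ^ k + Ca * K' / ρ * (k * t ^ k) := by
      have h2 := (hCb' (B ^ k *ᵥ shift B (q k) x)).trans (mul_le_mul_of_nonneg_left hz hCb.le)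
      rw [dotProduct_pow_mulVec_chain ha hb] at h2
      have h4 : ‖(k : Quat) * ν ^ (k - 1) * (a ⬝ᵥ shift B (q k) x)‖
          ≤ k * ρ ^ (k - 1) * (Ca * K' * t ^ k) := by
        have hkn : ‖(k : Quat)‖ = k := by
          rw [← Quaternion.coe_natCast, Quaternion.norm_coe, Real.norm_natCast]
        rw [norm_mul, norm_mul, norm_pow, hkn]
        gcongr
      have h5 : ‖ν ^ k * (b ⬝ᵥ shift B (q k) x)‖ ≤ Cb * (K' * (t ^ k * ρ ^ k))
          + k * ρ ^ (k - 1) * (Ca * K' * t ^ k) := by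
        refine (norm_le_add_norm_add _ _).trans (add_le_add h2 h4)
      rw [norm_mul, norm_pow] at h5
      refine le_of_mul_le_mul_left (h5.trans (le_of_eq ?_)) hρk
      obtain ⟨j, rfl⟩ := Nat.exists_eq_add_of_le' hk1
      rw [Nat.add_sub_cancel, pow_succ ρ]
      field_simp
    rw [hwk k]
    refine (norm_sub_le _ _).trans (add_le_add h3 ?_)
    rw [norm_mul]
    gcongr
  have hlim : Tendsto (fun k : ℕ => Cb * K' * t ^ k + Ca * K' / ρ * (k * t ^ k)
      + ‖f * g⁻¹‖ * (Ca * K' * t ^ k)) atTop (𝓝 0) := by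
    have h1 := tendsto_pow_atTop_nhds_zero_of_lt_one ht0.le ht1
    have h2 := tendsto_self_mul_const_pow_of_lt_one ht0.le ht1
    simpa using ((h1.const_mul (Cb * K')).add (h2.const_mul (Ca * K' / ρ))).add
      ((h1.const_mul (Ca * K')).const_mul ‖f * g⁻¹‖)
  have hw0 : w = 0 := norm_le_zero_iff.1 (ge_of_tendsto hlim hbound)
  -- A commutator of quaternions has real part zero and cannot equal `-1`.
  have h6 : ν * (f * g⁻¹) + 1 - f * g⁻¹ * ν = w * g⁻¹ := by
    rw [hw, sub_mul, add_mul, mul_inv_cancel₀ hg, mul_assoc (f * g⁻¹), mul_assoc ν g,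
      mul_inv_cancel₀ hg, mul_one, mul_assoc ν]
  rw [hw0, zero_mul] at h6
  have h7 := congrArg reLin h6
  rw [map_sub, map_add, map_zero] at h7
  change (ν * (f * g⁻¹)).re + (1 : Quat).re - (f * g⁻¹ * ν).re = 0 at h7
  rw [re_mul_comm] at h7
  norm_num at h7

/-- Along a left Jordan chain of length two the powers outgrow `k ρ ^ k`. -/
theorem exists_mul_le_norm_pow_mulVec {B : Matrix (Fin n) (Fin n) Quat} {ν : Quat}
    {a b x : Fin n → Quat} (ha : a ᵥ* B = ν • a) (hb : b ᵥ* B = ν • b + a) (hg : a ⬝ᵥ x ≠ 0)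
    (hν : ν ≠ 0) : ∃ c : ℝ, 0 < c ∧ ∀ᶠ k : ℕ in atTop, c * k * ‖ν‖ ^ k ≤ ‖B ^ k *ᵥ x‖ := by
  have hρ0 : 0 < ‖ν‖ := norm_pos_iff.2 hν
  have hg0 : 0 < ‖a ⬝ᵥ x‖ := norm_pos_iff.2 hg
  obtain ⟨Cb, hCb, hCb'⟩ := exists_norm_dotProduct_le b
  refine ⟨‖a ⬝ᵥ x‖ / (2 * ‖ν‖ * Cb), by positivity, ?_⟩
  -- From here on the term `ν ^ k (b x)` is at most half of the chain term `k ν ^ (k - 1) (a x)`.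
  obtain ⟨k₀, hk₀⟩ := exists_nat_ge (2 * ‖ν‖ * ‖b ⬝ᵥ x‖ / ‖a ⬝ᵥ x‖)
  filter_upwards [eventually_ge_atTop k₀, eventually_ge_atTop 1] with k hk hk1
  have h1 : 2 * ‖ν‖ * ‖b ⬝ᵥ x‖ ≤ k * ‖a ⬝ᵥ x‖ :=
    (div_le_iff₀ hg0).1 (hk₀.trans (by exact_mod_cast hk))
  have h2 := hCb' (B ^ k *ᵥ x)
  have hkn : ‖(k : Quat)‖ = k := by
    rw [← Quaternion.coe_natCast, Quaternion.norm_coe, Real.norm_natCast]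
  have h3 : k * ‖ν‖ ^ (k - 1) * ‖a ⬝ᵥ x‖ - ‖ν‖ ^ k * ‖b ⬝ᵥ x‖ ≤ ‖b ⬝ᵥ (B ^ k *ᵥ x)‖ := by
    rw [dotProduct_pow_mulVec_chain ha hb, ← hkn, ← norm_pow, ← norm_pow, ← norm_mul, ← norm_mul,
      ← norm_mul, add_comm]
    have := norm_sub_norm_le ((k : Quat) * ν ^ (k - 1) * a ⬝ᵥ x) (-(ν ^ k * b ⬝ᵥ x))
    rwa [norm_neg, sub_neg_eq_add] at this
  obtain ⟨j, rfl⟩ := Nat.exists_eq_add_of_le' hk1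
  rw [Nat.add_sub_cancel] at h3
  have h4 : ‖ν‖ ^ (j + 1) * ‖b ⬝ᵥ x‖ ≤ ((j + 1 : ℕ) : ℝ) * ‖ν‖ ^ j * ‖a ⬝ᵥ x‖ / 2 := by
    rw [pow_succ]
    have h5 := mul_le_mul_of_nonneg_left h1 (pow_nonneg hρ0.le j)
    linarith
  have h6 : ((j + 1 : ℕ) : ℝ) * ‖ν‖ ^ j * ‖a ⬝ᵥ x‖ / 2 ≤ Cb * ‖B ^ (j + 1) *ᵥ x‖ := by linarith
  rw [← div_le_iff₀' hCb] at h6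
  refine le_trans (le_of_eq ?_) h6
  rw [pow_succ]
  field_simp

/-- The eigenvalue may be any quaternion. An eigenvalue beyond `ρ` would make the powers of its
eigenvector outgrow `r ^ k` for some `r > ρ`. -/
theorem norm_eigenvalue_le {B : Matrix (Fin n) (Fin n) Quat} {ρ : ℝ} (hρ : 0 ≤ ρ)
    (hmax : ∀ μ, IsStandardEigenvalue B μ → ‖μ‖ ≤ ρ) {q : Quat} {x : Fin n → Quat} (hx0 : x ≠ 0)
    (hx : shift B q x = 0) : ‖q‖ ≤ ρ := by
  by_contra! hlt
  obtain ⟨r, hr, hrq⟩ := exists_between hlt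
  have hr0 : 0 < r := hρ.trans_lt hr
  obtain ⟨C, -, hCk⟩ := exists_norm_pow_mulVec_le hmax hr x
  rw [shift_apply, sub_eq_zero] at hx
  have hx0' : 0 < ‖x‖ := norm_pos_iff.2 hx0
  have h1 : ∀ k : ℕ, (‖q‖ / r) ^ k ≤ C / ‖x‖ := fun k => by
    have := hCk k
    rw [pow_mulVec_of_eigenvector hx, norm_rsmul, norm_pow] at this
    rw [div_pow, div_le_div_iff₀ (by positivity) hx0']
    linarith
  have h2 := tendsto_pow_atTop_atTop_of_one_lt ((one_lt_div hr0).2 hrq)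
  obtain ⟨k, hk⟩ := (h2.eventually_gt_atTop (C / ‖x‖)).exists
  exact absurd (h1 k) (not_le.2 hk)

/-! ### Similarity -/

@[simp] theorem fst_conj (q : DualQuat) : (conj q).fst = star q.fst := by simp [conj]

@[simp] theorem snd_conj (q : DualQuat) : (conj q).snd = star q.snd := by simp [conj]

theorem IsUnitDQ.fst_mul_star {u : DualQuat} (hu : IsUnitDQ u) : u.fst * star u.fst = 1 := by
  have h := congrArg TrivSqZeroExt.fst hu
  rw [TrivSqZeroExt.fst_mul, fst_conj, TrivSqZeroExt.fst_one] at h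
  rw [Quaternion.self_mul_star, ← Quaternion.star_mul_self, h]

/-- Multiply the dual part of `u^* u = 1` by `u_s` from the left and by `u_s^*` from the right. -/
theorem IsUnitDQ.snd_mul_star {u : DualQuat} (hu : IsUnitDQ u) :
    u.fst * star u.snd + u.snd * star u.fst = 0 := by
  have h := congrArg TrivSqZeroExt.snd hu
  rw [TrivSqZeroExt.snd_mul, fst_conj, snd_conj, TrivSqZeroExt.snd_one, smul_eq_mul,
    MulOpposite.smul_eq_mul_unop, MulOpposite.unop_op] at h
  have h1 := hu.fst_mul_star
  have h2 : u.fst * (star u.fst * u.snd + star u.snd * u.fst) * star u.fst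
      = (u.fst * star u.fst) * u.snd * star u.fst + u.fst * star u.snd * (u.fst * star u.fst) := by
    noncomm_ring
  rw [h, h1, mul_zero, zero_mul, one_mul, mul_one] at h2
  rw [add_comm]
  exact h2.symm

theorem IsUnitDQ.mul_conj {u : DualQuat} (hu : IsUnitDQ u) : u * conj u = 1 := by
  refine TrivSqZeroExt.ext ?_ ?_
  · rw [TrivSqZeroExt.fst_mul, fst_conj, TrivSqZeroExt.fst_one, hu.fst_mul_star]
  · rw [TrivSqZeroExt.snd_mul, fst_conj, snd_conj, TrivSqZeroExt.snd_one, smul_eq_mul,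
      MulOpposite.smul_eq_mul_unop, MulOpposite.unop_op, hu.snd_mul_star]

theorem IsUnitDQ.norm_fst {u : DualQuat} (hu : IsUnitDQ u) : ‖u.fst‖ = 1 := by
  have h := congrArg norm hu.fst_mul_star
  rw [norm_mul, norm_star, norm_one] at h
  nlinarith [norm_nonneg u.fst]

/-- The real part of the dual part is a similarity invariant. -/
theorem Similar.re_snd_eq {p q : DualQuat} (h : Similar p q) : q.snd.re = p.snd.re := by
  obtain ⟨u, hu, rfl⟩ := h
  simp only [TrivSqZeroExt.snd_mul, TrivSqZeroExt.fst_mul, fst_conj, snd_conj, smul_eq_mul,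
    MulOpposite.smul_eq_mul_unop, MulOpposite.unop_op, Quaternion.re_add, add_mul]
  rw [re_mul_comm (star u.fst * p.fst) u.snd, re_mul_comm (star u.fst * p.snd) u.fst,
    re_mul_comm (star u.snd * p.fst) u.fst, ← mul_assoc, ← mul_assoc, ← mul_assoc, hu.fst_mul_star,
    one_mul, add_comm p.snd.re, ← add_assoc, ← Quaternion.re_add, ← add_mul,
    add_comm (u.snd * _), hu.snd_mul_star, zero_mul, Quaternion.re_zero, zero_add]

/-! ### Strict dominance -/

/-- Standard parts of the solutions of `A x = x μ`. -/
def standardEigenspace (A : Matrix (Fin n) (Fin n) DualQuat) (μ : DualQuat) :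
    Submodule ℝ (Fin n → Quat) where
  carrier := {x | shift (stMat A) μ.fst x = 0 ∧
    ∃ y, shift (stMat A) μ.fst y = rsmul x μ.snd - duMat A *ᵥ x}
  zero_mem' := ⟨map_zero _, 0, by simp⟩
  add_mem' := by
    rintro x x' ⟨hx, y, hy⟩ ⟨hx', y', hy'⟩
    refine ⟨by rw [map_add, hx, hx', add_zero], y + y', ?_⟩
    rw [map_add, hy, hy', rsmul_add, Matrix.mulVec_add]
    abel
  smul_mem' := by
    rintro c x ⟨hx, y, hy⟩
    refine ⟨by rw [map_smul, hx, smul_zero], c • y, ?_⟩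
    rw [map_smul, hy, smul_sub, Matrix.mulVec_smul]
    congr 1
    ext1 i
    simp

/-- If `x = shift z` lifts to an eigenvector for `μ`, adding `z` to the dual part gives one for `μ +
ε`. That eigenvalue has the same standard part but is not similar to `μ`, which contradicts strict
dominance. -/
theorem disjoint_range_standardEigenspace {A : Matrix (Fin n) (Fin n) DualQuat} {μ : DualQuat}
    (hμ : IsStrictDominant A μ) :
    Disjoint (shift (stMat A) μ.fst).range (standardEigenspace A μ) := by
  rw [Submodule.disjoint_def]
  rintro _ ⟨z, rfl⟩ ⟨hx, y, hy⟩
  by_contra hne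
  set x := shift (stMat A) μ.fst z with hxz
  set ν : DualQuat := TrivSqZeroExt.inl μ.fst + TrivSqZeroExt.inr (μ.snd + 1) with hν
  have hν1 : ν.fst = μ.fst := by simp [hν]
  have hν2 : ν.snd = μ.snd + 1 := by simp [hν]
  refine lt_irrefl ‖ν.fst‖ (lt_of_lt_of_eq (hμ.2 ν ⟨mkVec x (y + z), by simpa using hne, ?_⟩
    fun hs => ?_) (by rw [hν1]))
  · rw [mulVec_eq_rsmul_iff, hν1, hν2, stVec_mkVec, duVec_mkVec]
    refine ⟨hx, ?_⟩
    rw [map_add, hy, ← hxz, add_rsmul, rsmul_one]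
    abel
  · have := hs.re_snd_eq
    rw [hν2] at this
    simp at this

/-- Right multiplication by `u^*` carries eigenvectors for `u^* μ u` to eigenvectors for `μ`, so one
fixed space serves the whole similarity class. -/
theorem stVec_mem_standardEigenspace {A : Matrix (Fin n) (Fin n) DualQuat} {μ ν u : DualQuat}
    {w : Fin n → DualQuat} (hu : IsUnitDQ u) (hν : conj u * μ * u = ν) (hw : A *ᵥ w = rsmul w ν) :
    rsmul (stVec w) (star u.fst) ∈ standardEigenspace A μ := by
  have h1 : A *ᵥ rsmul w (conj u) = rsmul (rsmul w (conj u)) μ := by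
    rw [mulVec_rsmul, hw, rsmul_rsmul, rsmul_rsmul, ← hν, mul_assoc, hu.mul_conj, mul_one]
  obtain ⟨h2, h3⟩ := (mulVec_eq_rsmul_iff _ _ _).1 h1
  rw [stVec_rsmul, fst_conj] at h2 h3
  exact ⟨h2, _, h3⟩

/-- A projection onto the standard parts of the eigenvectors turns powers of the matrix into powers
of the eigenvalue. -/
theorem exists_projection_standardEigenspace {A : Matrix (Fin n) (Fin n) DualQuat} {μ : DualQuat}
    (hμ : IsStrictDominant A μ) : ∃ P : (Fin n → Quat) →ₗ[ℝ] (Fin n → Quat),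
      (∀ (k : ℕ) y, P (stMat A ^ k *ᵥ y) = P (rsmul y (μ.fst ^ k))) ∧
      ∀ y ∈ standardEigenspace A μ, P y = y := by
  -- The complement is chosen to contain the range of the shift. The projection along it therefore
  -- satisfies `P (B y) = P (y μ)`.
  obtain ⟨R, hR, hRK⟩ := (disjoint_range_standardEigenspace hμ).exists_isCompl
  set P := (standardEigenspace A μ).projection R hRK.symm with hP
  have hPr : ∀ y, P (shift (stMat A) μ.fst y) = 0 := fun y =>
    (Submodule.projection_apply_eq_zero_iff _).2 (hR ⟨y, rfl⟩)
  refine ⟨P, fun k => ?_, fun y hy => (Submodule.projection_eq_self_iff _ _).2 hy⟩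
  induction k with
  | zero => intro y; simp
  | succ k ih =>
    intro y
    have h1 := hPr (stMat A ^ k *ᵥ y)
    rw [shift_apply, map_sub, sub_eq_zero, ← mulVec_rsmul, ih, rsmul_rsmul, ← pow_succ'] at h1
    rw [pow_succ_mulVec, h1]

theorem mul_inv_bound {s c k r C x : ℝ} (hc : 0 < c) (hk : 0 < k) (hC : 0 ≤ C) (hx : 0 ≤ x)
    (h : s * (c * k * r) ≤ 1) : s * (C * x * r) ≤ C * x / c * k⁻¹ := by
  calc s * (C * x * r) = C * x / c * k⁻¹ * (s * (c * k * r)) := by field_simp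
    _ ≤ C * x / c * k⁻¹ * 1 := by gcongr
    _ = _ := mul_one _

/-- If the powers outgrow `ρ ^ k`, no strict dominant eigenpair is approached. -/
theorem not_approaches_strictDominant {A : Matrix (Fin n) (Fin n) DualQuat} {v0 : Fin n → DualQuat}
    {ρ c : ℝ} (hρ : 0 < ρ) (hmax : ∀ μ, IsStandardEigenvalue (stMat A) μ → ‖μ‖ ≤ ρ)
    (hx : ∀ k, stMat A ^ k *ᵥ stVec v0 ≠ 0) (hc : 0 < c)
    (hgrow : ∀ᶠ k : ℕ in atTop, c * k * ρ ^ k ≤ ‖stMat A ^ k *ᵥ stVec v0‖) {μ : DualQuat}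
    (hμ : IsStrictDominant A μ) : ¬ ApproachesEigenvectors A v0 {ν | Similar μ ν} := by
  rintro ⟨w, hw, hlim⟩
  obtain ⟨P, hPpow, hPK⟩ := exists_projection_standardEigenspace hμ
  have hq : ‖μ.fst‖ ≤ ρ := by
    obtain ⟨⟨y, hy0, hy⟩, -⟩ := hμ
    exact norm_eigenvalue_le hρ.le hmax hy0 ((mulVec_eq_rsmul_iff _ _ _).1 hy).1
  obtain ⟨C, hC, hCP⟩ := exists_norm_le P
  set x := stVec v0 with hxdef
  have hbound : ∀ᶠ k : ℕ in atTop,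
      1 ≤ n * (C * ‖x‖ / c * (k : ℝ)⁻¹ + (C + 1) * normR (pmVec A v0 k - w k)) := by
    filter_upwards [hgrow, eventually_ge_atTop 1] with k hk hk1
    obtain ⟨ν, ⟨u, hu, huν⟩, -, hwν⟩ := hw k
    have hmem := stVec_mem_standardEigenspace hu huν hwν
    obtain ⟨s, hs, hsk⟩ := exists_stVec_pmVec A v0 k hx
    have hn := one_le_mul_norm_stVec_pmVec hx hk1
    have hle1 := norm_stVec_pmVec_le hx hk1
    have he : ‖stVec (pmVec A v0 k) - stVec (w k)‖ ≤ normR (pmVec A v0 k - w k) :=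
      norm_stVec_le_normR (pmVec A v0 k - w k)
    set U := stVec (pmVec A v0 k) with hU
    set W := stVec (w k) with hW
    set e := normR (pmVec A v0 k - w k) with hedef
    have hu1 : ‖star u.fst‖ = 1 := by rw [norm_star, hu.norm_fst]
    have hk0 : (0 : ℝ) < k := by exact_mod_cast hk1
    have hρk : 0 < ρ ^ k := by positivity
    have hs1 : s * (c * k * ρ ^ k) ≤ 1 := by
      refine le_trans (mul_le_mul_of_nonneg_left hk hs.le) ?_
      rw [hsk, norm_smul, Real.norm_of_nonneg hs.le] at hle1
      exact hle1
    -- The projection of `B ^ k x` is `O(ρ ^ k)`, while normalization divides by at least `c k ρ ^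
    -- k`.
    have h1 : ‖P (rsmul U (star u.fst))‖ ≤ C * ‖x‖ / c * (k : ℝ)⁻¹ := by
      have h2 : rsmul U (star u.fst) = s • stMat A ^ k *ᵥ rsmul x (star u.fst) := by
        rw [hsk, mulVec_rsmul]; ext1 i; simp [hxdef]
      rw [h2, map_smul, hPpow, norm_smul, Real.norm_of_nonneg hs.le]
      have h3 : ‖P (rsmul (rsmul x (star u.fst)) (μ.fst ^ k))‖ ≤ C * ‖x‖ * ρ ^ k := by
        refine (hCP _).trans ?_
        rw [norm_rsmul, norm_rsmul, hu1, norm_pow, mul_one, ← mul_assoc]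
        gcongr
      calc _ ≤ s * (C * ‖x‖ * ρ ^ k) := by gcongr
        _ ≤ _ := mul_inv_bound hc hk0 hC.le (norm_nonneg x) hs1
    -- After rotation by `u^*` the eigenvector is fixed by `P`. It is then as small as the projected
    -- iterate, although it approximates a vector of norm one.
    have h4 : ‖W‖ ≤ C * ‖x‖ / c * (k : ℝ)⁻¹ + C * e := by
      calc ‖W‖ = ‖P (rsmul W (star u.fst))‖ := by rw [hPK _ hmem, norm_rsmul, hu1, mul_one]
        _ = ‖P (rsmul U (star u.fst)) - P (rsmul (U - W) (star u.fst))‖ := by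
            rw [← map_sub, ← rsmul_sub, sub_sub_cancel]
        _ ≤ C * ‖x‖ / c * (k : ℝ)⁻¹ + C * e := by
            refine (norm_sub_le _ _).trans (add_le_add h1 ((hCP _).trans ?_))
            rw [norm_rsmul, hu1, mul_one]
            gcongr
    have h5 : ‖U‖ ≤ ‖W‖ + e := by
      have := norm_add_le W (U - W)
      rw [add_sub_cancel] at this
      linarith
    refine hn.trans ?_
    gcongr
    linarith
  have hlim' : Tendsto (fun k : ℕ => n * (C * ‖x‖ / c * (k : ℝ)⁻¹
      + (C + 1) * normR (pmVec A v0 k - w k))) atTop (𝓝 0) := by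
    simpa using ((tendsto_inv_atTop_nhds_zero_nat (𝕜 := ℝ).const_mul (C * ‖x‖ / c)).add
      (hlim.const_mul (C + 1))).const_mul (n : ℝ)
  exact absurd (ge_of_tendsto hlim' hbound) (by norm_num)

/-! ### Failure for a defective dominant eigenvalue -/

/-- The only genericity needed is that the left eigenvector ending a left chain does not annihilate
the start. -/
theorem failure_of_defective {A : Matrix (Fin n) (Fin n) DualQuat} {ν : ℂ} (hν : ν ≠ 0)
    (hmax : ∀ μ, IsStandardEigenvalue (stMat A) μ → ‖μ‖ ≤ ‖ν‖)
    (hdef : ¬ Semisimple (stMat A) ν) :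
    ∃ p : MvPolynomial (Fin n × Fin 4) ℝ, p ≠ 0 ∧
      ∀ v0 : Fin n → DualQuat, MvPolynomial.eval (coords (stVec v0)) p ≠ 0 →
        WellDefined A v0 ∧
        (∀ μ : DualQuat, IsStrictDominant A μ →
          ¬ ApproachesEigenvectors A v0 {ν | Similar μ ν}) ∧
        ∀ c : ℝ, 0 < c → c < 1 →
          ¬ pmResidual A v0 =O[Filter.atTop] (fun k => c ^ k) ∧
          ¬ ApproachesEigenvectorsAtRate A v0 c := by
  have hdef' : ∃ x, shift (stMat A) ν (shift (stMat A) ν x) = 0 ∧ shift (stMat A) ν x ≠ 0 := by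
    unfold Semisimple at hdef
    push Not at hdef
    exact hdef
  obtain ⟨x₀, hx2, hx1⟩ := hdef'
  obtain ⟨a, b, y, ha, hb, hay⟩ := exists_left_chain hx1 hx2
  obtain ⟨p, hp0, hp⟩ := (QuatPolyFun.dotProduct a).exists_polynomial hay
  have hνq : (ν : Quat) ≠ 0 := by
    rw [← norm_ne_zero_iff, norm_coeComplex]; exact norm_ne_zero_iff.2 hν
  have hmax' : ∀ μ, IsStandardEigenvalue (stMat A) μ → ‖μ‖ ≤ ‖(ν : Quat)‖ := by
    rwa [norm_coeComplex]
  refine ⟨p, hp0, fun v0 hv0 => ?_⟩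
  have hg : a ⬝ᵥ stVec v0 ≠ 0 := hp _ hv0
  have hx := pow_mulVec_ne_zero hνq ha hg
  have key : ∀ (c K : ℝ) (q : ℕ → Quat), 0 < c → c < 1 →
      ¬ ∀ᶠ k in atTop, ‖shift (stMat A) (q k) (stVec (pmVec A v0 k))‖ ≤ K * c ^ k := by
    intro c K q hc0 hc1 h
    -- The factor `n` comes from `1 ≤ n ‖u‖` in the maximum norm for a normalized iterate `u`.
    refine not_geometric_of_chain ha hb hg hνq hmax' hc0 hc1 (K := |K| * n) q ?_
    filter_upwards [h, eventually_ge_atTop 1] with k hk hk1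
    have hn := one_le_mul_norm_stVec_pmVec hx hk1
    obtain ⟨s, hs, hsk⟩ := exists_stVec_pmVec A v0 k hx
    rw [hsk, norm_smul, Real.norm_of_nonneg hs.le] at hn
    rw [hsk, shift_smul_eq, abs_of_pos hs] at hk
    refine le_of_mul_le_mul_left ?_ hs
    calc _ ≤ |K| * c ^ k * 1 := by
          rw [mul_one]
          exact hk.trans (by gcongr; exact le_abs_self K)
      _ ≤ |K| * c ^ k * (n * (s * ‖stMat A ^ k *ᵥ stVec v0‖)) := by gcongr
      _ = _ := by ring
  refine ⟨wellDefined_of_pow_ne_zero hx, fun μ hμ => ?_, fun c hc0 hc1 => ⟨fun hO => ?_, ?_⟩⟩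
  · obtain ⟨c, hc, hgrow⟩ := exists_mul_le_norm_pow_mulVec ha hb hg hνq
    exact not_approaches_strictDominant (norm_pos_iff.2 hνq) hmax' hx hc hgrow hμ
  · obtain ⟨K, hK⟩ := hO.bound
    refine key c K (fun k => (pmVal A v0 k).fst) hc0 hc1 ?_
    filter_upwards [hK] with k hk
    rw [Real.norm_of_nonneg (pow_nonneg hc0.le k)] at hk
    exact (norm_shift_stVec_pmVec_le_pmResidual A v0 k).trans ((le_abs_self _).trans hk)
  · rintro ⟨w, hw, hO⟩
    choose μ hμ using hw
    obtain ⟨K, hK⟩ := hO.bound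
    obtain ⟨C, hC, hCB⟩ := exists_norm_mulVec_le (stMat A)
    refine key c (2 * C * K) (fun k => (μ k).fst) hc0 hc1 ?_
    filter_upwards [hK] with k hk
    rw [Real.norm_of_nonneg (pow_nonneg hc0.le k), Real.norm_of_nonneg (normR_nonneg _)] at hk
    refine (norm_shift_le_of_eigenvector hCB (hμ k).1
      ((mulVec_eq_rsmul_iff _ _ _).1 (hμ k).2).1 _).trans ?_
    rw [mul_assoc (2 * C)]
    gcongr
    exact (norm_stVec_le_normR (pmVec A v0 k - w k)).trans hk

/-! ### Semisimple dominant eigenvalues: several left eigenvectors -/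

/-- The iterates stay away from eigenvectors, and the residuals away from zero. -/
def NoEigenpair (A : Matrix (Fin n) (Fin n) DualQuat) (v0 : Fin n → DualQuat) : Prop :=
  ¬ ApproachesEigenvectors A v0 Set.univ ∧ ∃ δ : ℝ, 0 < δ ∧ ∀ k : ℕ, δ ≤ pmResidual A v0 k

theorem NoEigenpair.not_approaches {A : Matrix (Fin n) (Fin n) DualQuat} {v0 : Fin n → DualQuat}
    (h : NoEigenpair A v0) (S : Set DualQuat) : ¬ ApproachesEigenvectors A v0 S := by
  rintro ⟨w, hw, hlim⟩
  exact h.1 ⟨w, fun k => (hw k).imp fun μ hμ => ⟨trivial, hμ.2⟩, hlim⟩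

theorem NoEigenpair.not_rate {A : Matrix (Fin n) (Fin n) DualQuat} {v0 : Fin n → DualQuat}
    (h : NoEigenpair A v0) {c : ℝ} (hc0 : 0 < c) (hc1 : c < 1) :
    ¬ pmResidual A v0 =O[Filter.atTop] (fun k => c ^ k) ∧
      ¬ ApproachesEigenvectorsAtRate A v0 c := by
  have hlim := tendsto_pow_atTop_nhds_zero_of_lt_one hc0.le hc1
  refine ⟨fun hO => ?_, ?_⟩
  · obtain ⟨δ, hδ, hr⟩ := h.2
    exact absurd (ge_of_tendsto (hO.trans_tendsto hlim) (Eventually.of_forall hr)) (not_le.2 hδ)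
  · rintro ⟨w, hw, hO⟩
    exact h.1 ⟨w, fun k => (hw k).imp fun μ hμ => ⟨trivial, hμ⟩, hO.trans_tendsto hlim⟩

/-- Let `T = G₂ G₁⁻¹` be the quotient of the two pairings with `B ^ k x`. At an eigenvector for `q`
both `μ₁ G₁ = G₁ q` and `μ₂ G₂ = G₂ q` hold, hence `μ₂ T = T μ₁`. But `μ₂ T - T μ₁ = μ₂ ^ k (μ₂ t -
t μ₁) μ₁ ^ (-k)` has the same norm for every `k`, and it is controlled by the defect. -/
theorem exists_delta_of_two_rows {B : Matrix (Fin n) (Fin n) Quat} {μ₁ μ₂ : Quat}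
    {a₁ a₂ x : Fin n → Quat} {ρ C : ℝ} (hρ : 0 < ρ) (ha₁ : a₁ ᵥ* B = μ₁ • a₁)
    (ha₂ : a₂ ᵥ* B = μ₂ • a₂) (hμ₁ : ‖μ₁‖ = ρ) (hμ₂ : ‖μ₂‖ = ρ) (hg : a₁ ⬝ᵥ x ≠ 0)
    (ht : μ₂ * ((a₂ ⬝ᵥ x) * (a₁ ⬝ᵥ x)⁻¹) - (a₂ ⬝ᵥ x) * (a₁ ⬝ᵥ x)⁻¹ * μ₁ ≠ 0)
    (hC : 0 < C) (hCk : ∀ k, ‖B ^ k *ᵥ x‖ ≤ C * ρ ^ k) :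
    ∃ δ : ℝ, 0 < δ ∧ ∀ k q, δ * ‖B ^ k *ᵥ x‖ ≤ ‖shift B q (B ^ k *ᵥ x)‖ := by
  obtain ⟨C₁, hC₁, hC₁'⟩ := exists_norm_dotProduct_le a₁
  obtain ⟨C₂, hC₂, hC₂'⟩ := exists_norm_dotProduct_le a₂
  set g₁ := a₁ ⬝ᵥ x with hg₁
  set g₂ := a₂ ⬝ᵥ x with hg₂
  set t := g₂ * g₁⁻¹ with htdef
  set D := ‖μ₂ * t - t * μ₁‖ with hD
  have hD0 : 0 < D := norm_pos_iff.2 ht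
  have hg0 : 0 < ‖g₁‖ := norm_pos_iff.2 hg
  have hμ₁0 : μ₁ ≠ 0 := norm_pos_iff.1 (by rw [hμ₁]; exact hρ)
  refine ⟨D * ‖g₁‖ / (C * (C₂ + ‖t‖ * C₁)), by positivity, fun k q => ?_⟩
  have hρk : 0 < ρ ^ k := by positivity
  set z := B ^ k *ᵥ x with hz
  set e := shift B q z with he
  set G₁ := μ₁ ^ k * g₁ with hG₁
  set G₂ := μ₂ ^ k * g₂ with hG₂
  have hG₁0 : G₁ ≠ 0 := mul_ne_zero (pow_ne_zero _ hμ₁0) hg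
  have hE₁ : a₁ ⬝ᵥ e = μ₁ * G₁ - G₁ * q := by
    rw [he, shift_apply, dotProduct_sub, Matrix.dotProduct_mulVec, ha₁, smul_dotProduct,
      smul_eq_mul, dotProduct_rsmul, hz, dotProduct_pow_mulVec ha₁]
  have hE₂ : a₂ ⬝ᵥ e = μ₂ * G₂ - G₂ * q := by
    rw [he, shift_apply, dotProduct_sub, Matrix.dotProduct_mulVec, ha₂, smul_dotProduct,
      smul_eq_mul, dotProduct_rsmul, hz, dotProduct_pow_mulVec ha₂]
  have hT : G₂ * G₁⁻¹ = μ₂ ^ k * t * (μ₁ ^ k)⁻¹ := by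
    rw [hG₁, hG₂, mul_inv_rev, htdef]; simp only [mul_assoc]
  have h1 : μ₂ * (G₂ * G₁⁻¹) - G₂ * G₁⁻¹ * μ₁ = μ₂ ^ k * (μ₂ * t - t * μ₁) * (μ₁ ^ k)⁻¹ := by
    have hc1 : μ₂ * μ₂ ^ k = μ₂ ^ k * μ₂ := by rw [← pow_succ, ← pow_succ']
    have hc2 : (μ₁ ^ k)⁻¹ * μ₁ = μ₁ * (μ₁ ^ k)⁻¹ :=
      ((Commute.refl μ₁).pow_left k).inv_left₀.eq
    rw [hT, mul_assoc (μ₂ ^ k * t), hc2, ← mul_assoc μ₂, ← mul_assoc μ₂, hc1]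
    simp only [mul_sub, sub_mul, mul_assoc]
  have h2 : μ₂ * (G₂ * G₁⁻¹) - G₂ * G₁⁻¹ * μ₁
      = (a₂ ⬝ᵥ e) * G₁⁻¹ - G₂ * G₁⁻¹ * (a₁ ⬝ᵥ e) * G₁⁻¹ := by
    rw [hE₁, hE₂, sub_mul, mul_sub, sub_mul, mul_assoc (G₂ * G₁⁻¹) (μ₁ * G₁), mul_assoc μ₁,
      mul_inv_cancel₀ hG₁0, mul_one, mul_assoc G₂ G₁⁻¹ (G₁ * q), inv_mul_cancel_left₀ hG₁0,
      mul_assoc μ₂]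
    abel
  have hnT : ‖G₂ * G₁⁻¹‖ = ‖t‖ := by
    rw [hT, norm_mul, norm_mul, norm_inv, norm_pow, norm_pow, hμ₁, hμ₂]
    field_simp
  have h3 : D ≤ ‖e‖ * (C₂ + ‖t‖ * C₁) * ‖G₁‖⁻¹ := by
    calc D = ‖μ₂ * (G₂ * G₁⁻¹) - G₂ * G₁⁻¹ * μ₁‖ := by
          rw [h1, norm_mul, norm_mul, norm_inv, norm_pow, norm_pow, hμ₁, hμ₂, hD]
          field_simp
      _ ≤ ‖a₂ ⬝ᵥ e‖ * ‖G₁‖⁻¹ + ‖t‖ * ‖a₁ ⬝ᵥ e‖ * ‖G₁‖⁻¹ := by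
          rw [h2]
          refine (norm_sub_le _ _).trans (le_of_eq ?_)
          rw [norm_mul, norm_mul, norm_mul (G₂ * G₁⁻¹), hnT, norm_inv]
      _ ≤ C₂ * ‖e‖ * ‖G₁‖⁻¹ + ‖t‖ * (C₁ * ‖e‖) * ‖G₁‖⁻¹ := by
          gcongr
          · exact hC₂' e
          · exact hC₁' e
      _ = _ := by ring
  have hnG : ‖G₁‖ = ρ ^ k * ‖g₁‖ := by rw [hG₁, norm_mul, norm_pow, hμ₁]
  have h4 : D * (ρ ^ k * ‖g₁‖) ≤ ‖e‖ * (C₂ + ‖t‖ * C₁) := by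
    rw [← hnG]
    exact (le_mul_inv_iff₀ (norm_pos_iff.2 hG₁0)).1 h3
  rw [div_mul_eq_mul_div, div_le_iff₀ (by positivity)]
  calc D * ‖g₁‖ * ‖z‖ ≤ D * ‖g₁‖ * (C * ρ ^ k) := by gcongr; exact hCk k
    _ = C * (D * (ρ ^ k * ‖g₁‖)) := by ring
    _ ≤ C * (‖e‖ * (C₂ + ‖t‖ * C₁)) := by gcongr
    _ = _ := by ring

theorem noEigenpair_of_delta {A : Matrix (Fin n) (Fin n) DualQuat} {v0 : Fin n → DualQuat}
    (hx : ∀ k, stMat A ^ k *ᵥ stVec v0 ≠ 0) {δ : ℝ} (hδ : 0 < δ)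
    (h : ∀ k q, δ * ‖stMat A ^ k *ᵥ stVec v0‖ ≤ ‖shift (stMat A) q (stMat A ^ k *ᵥ stVec v0)‖) :
    NoEigenpair A v0 := by
  have hx0 : 0 < ‖stVec v0‖ := norm_pos_iff.2 (by simpa using hx 0)
  have hu : ∀ k q, δ * ‖stVec (pmVec A v0 k)‖ ≤ ‖shift (stMat A) q (stVec (pmVec A v0 k))‖ := by
    intro k q
    obtain ⟨s, hs, hsk⟩ := exists_stVec_pmVec A v0 k hx
    rw [hsk, shift_smul_eq, norm_smul, Real.norm_eq_abs, mul_left_comm]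
    gcongr
    exact h k q
  have hlow : ∀ k q, 1 ≤ k → δ / (n + 1) ≤ ‖shift (stMat A) q (stVec (pmVec A v0 k))‖ := by
    intro k q hk
    refine le_trans ?_ (hu k q)
    rw [div_le_iff₀ (by positivity), mul_assoc]
    have := one_le_mul_norm_stVec_pmVec hx hk
    nlinarith [norm_nonneg (stVec (pmVec A v0 k))]
  -- The second entry handles `k = 0`, where the iterate is not normalized.
  refine ⟨?_, min (δ / (n + 1)) (δ * ‖stVec v0‖), by positivity, fun k => ?_⟩
  · rintro ⟨w, hw, hlim⟩
    obtain ⟨C, hC, hCB⟩ := exists_norm_mulVec_le (stMat A)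
    have hlim' : Tendsto (fun k => 2 * C * normR (pmVec A v0 k - w k)) atTop (𝓝 0) := by
      simpa using hlim.const_mul (2 * C)
    have hpos : 0 < δ / ((n : ℝ) + 1) := by positivity
    refine absurd (ge_of_tendsto hlim' ?_) (not_le.2 hpos)
    filter_upwards [eventually_ge_atTop 1] with k hk
    obtain ⟨μ, -, hw0, hAw⟩ := hw k
    refine (hlow k μ.fst hk).trans ((norm_shift_le_of_eigenvector hCB hw0
      ((mulVec_eq_rsmul_iff _ _ _).1 hAw).1 _).trans ?_)
    gcongr
    exact norm_stVec_le_normR (pmVec A v0 k - w k)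
  · refine le_trans ?_ (norm_shift_stVec_pmVec_le_pmResidual A v0 k)
    rcases Nat.eq_zero_or_pos k with rfl | hk
    · exact (min_le_right _ _).trans (hu 0 _)
    · exact (min_le_left _ _).trans (hlow k _ hk)

/-- Two left eigenvectors to eigenvalues of maximal magnitude which separate generic starts from
all eigenvectors. -/
theorem failure_of_two_rows {A : Matrix (Fin n) (Fin n) DualQuat} {μ₁ μ₂ : ℂ} {ρ : ℝ} (hρ : 0 < ρ)
    (hμ₁ : ‖μ₁‖ = ρ) (hμ₂ : ‖μ₂‖ = ρ) {a₁ a₂ x₀ : Fin n → Quat}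
    (ha₁ : a₁ ᵥ* stMat A = (μ₁ : Quat) • a₁) (ha₂ : a₂ ᵥ* stMat A = (μ₂ : Quat) • a₂)
    (hmax : ∀ μ, IsStandardEigenvalue (stMat A) μ → ‖μ‖ ≤ ρ)
    (hss : ∀ μ, IsStandardEigenvalue (stMat A) μ → ‖μ‖ = ρ → Semisimple (stMat A) μ)
    (hx₀ : (μ₂ : Quat) * ((a₂ ⬝ᵥ x₀) * star (a₁ ⬝ᵥ x₀))
      - (a₂ ⬝ᵥ x₀) * star (a₁ ⬝ᵥ x₀) * μ₁ ≠ 0) :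
    ∃ p : MvPolynomial (Fin n × Fin 4) ℝ, p ≠ 0 ∧
      ∀ v0 : Fin n → DualQuat, MvPolynomial.eval (coords (stVec v0)) p ≠ 0 →
        WellDefined A v0 ∧ NoEigenpair A v0 := by
  -- Using `star (a₁ x)` in place of the inverse makes the condition polynomial; it changes the
  -- expression by a real factor and also forces `a₁ x ≠ 0`.
  have hpoly : QuatPolyFun fun x : Fin n → Quat => (μ₂ : Quat) * ((a₂ ⬝ᵥ x) * star (a₁ ⬝ᵥ x))
      - (a₂ ⬝ᵥ x) * star (a₁ ⬝ᵥ x) * μ₁ :=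
    ((QuatPolyFun.const _).mul ((QuatPolyFun.dotProduct a₂).mul (QuatPolyFun.dotProduct a₁).star)).sub
      (((QuatPolyFun.dotProduct a₂).mul (QuatPolyFun.dotProduct a₁).star).mul (QuatPolyFun.const _))
  obtain ⟨p, hp0, hp⟩ := hpoly.exists_polynomial hx₀
  refine ⟨p, hp0, fun v0 hv0 => ?_⟩
  have hF := hp _ hv0
  set x := stVec v0 with hxdef
  have hg : a₁ ⬝ᵥ x ≠ 0 := fun h => hF (by simp [h])
  have hstar : star (a₁ ⬝ᵥ x) = (a₁ ⬝ᵥ x)⁻¹ * ((Quaternion.normSq (a₁ ⬝ᵥ x) : ℝ) : Quat) := by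
    rw [← Quaternion.self_mul_star, inv_mul_cancel_left₀ hg]
  have hF' : (μ₂ : Quat) * ((a₂ ⬝ᵥ x) * (a₁ ⬝ᵥ x)⁻¹) - (a₂ ⬝ᵥ x) * (a₁ ⬝ᵥ x)⁻¹ * μ₁ ≠ 0 := by
    intro h
    refine hF ?_
    rw [hstar, ← mul_assoc (a₂ ⬝ᵥ x), ← mul_assoc (μ₂ : Quat), mul_assoc _ _ (μ₁ : Quat),
      Quaternion.coe_commutes, ← mul_assoc _ (μ₁ : Quat), ← sub_mul, h, zero_mul]
  have hμ₁0 : (μ₁ : Quat) ≠ 0 := norm_pos_iff.1 (by rw [norm_coeComplex, hμ₁]; exact hρ)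
  have hx := pow_mulVec_ne_zero hμ₁0 ha₁ hg
  obtain ⟨C, hC, hCk⟩ := exists_norm_pow_mulVec_le_of_semisimple hmax hss x
  obtain ⟨δ, hδ, h⟩ := exists_delta_of_two_rows hρ ha₁ ha₂ (by rw [norm_coeComplex, hμ₁])
    (by rw [norm_coeComplex, hμ₂]) hg hF' (C := C + 1) (by positivity)
    (fun k => (hCk k).trans (by gcongr; linarith))
  exact ⟨wellDefined_of_pow_ne_zero hx, noEigenpair_of_delta hx hδ h⟩

/-- Conjugation preserves the real part. Equal magnitudes then leave only the sign of the imaginary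
part, which is fixed by assumption. -/
theorem eq_of_mul_eq_mul {μ₁ μ₂ : ℂ} (h1 : 0 ≤ μ₁.im) (h2 : 0 ≤ μ₂.im) (hn : ‖μ₁‖ = ‖μ₂‖)
    {s : Quat} (hs : s ≠ 0) (h : (μ₂ : Quat) * s = s * μ₁) : μ₁ = μ₂ := by
  have hre : μ₁.re = μ₂.re := by
    have h3 : (μ₂ : Quat) = s * μ₁ * s⁻¹ := by rw [← h, mul_inv_cancel_right₀ hs]
    have h4 := congrArg reLin h3
    change (μ₂ : Quat).re = (s * μ₁ * s⁻¹).re at h4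
    rw [re_mul_comm, inv_mul_cancel_left₀ hs] at h4
    simpa using h4.symm
  refine Complex.ext hre ?_
  have h5 := congrArg (fun r => r ^ 2) hn
  simp only [Complex.sq_norm, Complex.normSq_apply] at h5
  rw [hre] at h5
  nlinarith

/-- Two distinct semisimple dominant eigenvalues. -/
theorem failure_of_two_eigenvalues {A : Matrix (Fin n) (Fin n) DualQuat} {l μ : ℂ} (hl0 : l ≠ 0)
    (hl : IsStandardEigenvalue (stMat A) l) (hμ : IsStandardEigenvalue (stMat A) μ) (hne : μ ≠ l)
    (hnorm : ‖μ‖ = ‖l‖) (hmax : ∀ μ, IsStandardEigenvalue (stMat A) μ → ‖μ‖ ≤ ‖l‖)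
    (hss : ∀ μ, IsStandardEigenvalue (stMat A) μ → ‖μ‖ = ‖l‖ → Semisimple (stMat A) μ) :
    ∃ p : MvPolynomial (Fin n × Fin 4) ℝ, p ≠ 0 ∧
      ∀ v0 : Fin n → DualQuat, MvPolynomial.eval (coords (stVec v0)) p ≠ 0 →
        WellDefined A v0 ∧ NoEigenpair A v0 := by
  obtain ⟨hlim, e, he, hBe⟩ := hl
  obtain ⟨hμim, f, hf, hBf⟩ := hμ
  obtain ⟨a₁, y₁, ha₁, hy₁⟩ := exists_left_eigenvector he hBe
  obtain ⟨a₂, y₂, ha₂, hy₂⟩ := exists_left_eigenvector hf hBf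
  obtain ⟨x₀, hx₁, hx₂⟩ : ∃ x, a₁ ⬝ᵥ x ≠ 0 ∧ a₂ ⬝ᵥ x ≠ 0 := by
    by_cases h1 : a₂ ⬝ᵥ y₁ = 0
    · by_cases h2 : a₁ ⬝ᵥ y₂ = 0
      · exact ⟨y₁ + y₂, by rwa [dotProduct_add, h2, add_zero], by rwa [dotProduct_add, h1, zero_add]⟩
      · exact ⟨y₂, h2, hy₂⟩
    · exact ⟨y₁, hy₁, h1⟩
  refine failure_of_two_rows (norm_pos_iff.2 hl0) rfl hnorm ha₁ ha₂ hmax hss (x₀ := x₀) fun h => ?_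
  exact hne (eq_of_mul_eq_mul hlim hμim hnorm.symm (mul_ne_zero hx₂ (star_ne_zero.2 hx₁))
    (sub_eq_zero.1 h)).symm

/-- A multiple semisimple dominant eigenvalue which is not real. -/
theorem failure_of_nonreal {A : Matrix (Fin n) (Fin n) DualQuat} {l : ℂ}
    (hl : IsStandardEigenvalue (stMat A) l) (him : l.im ≠ 0) (hg : 1 < geomMult l (stMat A))
    (hmax : ∀ μ, IsStandardEigenvalue (stMat A) μ → ‖μ‖ ≤ ‖l‖)
    (hss : ∀ μ, IsStandardEigenvalue (stMat A) μ → ‖μ‖ = ‖l‖ → Semisimple (stMat A) μ) :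
    ∃ p : MvPolynomial (Fin n × Fin 4) ℝ, p ≠ 0 ∧
      ∀ v0 : Fin n → DualQuat, MvPolynomial.eval (coords (stVec v0)) p ≠ 0 →
        WellDefined A v0 ∧ NoEigenpair A v0 := by
  have hssl := hss l hl rfl
  have hl0 : l ≠ 0 := fun h => him (by rw [h]; rfl)
  obtain ⟨-, e, he, hBe⟩ := hl
  obtain ⟨a₁, y, ha₁, hy⟩ := exists_left_eigenvector he hBe
  -- These pairings commute with `l`, so quotients of them are scalars that preserve the eigenspace.
  -- This permits elimination between two independent eigenvectors.
  have hcomm : ∀ x, shift (stMat A) l x = 0 → Commute (a₁ ⬝ᵥ x) (l : Quat) := fun x hx => by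
    rw [shift_apply, sub_eq_zero] at hx
    have := Matrix.dotProduct_mulVec a₁ (stMat A) x
    rw [hx, dotProduct_rsmul, ha₁, smul_dotProduct, smul_eq_mul] at this
    exact this
  obtain ⟨x, hx0, hx, hax⟩ : ∃ x, x ≠ 0 ∧ shift (stMat A) l x = 0 ∧ a₁ ⬝ᵥ x = 0 := by
    have hBe' : shift (stMat A) l e = 0 := sub_eq_zero.2 hBe
    by_cases hae : a₁ ⬝ᵥ e = 0
    · exact ⟨e, he, hBe', hae⟩
    obtain ⟨f, hf, hfe⟩ := exists_independent_eigenvector hg e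
    have hc : Commute ((a₁ ⬝ᵥ e)⁻¹ * (a₁ ⬝ᵥ f)) (l : Quat) :=
      (hcomm e hBe').inv_left₀.mul_left (hcomm f hf)
    refine ⟨f - rsmul e ((a₁ ⬝ᵥ e)⁻¹ * (a₁ ⬝ᵥ f)), fun h => hfe _ (sub_eq_zero.1 h), ?_, ?_⟩
    · rw [map_sub, hf, zero_sub, neg_eq_zero, shift_apply, mulVec_rsmul, hBe, rsmul_rsmul,
        rsmul_rsmul, hc.eq, sub_self]
    · rw [dotProduct_sub, dotProduct_rsmul, mul_inv_cancel_left₀ hae, sub_self]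
  -- By semisimplicity no nonzero eigenvector lies in the range, which provides a second row that
  -- does not annihilate `x`.
  have hxr : x ∉ (shift (stMat A) (l : Quat)).range := by
    rintro ⟨z, rfl⟩
    exact hx0 (hssl z hx)
  obtain ⟨a₂, ha₂, hax₂⟩ := exists_left_eigenvector_of_notMem hxr
  set g := a₁ ⬝ᵥ y with hgdef
  -- The correction along `x` leaves the pairing with `a₁` equal to `g` and makes the pairing with
  -- `a₂` equal to `j g`. The condition then becomes `(l j - j l) ‖g‖ ^ 2 ≠ 0`, true for nonreal
  -- `l`.
  refine failure_of_two_rows (norm_pos_iff.2 hl0) rfl rfl ha₁ ha₂ hmax hss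
    (x₀ := y + rsmul x ((a₂ ⬝ᵥ x)⁻¹ * (quatMk 0 0 1 0 * g - a₂ ⬝ᵥ y))) fun h => ?_
  rw [dotProduct_add, dotProduct_add, dotProduct_rsmul, dotProduct_rsmul, hax, zero_mul, add_zero,
    mul_inv_cancel_left₀ hax₂, add_sub_cancel, mul_assoc (quatMk 0 0 1 0), Quaternion.self_mul_star]
    at h
  have h1 := congrArg (fun q : Quat => q.imK) h
  simp at h1
  have h2 : Quaternion.normSq g ≠ 0 := Quaternion.normSq_ne_zero.2 hy
  have h3 : 2 * (l.im * Quaternion.normSq g) = 0 := by linarith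
  simp [him, h2] at h3

/-! ### Components orthogonal to a vector -/

theorem star_dotProduct_self (ξ : Fin n → Quat) :
    star ξ ⬝ᵥ ξ = ((norm2 ξ ^ 2 : ℝ) : Quat) := by
  rw [norm2_sq]
  change ∑ i, star (ξ i) * ξ i = ((∑ i, ‖ξ i‖ ^ 2 : ℝ) : Quat)
  rw [← Quaternion.coeComplex_coe, Complex.ofReal_sum, ← Quaternion.coe_ofComplex, map_sum]
  refine Finset.sum_congr rfl fun i _ => ?_
  rw [Quaternion.star_mul_self, Quaternion.normSq_eq_norm_mul_self, Quaternion.coe_ofComplex,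
    Quaternion.coeComplex_coe, sq]

/-- The component of `z` orthogonal to `ξ`, multiplied by `‖ξ‖ ^ 2`. -/
def perp (ξ : Fin n → Quat) : (Fin n → Quat) →ₗ[Quatᵐᵒᵖ] (Fin n → Quat) where
  toFun z := rsmul z (star ξ ⬝ᵥ ξ) - rsmul ξ (star ξ ⬝ᵥ z)
  map_add' x y := by rw [rsmul_add, dotProduct_add, add_rsmul]; abel
  map_smul' q x := by
    change rsmul (rsmul x q.unop) _ - rsmul ξ (star ξ ⬝ᵥ rsmul x q.unop)
      = rsmul (rsmul x _ - rsmul ξ _) q.unop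
    rw [rsmul_sub, dotProduct_rsmul, rsmul_rsmul, rsmul_rsmul, rsmul_rsmul, star_dotProduct_self,
      Quaternion.coe_commutes]

theorem perp_apply (ξ z : Fin n → Quat) :
    perp ξ z = rsmul z (star ξ ⬝ᵥ ξ) - rsmul ξ (star ξ ⬝ᵥ z) := rfl

@[simp] theorem perp_rsmul_self (ξ : Fin n → Quat) (q : Quat) : perp ξ (rsmul ξ q) = 0 := by
  rw [map_rsmul, perp_apply, sub_self, zero_rsmul]

theorem exists_eq_rsmul_of_perp_eq_zero {ξ z : Fin n → Quat} (hξ : ξ ≠ 0) (h : perp ξ z = 0) :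
    ∃ q, z = rsmul ξ q := by
  have h0 : star ξ ⬝ᵥ ξ ≠ 0 := by
    rw [star_dotProduct_self]
    exact fun h => (pow_pos (norm2_pos hξ) 2).ne' (Quaternion.coe_injective (h.trans rfl))
  refine ⟨(star ξ ⬝ᵥ z) * (star ξ ⬝ᵥ ξ)⁻¹, ?_⟩
  rw [perp_apply, sub_eq_zero] at h
  rw [← rsmul_rsmul, ← h, rsmul_rsmul, mul_inv_cancel₀ h0, rsmul_one]

/-- Because of this homogeneity, vanishing of `perp ξ (M ξ)` survives real rescaling of
eigenvectors. -/
theorem perp_smul_map_smul (M : (Fin n → Quat) →ₗ[Quatᵐᵒᵖ] (Fin n → Quat)) (c : ℝ)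
    (ξ : Fin n → Quat) : perp (c • ξ) (M (c • ξ)) = c ^ 3 • perp ξ (M ξ) := by
  have hstar : ∀ z, star (c • ξ) ⬝ᵥ z = (c : Quat) * (star ξ ⬝ᵥ z) := fun z => by
    have h : star (c • ξ) = (c : Quat) • star ξ := by
      ext1 i
      change star (c • ξ i) = (c : Quat) * star (ξ i)
      ext <;> simp
    rw [h, smul_dotProduct, smul_eq_mul]
  have hcomm : ∀ s : Quat, (c : Quat) * (c * (s * c)) = s * ((c ^ 3 : ℝ) : Quat) := fun s => by
    rw [Quaternion.mul_coe_eq_smul, Quaternion.mul_coe_eq_smul, Quaternion.coe_mul_eq_smul,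
      Quaternion.coe_mul_eq_smul, smul_smul, smul_smul]
    congr 1
    ring
  rw [perp_apply, perp_apply, hstar, hstar, ← rsmul_coe ξ c, map_rsmul, dotProduct_rsmul,
    dotProduct_rsmul, rsmul_rsmul, rsmul_rsmul, hcomm, hcomm, ← rsmul_coe, rsmul_sub, rsmul_rsmul,
    rsmul_rsmul]

theorem continuous_perp_map (M : (Fin n → Quat) →ₗ[Quatᵐᵒᵖ] (Fin n → Quat)) :
    Continuous fun ξ => perp ξ (M ξ) := by
  have hM : Continuous M := (M.restrictScalars ℝ).continuous_of_finiteDimensional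
  refine continuous_pi fun i => ?_
  change Continuous fun ξ : Fin n → Quat =>
    M ξ i * (∑ j, star (ξ j) * ξ j) - ξ i * (∑ j, star (ξ j) * M ξ j)
  fun_prop

theorem quatPolyFun_perp_map (Q M : (Fin n → Quat) →ₗ[Quatᵐᵒᵖ] (Fin n → Quat)) (i : Fin n) :
    QuatPolyFun fun x => perp (Q x) (M (Q x)) i := by
  have hQ := QuatPolyFun.map_apply Q
  have hM := QuatPolyFun.map_apply (M ∘ₗ Q)
  exact ((hM i).mul (QuatPolyFun.sum Finset.univ fun j => (hQ j).star.mul (hQ j))).sub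
    ((hQ i).mul (QuatPolyFun.sum Finset.univ fun j => (hQ j).star.mul (hM j)))

/-! ### A real semisimple dominant eigenvalue -/

/-- The data of the first order reduction at a real semisimple eigenvalue `l` of the standard
part: the spectral projection `Q`, a reduced resolvent `D`. -/
structure Reduction (A : Matrix (Fin n) (Fin n) DualQuat) (l : ℂ)
    (Q D : (Fin n → Quat) →ₗ[Quatᵐᵒᵖ] (Fin n → Quat)) : Prop where
  apply_shift : ∀ x, Q (shift (stMat A) l x) = 0
  resolvent : ∀ x, D (shift (stMat A) l x) = x - Q x
  real : l.im = 0

namespace Reduction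

variable {A : Matrix (Fin n) (Fin n) DualQuat} {l : ℂ}
  {Q D : (Fin n → Quat) →ₗ[Quatᵐᵒᵖ] (Fin n → Quat)}

/-- The dual part of the reduced vector. -/
def dualPart (A : Matrix (Fin n) (Fin n) DualQuat)
    (Q D : (Fin n → Quat) →ₗ[Quatᵐᵒᵖ] (Fin n → Quat)) (v : Fin n → DualQuat) : Fin n → Quat :=
  Q (duVec v) - Q (duMat A *ᵥ D (stVec v))

theorem coe_eq (h : Reduction A l Q D) : (l : Quat) = ((l.re : ℝ) : Quat) := by
  ext <;> simp [h.real]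

theorem map_mulVec (h : Reduction A l Q D) (x : Fin n → Quat) :
    Q (stMat A *ᵥ x) = rsmul (Q x) l := by
  have := h.apply_shift x
  rwa [shift_apply, map_sub, sub_eq_zero, map_rsmul] at this

theorem map_pow_mulVec (h : Reduction A l Q D) (k : ℕ) (x : Fin n → Quat) :
    Q (stMat A ^ k *ᵥ x) = (l.re ^ k) • Q x := by
  induction k with
  | zero => simp
  | succ k ih =>
    rw [pow_succ_mulVec, h.map_mulVec, ih, h.coe_eq, rsmul_coe, smul_smul, pow_succ']

theorem map_shift (h : Reduction A l Q D) (x : Fin n → Quat) (q : Quat) :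
    Q (shift (stMat A) q x) = rsmul (Q x) (l - q) := by
  rw [shift_apply, map_sub, h.map_mulVec, map_rsmul, sub_rsmul]

theorem dualPart_sub (v w : Fin n → DualQuat) :
    dualPart A Q D (v - w) = dualPart A Q D v - dualPart A Q D w := by
  simp only [dualPart, duVec_sub, stVec_sub, map_sub, Matrix.mulVec_sub]
  abel

theorem dualPart_rsmul (v : Fin n → DualQuat) (q : DualQuat) :
    dualPart A Q D (rsmul v q)
      = rsmul (dualPart A Q D v) q.fst + rsmul (Q (stVec v)) q.snd := by
  simp only [dualPart, duVec_rsmul, stVec_rsmul, map_add, map_rsmul, mulVec_rsmul, rsmul_sub]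
  abel

/-- The correction by `C D` in `dualPart` absorbs the contribution of `v_s - Q v_s`. The reduced
pair `(Q v_s, dualPart v)` therefore evolves exactly, with only `Q C Q` coupling its components. -/
theorem dualPart_mulVec (h : Reduction A l Q D) (v : Fin n → DualQuat) :
    dualPart A Q D (A *ᵥ v)
      = rsmul (dualPart A Q D v) l + Q (duMat A *ᵥ Q (stVec v)) := by
  have h1 : D (stMat A *ᵥ stVec v) = stVec v - Q (stVec v) + rsmul (D (stVec v)) l := by
    have := h.resolvent (stVec v)
    rw [shift_apply, map_sub, map_rsmul, sub_eq_iff_eq_add] at this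
    exact this
  simp only [dualPart, duVec_mulVec, stVec_mulVec, map_add, h.map_mulVec, h1, Matrix.mulVec_add,
    Matrix.mulVec_sub, map_sub, mulVec_rsmul, map_rsmul, rsmul_sub]
  abel

theorem dualPart_residual (h : Reduction A l Q D) (v : Fin n → DualQuat) (q : DualQuat) :
    dualPart A Q D (A *ᵥ v - rsmul v q) = rsmul (dualPart A Q D v) (l - q.fst)
      + Q (duMat A *ᵥ Q (stVec v)) - rsmul (Q (stVec v)) q.snd := by
  rw [dualPart_sub, h.dualPart_mulVec, dualPart_rsmul, sub_rsmul]
  abel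

theorem exists_norm_dualPart_le (A : Matrix (Fin n) (Fin n) DualQuat)
    (Q D : (Fin n → Quat) →ₗ[Quatᵐᵒᵖ] (Fin n → Quat)) :
    ∃ C : ℝ, 0 < C ∧ ∀ v, ‖dualPart A Q D v‖ ≤ C * normR v := by
  obtain ⟨C, hC, hCQ⟩ := exists_norm_map_le Q
  obtain ⟨C', hC', hCQ'⟩ := exists_norm_map_le (Q ∘ₗ matLin (duMat A) ∘ₗ D)
  refine ⟨C + C', by positivity, fun v => ?_⟩
  rw [add_mul]
  refine (norm_sub_le _ _).trans (add_le_add ((hCQ _).trans ?_) ((hCQ' (stVec v)).trans ?_))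
  · gcongr; exact norm_duVec_le_normR v
  · gcongr; exact norm_stVec_le_normR v

/-- The reduced operator on the eigenspace. -/
def reduced (A : Matrix (Fin n) (Fin n) DualQuat)
    (Q : (Fin n → Quat) →ₗ[Quatᵐᵒᵖ] (Fin n → Quat)) :
    (Fin n → Quat) →ₗ[Quatᵐᵒᵖ] (Fin n → Quat) := Q ∘ₗ matLin (duMat A)

@[simp] theorem reduced_apply (x : Fin n → Quat) : reduced A Q x = Q (duMat A *ᵥ x) := rfl

/-- The reduced iterates, up to multiples of the reduced start `ξ`. -/
theorem exists_pmVec_eq (h : Reduction A l Q D) (hl : l ≠ 0) (v0 : Fin n → DualQuat) (k : ℕ) :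
    ∃ α : ℝ, Q (stVec (pmVec A v0 k)) = α • Q (stVec v0) ∧
      perp (Q (stVec v0)) (dualPart A Q D (pmVec A v0 k))
        = α • (perp (Q (stVec v0)) (dualPart A Q D v0)
          + (k / l.re) • perp (Q (stVec v0)) (reduced A Q (Q (stVec v0)))) := by
  have hre : l.re ≠ 0 := fun h0 => hl (Complex.ext h0 h.real)
  set ξ := Q (stVec v0) with hξ
  have hsmul : ∀ (f : (Fin n → Quat) →ₗ[Quatᵐᵒᵖ] (Fin n → Quat)) (c : ℝ) x,
      f (c • x) = c • f x := fun f c x => by rw [← rsmul_coe, map_rsmul, rsmul_coe]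
  induction k with
  | zero => exact ⟨1, by simp [pmVec, hξ], by simp [pmVec]⟩
  | succ k ih =>
    obtain ⟨α, hα, hω⟩ := ih
    set ω₀ := perp ξ (dualPart A Q D v0)
    set P := perp ξ (reduced A Q ξ)
    set d := (dualNorm (A *ᵥ pmVec A v0 k))⁻¹ with hd
    have hfst : (ofDualReal d).fst = (d.fst : Quat) := by simp [ofDualReal]
    have hsnd : (ofDualReal d).snd = (d.snd : Quat) := by simp [ofDualReal]
    refine ⟨d.fst * l.re * α, ?_, ?_⟩
    · rw [pmVec, ← hd, stVec_rsmul, hfst, map_rsmul, stVec_mulVec, h.map_mulVec, hα, h.coe_eq,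
        rsmul_coe, rsmul_coe, smul_smul, smul_smul]
    · rw [pmVec, ← hd, dualPart_rsmul, hfst, hsnd, stVec_mulVec, h.map_mulVec, hα,
        h.dualPart_mulVec, hα, h.coe_eq, map_add, map_rsmul, map_add, map_rsmul, hω]
      -- The dual part of the normalization adds only a multiple of `ξ`, which `perp` removes. Each
      -- step then adds one copy of `P` divided by `l`, whence the factor `k / l`.
      have h1 : perp ξ (rsmul (rsmul (α • ξ) ((l.re : ℝ) : Quat)) ((d.snd : ℝ) : Quat)) = 0 := by
        rw [← rsmul_coe ξ α, rsmul_rsmul, rsmul_rsmul, perp_rsmul_self]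
      have h2 : perp ξ (Q (duMat A *ᵥ α • ξ)) = α • P := by
        rw [Matrix.mulVec_smul, hsmul, hsmul]; rfl
      rw [h1, h2, add_zero, rsmul_coe, rsmul_coe]
      push_cast
      have h3 : l.re * ((k + 1 : ℝ) / l.re) = l.re * (k / l.re) + 1 := by field_simp
      simp only [smul_add, smul_smul]
      rw [add_assoc, ← add_smul]
      congr 2
      · ring
      · linear_combination -(d.fst * α) * h3

end Reduction

theorem exists_pos_forall_le {r : ℕ → ℝ} {δ : ℝ} (hδ : 0 < δ) (hr : ∀ k, 0 < r k)
    (h : ∀ᶠ k in atTop, δ ≤ r k) : ∃ ε : ℝ, 0 < ε ∧ ∀ k, ε ≤ r k := by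
  obtain ⟨N, hN⟩ := eventually_atTop.1 h
  have hfin : ∀ N : ℕ, ∃ ε : ℝ, 0 < ε ∧ ∀ k < N, ε ≤ r k := by
    intro N
    induction N with
    | zero => exact ⟨1, one_pos, fun k hk => absurd hk (Nat.not_lt_zero k)⟩
    | succ N ih =>
      obtain ⟨ε, hε, hk⟩ := ih
      refine ⟨min ε (r N), lt_min hε (hr N), fun k hkN => ?_⟩
      rcases Nat.lt_succ_iff_lt_or_eq.1 hkN with h1 | rfl
      · exact (min_le_left _ _).trans (hk k h1)
      · exact min_le_right _ _
  obtain ⟨ε, hε, hk⟩ := hfin N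
  refine ⟨min ε δ, lt_min hε hδ, fun k => ?_⟩
  rcases lt_or_ge k N with h1 | h1
  · exact (min_le_left _ _).trans (hk k h1)
  · exact (min_le_right _ _).trans (hN k h1)

/-- The Rayleigh quotient of a normalized iterate is as close to `l` as the iterate is to being an
eigenvector for `l`. -/
theorem norm_sub_pmVal_le {A : Matrix (Fin n) (Fin n) DualQuat} {v0 : Fin n → DualQuat} {k : ℕ}
    (hu : norm2 (stVec (pmVec A v0 k)) = 1) (l : Quat) :
    ‖l - (pmVal A v0 k).fst‖ ≤ n * ‖shift (stMat A) l (stVec (pmVec A v0 k))‖ := by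
  set u := stVec (pmVec A v0 k) with hudef
  have h1 : (pmVal A v0 k).fst = star u ⬝ᵥ (stMat A *ᵥ u) := by
    rw [pmVal, dot, TrivSqZeroExt.fst_sum, hudef, ← stVec_mulVec]
    refine Finset.sum_congr rfl fun i _ => ?_
    rw [TrivSqZeroExt.fst_mul, fst_conj]
    rfl
  have h2 : l - (pmVal A v0 k).fst = -(star u ⬝ᵥ shift (stMat A) l u) := by
    rw [h1, shift_apply, dotProduct_sub, dotProduct_rsmul, star_dotProduct_self, hu]
    simp
  have h3 : ∀ i, ‖u i‖ ≤ 1 := fun i => (norm_le_pi_norm u i).trans ((norm_le_norm2 u).trans hu.le)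
  rw [h2, norm_neg]
  calc ‖star u ⬝ᵥ shift (stMat A) l u‖ ≤ ∑ i, ‖u i‖ * ‖shift (stMat A) l u i‖ := by
        refine (norm_sum_le _ _).trans (Finset.sum_le_sum fun i _ => ?_)
        rw [norm_mul, Pi.star_apply, norm_star]
    _ ≤ ∑ _i : Fin n, 1 * ‖shift (stMat A) l u‖ := by
        gcongr with i
        · exact h3 i
        · exact norm_le_pi_norm _ i
    _ = n * ‖shift (stMat A) l u‖ := by simp

open Reduction

/-! ### Failure for a real semisimple dominant eigenvalue -/

section Real

variable {A : Matrix (Fin n) (Fin n) DualQuat} {l : ℂ}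
  {Q D : (Fin n → Quat) →ₗ[Quatᵐᵒᵖ] (Fin n → Quat)} {v0 : Fin n → DualQuat}

theorem Reduction.pow_mulVec_ne_zero (h : Reduction A l Q D) (hl : l ≠ 0)
    (hξ : Q (stVec v0) ≠ 0) (k : ℕ) : stMat A ^ k *ᵥ stVec v0 ≠ 0 := fun h0 => by
  have hre : l.re ≠ 0 := fun h0 => hl (Complex.ext h0 h.real)
  have h1 := h.map_pow_mulVec k (stVec v0)
  rw [h0, map_zero] at h1
  exact smul_ne_zero (pow_ne_zero k hre) hξ h1.symm

theorem Reduction.norm_eq (h : Reduction A l Q D) : ‖l‖ = |l.re| := by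
  rw [← norm_coeComplex, h.coe_eq, Quaternion.norm_coe, Real.norm_eq_abs]

/-- The reduced standard parts of the iterates stay away from zero. -/
theorem Reduction.exists_lower_bound (h : Reduction A l Q D) (hl : l ≠ 0)
    (hξ : Q (stVec v0) ≠ 0) {C : ℝ} (hC : ∀ k, ‖stMat A ^ k *ᵥ stVec v0‖ ≤ C * ‖l‖ ^ k) :
    ∃ c : ℝ, 0 < c ∧ ∀ k, 1 ≤ k → ∀ α : ℝ,
      Q (stVec (pmVec A v0 k)) = α • Q (stVec v0) → c ≤ |α| := by
  have hx := h.pow_mulVec_ne_zero hl hξ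
  have hl0 : 0 < ‖l‖ := norm_pos_iff.2 hl
  have hξ0 : 0 < ‖Q (stVec v0)‖ := norm_pos_iff.2 hξ
  have hC0 : 0 < C := by
    have h1 := (norm_pos_iff.2 (hx 0)).trans_le (hC 0)
    rwa [pow_zero ‖l‖, mul_one] at h1
  -- Here `|α| = s ‖l‖ ^ k`, and normalization gives `1 ≤ n s ‖B ^ k x‖ ≤ n s C ‖l‖ ^ k`.
  refine ⟨(C * (n + 1))⁻¹, by positivity, fun k hk α hα => ?_⟩
  obtain ⟨s, hs, hsk⟩ := exists_stVec_pmVec A v0 k hx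
  have hn := one_le_mul_norm_stVec_pmVec hx hk
  have h1 : |α| = s * ‖l‖ ^ k := by
    rw [hsk, ← rsmul_coe, map_rsmul, rsmul_coe, h.map_pow_mulVec, smul_smul] at hα
    have h2 := congrArg norm hα
    rw [norm_smul, norm_smul, Real.norm_eq_abs, Real.norm_eq_abs] at h2
    rw [← mul_right_cancel₀ hξ0.ne' h2, abs_mul, abs_of_pos hs, abs_pow, h.norm_eq]
  rw [hsk, norm_smul, Real.norm_of_nonneg hs.le] at hn
  rw [h1, inv_le_iff_one_le_mul₀' (by positivity)]
  calc 1 ≤ n * (s * ‖stMat A ^ k *ᵥ stVec v0‖) := hn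
    _ ≤ (n + 1) * (s * (C * ‖l‖ ^ k)) := by
        gcongr
        · linarith
        · exact hC k
    _ = _ := by ring

/-- Unless `Q w_s` vanishes, the eigenvalue has standard part `l`. The reduced equation then reads
`Q C (Q w_s) = (Q w_s) μ_d`. -/
theorem Reduction.perp_eigenvector (h : Reduction A l Q D) {w : Fin n → DualQuat} {μ : DualQuat}
    (hw : A *ᵥ w = rsmul w μ) : perp (Q (stVec w)) (reduced A Q (Q (stVec w))) = 0 := by
  by_cases hw0 : Q (stVec w) = 0
  · rw [hw0, map_zero, map_zero]
  have h1 := h.map_shift (stVec w) μ.fst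
  rw [((mulVec_eq_rsmul_iff _ _ _).1 hw).1, map_zero] at h1
  have h2 : (l : Quat) - μ.fst = 0 := (rsmul_eq_zero h1.symm).resolve_left hw0
  have h3 := h.dualPart_residual w μ
  have h4 : dualPart A Q D (0 : Fin n → DualQuat) = 0 := by
    have := dualPart_sub (A := A) (Q := Q) (D := D) w w
    rwa [sub_self, sub_self] at this
  rw [hw, sub_self, h4, h2, rsmul_zero, zero_add] at h3
  have h5 := sub_eq_zero.1 h3.symm
  rw [reduced_apply, h5, perp_rsmul_self]

/-- Standard parts alone give the contradiction: suitably rescaled, `Q w_s` would tend to `ξ`, while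
the continuous map `perp ξ (Q C ξ)` vanishes along the sequence and not at the limit. -/
theorem Reduction.not_approaches (h : Reduction A l Q D) (hl : l ≠ 0)
    (hP : perp (Q (stVec v0)) (reduced A Q (Q (stVec v0))) ≠ 0) {C : ℝ}
    (hC : ∀ k, ‖stMat A ^ k *ᵥ stVec v0‖ ≤ C * ‖l‖ ^ k) :
    ¬ ApproachesEigenvectors A v0 Set.univ := by
  rintro ⟨w, hw, hlim⟩
  have hξ : Q (stVec v0) ≠ 0 := fun h0 => hP (by rw [h0, map_zero, map_zero])
  obtain ⟨c, hc, hcα⟩ := h.exists_lower_bound hl hξ hC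
  choose α hα _ using fun k => h.exists_pmVec_eq hl v0 k
  obtain ⟨CQ, hCQ, hCQ'⟩ := exists_norm_map_le Q
  set ξ := Q (stVec v0) with hξdef
  set ζ : ℕ → Fin n → Quat := fun k => (α k)⁻¹ • Q (stVec (w k)) with hζ
  have hζlim : Tendsto ζ atTop (𝓝 ξ) := by
    rw [tendsto_iff_norm_sub_tendsto_zero]
    have hz : Tendsto (fun k => c⁻¹ * (CQ * normR (pmVec A v0 k - w k))) atTop (𝓝 0) := by
      simpa using (hlim.const_mul CQ).const_mul c⁻¹
    refine squeeze_zero' (Eventually.of_forall fun k => norm_nonneg _) ?_ hz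
    filter_upwards [eventually_ge_atTop 1] with k hk
    have hck := hcα k hk (α k) (hα k)
    have hα0 : α k ≠ 0 := abs_pos.1 (hc.trans_le hck)
    have h1 : ζ k - ξ = -((α k)⁻¹ • Q (stVec (pmVec A v0 k - w k))) := by
      rw [stVec_sub, map_sub, hα, smul_sub, smul_smul, inv_mul_cancel₀ hα0, one_smul, neg_sub]
    rw [h1, norm_neg, norm_smul, norm_inv, Real.norm_eq_abs]
    gcongr
    refine (hCQ' _).trans ?_
    gcongr
    exact norm_stVec_le_normR (pmVec A v0 k - w k)
  have hζ0 : ∀ k, perp (ζ k) (reduced A Q (ζ k)) = 0 := fun k => by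
    obtain ⟨μ, -, -, hμ⟩ := hw k
    rw [hζ, perp_smul_map_smul, h.perp_eigenvector hμ, smul_zero]
  have h2 := ((continuous_perp_map (reduced A Q)).tendsto ξ).comp hζlim
  refine hP (tendsto_nhds_unique h2 ?_)
  simp only [Function.comp_def, hζ0]
  exact tendsto_const_nhds

/-- The residual controls the defect of the reduced iterate. -/
theorem Reduction.exists_residual_bound (h : Reduction A l Q D) (hl : l ≠ 0)
    (v0 : Fin n → DualQuat) : ∃ C : ℝ, 0 < C ∧ ∀ k, ∃ α : ℝ,
      Q (stVec (pmVec A v0 k)) = α • Q (stVec v0) ∧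
      |α| * (‖perp (Q (stVec v0)) (reduced A Q (Q (stVec v0)))‖ -
        (‖perp (Q (stVec v0)) (dualPart A Q D v0)‖
          + k / ‖l‖ * ‖perp (Q (stVec v0)) (reduced A Q (Q (stVec v0)))‖)
        * ‖(l : Quat) - (pmVal A v0 k).fst‖) ≤ C * pmResidual A v0 k := by
  set ξ := Q (stVec v0) with hξ
  obtain ⟨C₁, hC₁, hC₁'⟩ := exists_norm_map_le (perp ξ)
  obtain ⟨C₂, hC₂, hC₂'⟩ := exists_norm_dualPart_le A Q D
  refine ⟨C₁ * C₂, by positivity, fun k => ?_⟩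
  obtain ⟨α, hα, hω⟩ := h.exists_pmVec_eq hl v0 k
  refine ⟨α, hα, ?_⟩
  set ω₀ := perp ξ (dualPart A Q D v0)
  set P := perp ξ (reduced A Q ξ) with hP
  set d := (l : Quat) - (pmVal A v0 k).fst with hd
  -- Projecting orthogonally to `ξ` discards the term with the dual part of the eigenvalue estimate,
  -- about which nothing is known.
  have h1 := congrArg (perp ξ) (h.dualPart_residual (pmVec A v0 k) (pmVal A v0 k))
  have h2 : perp ξ (rsmul (Q (stVec (pmVec A v0 k))) (pmVal A v0 k).snd) = 0 := by
    rw [hα, ← hξ, ← rsmul_coe, rsmul_rsmul, perp_rsmul_self]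
  have h3 : perp ξ (Q (duMat A *ᵥ Q (stVec (pmVec A v0 k)))) = α • P := by
    rw [hα, ← reduced_apply (A := A), ← rsmul_coe, map_rsmul, map_rsmul, rsmul_coe]
  rw [map_sub, map_add, h2, h3, map_rsmul, hω, sub_zero] at h1
  have h4 : ‖rsmul (α • (ω₀ + ((k : ℝ) / l.re) • P)) d + α • P‖ ≤ C₁ * C₂ * pmResidual A v0 k := by
    rw [← h1, mul_assoc]
    refine (hC₁' _).trans ?_
    gcongr
    exact hC₂' _
  refine le_trans ?_ h4
  have h5 : ‖rsmul (α • (ω₀ + ((k : ℝ) / l.re) • P)) d‖ ≤ |α| * (‖ω₀‖ + k / ‖l‖ * ‖P‖) * ‖d‖ := by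
    rw [norm_rsmul, norm_smul, Real.norm_eq_abs]
    gcongr
    refine (norm_add_le _ _).trans (add_le_add le_rfl (le_of_eq ?_))
    rw [norm_smul, norm_div, Real.norm_natCast, Real.norm_eq_abs, h.norm_eq]
  have h6 := norm_sub_norm_le (α • P) (-rsmul (α • (ω₀ + ((k : ℝ) / l.re) • P)) d)
  rw [norm_neg, sub_neg_eq_add, add_comm (α • P), norm_smul, Real.norm_eq_abs] at h6
  linarith

/-- The reduced dual part grows only linearly in `k`, while `l` minus the standard part of the
eigenvalue estimate decays geometrically. Their product disappears from the residual bound, which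
leaves a positive multiple of `‖P‖`. -/
theorem Reduction.exists_delta (h : Reduction A l Q D) (hl : l ≠ 0)
    (hst : StrictlyLargest (stMat A) l) (hss : Semisimple (stMat A) l)
    (hP : perp (Q (stVec v0)) (reduced A Q (Q (stVec v0))) ≠ 0) {C : ℝ}
    (hC : ∀ k, ‖stMat A ^ k *ᵥ stVec v0‖ ≤ C * ‖l‖ ^ k) :
    ∃ δ : ℝ, 0 < δ ∧ ∀ k : ℕ, δ ≤ pmResidual A v0 k := by
  have hξ : Q (stVec v0) ≠ 0 := fun h0 => hP (by rw [h0, map_zero, map_zero])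
  have hx := h.pow_mulVec_ne_zero hl hξ
  have hl0 : 0 < ‖l‖ := norm_pos_iff.2 hl
  have hξ0 : 0 < ‖Q (stVec v0)‖ := norm_pos_iff.2 hξ
  have hP0 := norm_pos_iff.2 hP
  obtain ⟨c, hc, hcα⟩ := h.exists_lower_bound hl hξ hC
  obtain ⟨K, hK, hKr⟩ := h.exists_residual_bound hl v0
  obtain ⟨CQ, hCQ, hCQ'⟩ := exists_norm_map_le Q
  obtain ⟨C₂, r, hC₂, hr, hrl, hdecay⟩ :=
    exists_norm_pow_mulVec_shift_le hl h.real hst hss (stVec v0)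
  set P := perp (Q (stVec v0)) (reduced A Q (Q (stVec v0)))
  set ω₀ := perp (Q (stVec v0)) (dualPart A Q D v0)
  have hQu : ∀ k, Q (stVec (pmVec A v0 k)) ≠ 0 := fun k => by
    obtain ⟨s, hs, hsk⟩ := exists_stVec_pmVec A v0 k hx
    have hre : l.re ≠ 0 := fun h0 => hl (Complex.ext h0 h.real)
    rw [hsk, ← rsmul_coe, map_rsmul, rsmul_coe, h.map_pow_mulVec]
    exact smul_ne_zero hs.ne' (smul_ne_zero (pow_ne_zero k hre) hξ)
  -- The asymptotic bound leaves finitely many indices. At any index a zero residual would make the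
  -- standard part of the estimate equal to `l`, and the residual bound would give `P = 0`.
  have hpos : ∀ k, 0 < pmResidual A v0 k := fun k => by
    refine lt_of_le_of_ne (normR_nonneg _) fun h0 => ?_
    obtain ⟨α, hα, hαr⟩ := hKr k
    have hα0 : 0 < |α| := abs_pos.2 fun h0 => hQu k (by rw [hα, h0, zero_smul])
    have hs := norm_shift_stVec_pmVec_le_pmResidual A v0 k
    rw [← h0, norm_le_zero_iff] at hs
    have h1 := h.map_shift (stVec (pmVec A v0 k)) (pmVal A v0 k).fst
    rw [hs, map_zero] at h1
    have h2 := (rsmul_eq_zero h1.symm).resolve_left (hQu k)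
    rw [h2, ← h0, norm_zero, mul_zero, mul_zero, sub_zero] at hαr
    exact absurd hαr (not_le.2 (by positivity))
  set t := r / ‖l‖ with ht
  have ht0 : 0 < t := by positivity
  have ht1 : t < 1 := (div_lt_one hl0).2 hrl
  -- The Rayleigh quotient error is bounded by the defect for `l`, and this is `O(r ^ k)` before
  -- normalization.
  have hd : ∀ k, 1 ≤ k → ‖(l : Quat) - (pmVal A v0 k).fst‖
      ≤ n * C₂ * (CQ / ‖Q (stVec v0)‖) * t ^ k := fun k hk => by
    obtain ⟨s, hs, hsk⟩ := exists_stVec_pmVec A v0 k hx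
    have hsb : s * ‖l‖ ^ k ≤ CQ / ‖Q (stVec v0)‖ := by
      rw [le_div_iff₀ hξ0]
      have h1 := (hCQ' (stVec (pmVec A v0 k))).trans
        (mul_le_mul_of_nonneg_left (norm_stVec_pmVec_le hx hk) hCQ.le)
      rw [hsk, ← rsmul_coe, map_rsmul, rsmul_coe, h.map_pow_mulVec, smul_smul, norm_smul,
        norm_mul, norm_pow, Real.norm_eq_abs, Real.norm_eq_abs, ← h.norm_eq, abs_of_pos hs,
        mul_one] at h1
      exact h1
    refine (norm_sub_pmVal_le (norm2_stVec_pmVec hx hk) l).trans ?_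
    rw [hsk, shift_smul_eq, abs_of_pos hs, shift_apply, ← pow_mulVec_shift]
    calc (n : ℝ) * (s * ‖stMat A ^ k *ᵥ shift (stMat A) l (stVec v0)‖)
        ≤ n * (s * (C₂ * r ^ k)) := by gcongr; exact hdecay k
      _ = n * C₂ * (s * ‖l‖ ^ k) * t ^ k := by rw [ht, div_pow]; field_simp
      _ ≤ _ := by gcongr
  have hlim : Tendsto (fun k : ℕ => (‖ω₀‖ + k / ‖l‖ * ‖P‖)
      * (n * C₂ * (CQ / ‖Q (stVec v0)‖) * t ^ k)) atTop (𝓝 0) := by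
    have h1 := (tendsto_pow_atTop_nhds_zero_of_lt_one ht0.le ht1).const_mul
      (‖ω₀‖ * (n * C₂ * (CQ / ‖Q (stVec v0)‖)))
    have h2 := (tendsto_self_mul_const_pow_of_lt_one ht0.le ht1).const_mul
      (‖P‖ / ‖l‖ * (n * C₂ * (CQ / ‖Q (stVec v0)‖)))
    have h3 := h1.add h2
    rw [mul_zero, mul_zero, add_zero] at h3
    refine h3.congr fun k => ?_
    ring
  refine exists_pos_forall_le (δ := c * (‖P‖ / 2) / K) (by positivity) hpos ?_
  filter_upwards [eventually_ge_atTop 1, hlim.eventually_le_const (half_pos hP0)] with k hk hk'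
  obtain ⟨α, hα, hαr⟩ := hKr k
  have h1 : (‖ω₀‖ + k / ‖l‖ * ‖P‖) * ‖(l : Quat) - (pmVal A v0 k).fst‖ ≤ ‖P‖ / 2 := by
    refine le_trans ?_ hk'
    gcongr
    exact hd k hk
  rw [div_le_iff₀' hK]
  refine le_trans ?_ hαr
  have h2 := hcα k hk α hα
  gcongr
  linarith

end Real

theorem failure_of_real {A : Matrix (Fin n) (Fin n) DualQuat} {l : ℂ} (hl0 : l ≠ 0)
    (hl : IsStandardEigenvalue (stMat A) l) (him : l.im = 0)
    (hmax : ∀ μ, IsStandardEigenvalue (stMat A) μ → ‖μ‖ ≤ ‖l‖)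
    (hst : StrictlyLargest (stMat A) l)
    (hss : ∀ μ, IsStandardEigenvalue (stMat A) μ → ‖μ‖ = ‖l‖ → Semisimple (stMat A) μ)
    (hA : ¬ SpectralAssumption A) :
    ∃ p : MvPolynomial (Fin n × Fin 4) ℝ, p ≠ 0 ∧
      ∀ v0 : Fin n → DualQuat, MvPolynomial.eval (coords (stVec v0)) p ≠ 0 →
        WellDefined A v0 ∧ NoEigenpair A v0 := by
  have hssl := hss l hl rfl
  obtain ⟨Q, D, hQk, hQr, -, hD, hQ⟩ :=
    exists_spectral_projection (T := shiftLin (stMat A) l him) hssl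
  have h : Reduction A l Q D := ⟨hQr, hD, him⟩
  obtain ⟨e, he, hne⟩ := exists_eigenvector_not_liftable hl hst hssl him hA hQ
  have hQe : Q e = e := hQk e he
  have he0 : e ≠ 0 := fun h0 => hne 0 (by rw [h0, Matrix.mulVec_zero, map_zero, zero_rsmul])
  have hP : perp (Q e) (reduced A Q (Q e)) ≠ 0 := fun h0 => by
    rw [hQe] at h0
    obtain ⟨q, hq⟩ := exists_eq_rsmul_of_perp_eq_zero he0 h0
    exact hne q hq
  -- A coordinate that is nonzero at the non-liftable eigenvector `e` supplies the polynomial.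
  obtain ⟨i, hi⟩ := Function.ne_iff.1 hP
  obtain ⟨p, hp0, hp⟩ := (quatPolyFun_perp_map Q (reduced A Q) i).exists_polynomial hi
  refine ⟨p, hp0, fun v0 hv0 => ?_⟩
  have hP0 : perp (Q (stVec v0)) (reduced A Q (Q (stVec v0))) ≠ 0 := fun h0 =>
    hp _ hv0 (by rw [h0]; rfl)
  have hξ : Q (stVec v0) ≠ 0 := fun h0 => hP0 (by rw [h0, map_zero, map_zero])
  obtain ⟨C, -, hC⟩ := exists_norm_pow_mulVec_le_of_semisimple hmax hss (stVec v0)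
  exact ⟨wellDefined_of_pow_ne_zero (h.pow_mulVec_ne_zero hl0 hξ),
    h.not_approaches hl0 hP0 hC, h.exists_delta hl0 hst hssl hP0 hC⟩

/-- If all eigenvalues of maximal magnitude are semisimple and the spectral assumption fails, no
eigenpair is produced from generic starts. -/
theorem failure_of_semisimple {A : Matrix (Fin n) (Fin n) DualQuat} {l : ℂ} (hl0 : l ≠ 0)
    (hl : IsStandardEigenvalue (stMat A) l)
    (hmax : ∀ μ, IsStandardEigenvalue (stMat A) μ → ‖μ‖ ≤ ‖l‖)
    (hss : ∀ μ, IsStandardEigenvalue (stMat A) μ → ‖μ‖ = ‖l‖ → Semisimple (stMat A) μ)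
    (hA : ¬ SpectralAssumption A) :
    ∃ p : MvPolynomial (Fin n × Fin 4) ℝ, p ≠ 0 ∧
      ∀ v0 : Fin n → DualQuat, MvPolynomial.eval (coords (stVec v0)) p ≠ 0 →
        WellDefined A v0 ∧ NoEigenpair A v0 := by
  by_cases h1 : CaseI A l
  · obtain ⟨μ, hμ, hne, hnorm⟩ := h1
    exact failure_of_two_eigenvalues hl0 hl hμ hne hnorm hmax hss
  have hst := strictlyLargest_of_not_caseI hmax h1
  by_cases him : l.im = 0
  · exact failure_of_real hl0 hl him hmax hst hss hA
  · exact failure_of_nonreal hl him (one_lt_geomMult hl hst (hss l hl rfl) hA) hmax hss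

end

end DQPower

/-! ### The main theorem: classification and generic failure -/

open DQPower
theorem theorem3p7 (n : ℕ) (A : Matrix (Fin n) (Fin n) DualQuat) (l : ℂ)
    (hl : IsStandardEigenvalue (stMat A) l)
    (hmax : ∀ μ : ℂ, IsStandardEigenvalue (stMat A) μ → ‖μ‖ ≤ ‖l‖)
    (hl0 : l ≠ 0)
    (hA : ¬ SpectralAssumption A) :
    (CaseI A l ∨ CaseII A l ∨ CaseIII A l ∨ CaseIV A l ∨ CaseV A l) ∧
    ∃ p : MvPolynomial (Fin n × Fin 4) ℝ, p ≠ 0 ∧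
      ∀ v0 : Fin n → DualQuat, MvPolynomial.eval (coords (stVec v0)) p ≠ 0 →
        WellDefined A v0 ∧
        (∀ μ : DualQuat, IsStrictDominant A μ →
          ¬ ApproachesEigenvectors A v0 {ν | Similar μ ν}) ∧
        (∀ c : ℝ, 0 < c → c < 1 →
          ¬ pmResidual A v0 =O[Filter.atTop] (fun k => c ^ k) ∧
          ¬ ApproachesEigenvectorsAtRate A v0 c) ∧
        ((∀ μ : ℂ, IsStandardEigenvalue (stMat A) μ → ‖μ‖ = ‖l‖ →
            algMult μ (stMat A) = geomMult μ (stMat A)) →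
          ¬ ApproachesEigenvectors A v0 Set.univ ∧
          ∃ δ : ℝ, 0 < δ ∧ ∀ k : ℕ, δ ≤ pmResidual A v0 k) := by
  refine ⟨cases_of_not_spectralAssumption hl hmax hA, ?_⟩
  -- The split concerns all eigenvalues of maximal magnitude, not only `l`: in the first case
  -- another one may be defective while `l` is semisimple.
  by_cases hss : ∀ μ, IsStandardEigenvalue (stMat A) μ → ‖μ‖ = ‖l‖ → Semisimple (stMat A) μ
  · obtain ⟨p, hp0, hp⟩ := failure_of_semisimple hl0 hl hmax hss hA
    refine ⟨p, hp0, fun v0 hv0 => ?_⟩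
    obtain ⟨hwd, hno⟩ := hp v0 hv0
    exact ⟨hwd, fun μ _ => hno.not_approaches _, fun c hc0 hc1 => hno.not_rate hc0 hc1,
      fun _ => hno⟩
  · push Not at hss
    obtain ⟨ν, hν, hνl, hdef⟩ := hss
    have hν0 : ν ≠ 0 := norm_pos_iff.1 (by rw [hνl]; exact norm_pos_iff.2 hl0)
    obtain ⟨p, hp0, hp⟩ := failure_of_defective hν0 (by rwa [hνl]) hdef
    refine ⟨p, hp0, fun v0 hv0 => ?_⟩
    obtain ⟨hwd, hb, hc⟩ := hp v0 hv0
    -- The premise of the last claim contradicts the defectiveness of `ν`.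
    exact ⟨hwd, hb, hc, fun heq => absurd (semisimple_of_algMult_eq (heq ν hν hνl)) hdef⟩
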